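/- **Setting.** Let $T>0$, $M,M^0\ge 1$, $\mathcal P=\{x\in\mathbb R^{M-1}: x_i\ge 0,\ \sum_i x_i\le 1\}$ with the Euclidean norm, $x_M:=1-\sum_{i<M}x_i$, and, for $N\ge 1$, $\mathcal P^N=\{\frac1N(n_1,\dots,n_{M-1}): n_i\in\mathbb N,\ \sum_i n_i\le N\}$. Let $A_0,A$ be convex subsets of real normed spaces. The data are jump rates $q^0(t,i^0,j^0,\alpha^0,x)$ and $q(t,i,j,\alpha,i^0,\alpha^0,x)$, which are Q-matrices in $(i^0,j^0)\in\{1,\dots,M^0\}^2$, resp. $(i,j)\in\{1,\dots,M\}^2$, running costs $f^0(t,i^0,\alpha^0,x)$, $f(t,i,\alpha,i^0,\alpha^0,x)$ and terminal costs $g^0(i^0,x)$, $g(i,i^0,x)$, for $t\in[0,T]$, $\alpha^0\in A_0$, $\alpha\in A$, $x\in\mathcal P$. All of them are Lipschitz in $(t,x,\alpha^0,\alpha)$ for fixed discrete states, with a constant $K$, and $|q|\le C$. Let $\phi^0(t,i^0,x)\in A_0$ and $\phi(t,i,i^0,x),\bar\phi(t,i,i^0,x)\in A$ be feedback functions that are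 $K$-Lipschitz in $(t,x)$. Put $q^0_{\phi^0}(t,i^0,j^0,x)=q^0(t,i^0,j^0,\phi^0(t,i^0,x),x)$, $q_{\phi^0,\phi}(t,i,j,i^0,x)=q(t,i,j,\phi(t,i,i^0,x),i^0,\phi^0(t,i^0,x),x)$, and define $f^0_{\phi^0}$, $f_{\phi^0,\bar\phi}$ likewise. Let $B$ be a bound for $|f^0_{\phi^0}|,|f_{\phi^0,\bar\phi}|,|g^0|,|g|$. Let $e_{ij}=e_j1_{j\ne M}-e_i1_{i\ne M}$, with $e_i$ the canonical basis of $\mathbb R^{M-1}$. **Processes.** Consider Markov processes on $[0,T]$ with the following generators. In the game with $N$ minor players, $(X^{0,N},\mu^N)$ on $\{1,\dots,M^0\}\times\mathcal P^N$ has $$\begin{aligned}\mathcal G^{0,N}F(t,i^0,x)={}&\partial_tF+\sum_{j^0\ne i^0}[F(t,j^0,x)-F(t,i^0,x)]\,q^0_{\phi^0}(t,i^0,j^0,x)\\&+\sum_{i}\sum_{j\neq i}[F(t,i^0,x+\tfrac1Ne_{ij})-F(t,i^0,x)]\,Nx_i\,q_{\phi^0,\phi}(t,i,j,i^0,x),\end{aligned}$$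 and $(X^N,X^{0,N},\mu^N)$, where $X^N$ is the state of one singled-out minor player who uses $\bar\phi$ while the $N-1$ others use $\phi$, has $$\begin{aligned}\mathcal G^{N}F(t,i,i^0,x)={}&\partial_tF+\sum_{j^0\ne i^0}[F(t,i,j^0,x)-F(t,i,i^0,x)]\,q^0_{\phi^0}(t,i^0,j^0,x)\\&+\sum_{j\ne i}[F(t,j,i^0,x+\tfrac1Ne_{ij})-F(t,i,i^0,x)]\,q_{\phi^0,\bar\phi}(t,i,j,i^0,x)\\&+\sum_k\sum_{j\ne k}[F(t,i,i^0,x+\tfrac1Ne_{kj})-F(t,i,i^0,x)]\,(Nx_k-1_{k=i})\,q_{\phi^0,\phi}(t,k,j,i^0,x)\end{aligned}$$ (for $F$ of class $C^1$ in $t$). Their mean-field counterparts $(X^0,\mu)$ on $\{1,\dots,M^0\}\times\mathcal P$ and $(X,X^0,\mu)$ on $\{1,\dots,M\}\times\{1,\dots,M^0\}\times\mathcal P$ have (for $F$ of class $C^1$ in $(t,x)$) $$\begin{aligned}\mathcal G^0F(t,i^0,x)={}&\partial_tF+\sum_{j^0\ne i^0}[F(t,j^0,x)-F(t,i^0,x)]\,q^0_{\phi^0}(t,i^0,j^0,x)+\sum_{k=1}^{M}\sum_{j=1}^{M-1}\partial_{x_j}F\;x_k\,q_{\phi^0,\phi}(t,k,j,i^0,x),\\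 \mathcal GF(t,i,i^0,x)={}&\partial_tF+\sum_{j^0\ne i^0}[F(t,i,j^0,x)-F(t,i,i^0,x)]\,q^0_{\phi^0}(t,i^0,j^0,x)\\&+\sum_{j\ne i}[F(t,j,i^0,x)-F(t,i,i^0,x)]\,q_{\phi^0,\bar\phi}(t,i,j,i^0,x)+\sum_{k=1}^{M}\sum_{j=1}^{M-1}\partial_{x_j}F\;x_k\,q_{\phi^0,\phi}(t,k,j,i^0,x).\end{aligned}$$ A Markov process $Z$ has generator $\mathcal G$ if $\mathbb E[F(s,Z_s)|Z_t=z]=F(t,z)+\mathbb E[\int_t^s\mathcal GF(u,Z_u)\,du\,|\,Z_t=z]$ for all these $F$ and all $0\le t\le s\le T$. **Costs.** The major player's expected costs are $$J^{0,N}_{\phi^0,\phi}(t,i^0,x)=\mathbb E\Big[\int_t^Tf^0_{\phi^0}(s,X^{0,N}_s,\mu^N_s)ds+g^0(X^{0,N}_T,\mu^N_T)\,\Big|\,X^{0,N}_t=i^0,\mu^N_t=x\Big]$$ and $J^0_{\phi^0,\phi}(t,i^0,x)$, the same expression for $(X^0,\mu)$. The singled-out minor player's are $$J^{N}_{\phi^0,\phi,\bar\phi}(t,i,i^0,x)=\mathbb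 E\Big[\int_t^Tf_{\phi^0,\bar\phi}(s,X^N_s,X^{0,N}_s,\mu^N_s)ds+g(X^N_T,X^{0,N}_T,\mu^N_T)\,\Big|\,X^N_t=i,X^{0,N}_t=i^0,\mu^N_t=x\Big]$$ and $J_{\phi^0,\phi,\bar\phi}(t,i,i^0,x)$, the same expression for $(X,X^0,\mu)$. **Theorem.** The processes above exist, and there is a constant $L$ depending only on $T,M,M^0,K,C,B$ such that for all $N\ge 1$, $t\in[0,T]$, $x\in\mathcal P^N$, $i^0\in\{1,\dots,M^0\}$ and $i\in\{1,\dots,M\}$ $$|J^{0,N}_{\phi^0,\phi}(t,i^0,x)-J^0_{\phi^0,\phi}(t,i^0,x)|\le \frac L{\sqrt N},\qquad |J^{N}_{\phi^0,\phi,\bar\phi}(t,i,i^0,x)-J_{\phi^0,\phi,\bar\phi}(t,i,i^0,x)|\le\frac L{\sqrt N}.$$ In the second bound the states $(i,i^0,x)$ of the finite game are those with $x_i\ge 1/N$ (the singled-out player is one of the $N$ players that $x$ counts), and $\mathcal G^N$ acts on this state space. If moreover no player can leave a nearly extinct state, i.e. there is $\varepsilon>0$ such that $q(t,i,j,\alpha,i^0,\alpha^0,x)=0$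 whenever $j\ne i$ and $x_i<\varepsilon$ (for all $t,\alpha,i^0,\alpha^0$), then $\mathcal G^N$ also defines a process on all of $\{1,\dots,M\}\times\{1,\dots,M^0\}\times\mathcal P^N$, and the second bound holds for all $(i,i^0,x)$ in it, with the same $L$. -/

import Mathlib

open MeasureTheory ProbabilityTheory

noncomputable section

namespace MajorMinor

/-! ## Simplex, grid, jump directions

The minor players have `M = m + 1` states, indexed by `Fin (m + 1)`; the state `Fin.last m` plays
the role of the state `M`. A distribution on the minor states is coded by its first `M - 1` weights. -/

/-- `ℝ^(M-1)` with its Euclidean norm. -/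
abbrev Vec (m : ℕ) : Type := EuclideanSpace ℝ (Fin m)

/-- The weight `x_i`, with the convention `x_M = 1 - ∑ x_k`. -/
def coord {m : ℕ} (x : Vec m) (i : Fin (m + 1)) : ℝ :=
  Fin.lastCases (motive := fun _ => ℝ) (1 - ∑ k, x k) (fun k => x k) i

/-- The simplex `𝒫`. -/
def simplex (m : ℕ) : Set (Vec m) := {x | (∀ k, 0 ≤ x k) ∧ ∑ k, x k ≤ 1}

/-- The set `𝒫^N` of possible empirical distributions of `N` minor players. -/
def grid (m N : ℕ) : Set (Vec m) :=
  {x | ∃ n : Fin m → ℕ, ∑ k, n k ≤ N ∧ ∀ k, x k = (n k : ℝ) / N}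

theorem grid_subset_simplex {m N : ℕ} {x : Vec m} (hx : x ∈ grid m N) : x ∈ simplex m := by
  obtain ⟨n, hn, hx⟩ := hx
  refine ⟨fun k => by rw [hx k]; positivity, ?_⟩
  simp only [hx]
  rw [← Finset.sum_div]
  exact div_le_one_of_le₀ (by exact_mod_cast hn) (by positivity)

/-- `e_i` for `i ≠ M`, and `0` for `i = M`. -/
def vertex {m : ℕ} (i : Fin (m + 1)) : Vec m :=
  Fin.lastCases (motive := fun _ => Vec m) 0 (fun k => EuclideanSpace.single k 1) i

/-- `e_{ij} = e_j 1_{j ≠ M} - e_i 1_{i ≠ M}`. -/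
def jump {m : ℕ} (i j : Fin (m + 1)) : Vec m := vertex j - vertex i

/-- Q-matrices. -/
def IsQMatrix {ι : Type*} [Fintype ι] [DecidableEq ι] (Q : ι → ι → ℝ) : Prop :=
  (∀ i j, i ≠ j → 0 ≤ Q i j) ∧ ∀ i, ∑ j with j ≠ i, Q i j = -Q i i

/-! ## Laws of time-inhomogeneous Markov processes with a given generator -/

/-- The law of a Markov process on `[0,T]` with state space `S ⊆ E` and generator `𝒢` (of the
space-time process, tested on the functions in `D`), given by its transition probabilities
`kernel t s z = Law (Z_s | Z_t = z)`, `0 ≤ t ≤ s ≤ T`: probability kernels that satisfy the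
Chapman-Kolmogorov equations and, for all `F ∈ D`,
`𝔼[F(s, Z_s) | Z_t = z] = F(t, z) + 𝔼[∫_t^s 𝒢F(u, Z_u) du | Z_t = z]`. -/
structure MarkovLaw {E : Type*} [MeasurableSpace E] (T : ℝ) (S : Set E)
    (D : Set (ℝ → E → ℝ)) (𝒢 : (ℝ → E → ℝ) → ℝ → E → ℝ) where
  kernel : ℝ → ℝ → Kernel S S
  isMarkov : ∀ t s, 0 ≤ t → t ≤ s → s ≤ T → IsMarkovKernel (kernel t s)
  initial : ∀ t, 0 ≤ t → t ≤ T → kernel t t = Kernel.id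
  chapmanKolmogorov : ∀ t s u, 0 ≤ t → t ≤ s → s ≤ u → u ≤ T →
    kernel s u ∘ₖ kernel t s = kernel t u
  generator : ∀ F ∈ D, ∀ t s, 0 ≤ t → t ≤ s → s ≤ T → ∀ z : S,
    IntervalIntegrable (fun u => ∫ y : S, 𝒢 F u y ∂(kernel t u z)) volume t s ∧
    ∫ y : S, F s y ∂(kernel t s z) =
      F t z + ∫ u in t..s, ∫ y : S, 𝒢 F u y ∂(kernel t u z)

/-- The expected cost `𝔼[∫_t^T f(s, Z_s) ds + g(Z_T) | Z_t = z]`. -/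
def MarkovLaw.cost {E : Type*} [MeasurableSpace E] {T : ℝ} {S : Set E}
    {D : Set (ℝ → E → ℝ)} {𝒢 : (ℝ → E → ℝ) → ℝ → E → ℝ} (P : MarkovLaw T S D 𝒢)
    (f : ℝ → E → ℝ) (g : E → ℝ) (t : ℝ) (z : S) : ℝ :=
  (∫ s in t..T, ∫ y : S, f s y ∂(P.kernel t s z)) + ∫ y : S, g y ∂(P.kernel t T z)

/-- Test functions for the finite games: `C¹` in time. -/
def timeC1 (E : Type*) : Set (ℝ → E → ℝ) := {F | ∀ z, ContDiff ℝ 1 (fun t => F t z)}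

/-- Test functions for the mean field limits: `C¹` in time and in the distribution, for each
value of the discrete states. -/
def timeSpaceC1 (ι : Type*) (m : ℕ) : Set (ℝ → ι × Vec m → ℝ) :=
  {F | ∀ i, ContDiff ℝ 1 (fun p : ℝ × Vec m => F p.1 (i, p.2))}

/-- `∂F/∂x_j`. -/
def partialX {m : ℕ} (F : Vec m → ℝ) (j : Fin m) (x : Vec m) : ℝ :=
  fderiv ℝ F x (EuclideanSpace.single j 1)

/-! ## Generators

`q₀ t i⁰ j⁰ x`, `q t i j i⁰ x` are the jump rates of the major player and of the minor players once
the feedback functions are inserted; `q'` is the rate of the singled-out minor player. -/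

section Generators

variable {m M₀ : ℕ}

/-- Generator of `(X⁰, μ^N)` in the game with `N` minor players. -/
def majorGenN (N : ℕ) (q₀ : ℝ → Fin M₀ → Fin M₀ → Vec m → ℝ)
    (q : ℝ → Fin (m + 1) → Fin (m + 1) → Fin M₀ → Vec m → ℝ)
    (F : ℝ → Fin M₀ × Vec m → ℝ) (t : ℝ) : Fin M₀ × Vec m → ℝ
  | (i₀, x) =>
    deriv (fun s => F s (i₀, x)) t
    + ∑ j₀ with j₀ ≠ i₀, (F t (j₀, x) - F t (i₀, x)) * q₀ t i₀ j₀ x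
    + ∑ i, ∑ j with j ≠ i, (F t (i₀, x + (1 / N : ℝ) • jump i j) - F t (i₀, x))
        * (N * coord x i) * q t i j i₀ x

/-- Generator of `(X⁰, μ)` in the mean field limit. -/
def majorGen (q₀ : ℝ → Fin M₀ → Fin M₀ → Vec m → ℝ)
    (q : ℝ → Fin (m + 1) → Fin (m + 1) → Fin M₀ → Vec m → ℝ)
    (F : ℝ → Fin M₀ × Vec m → ℝ) (t : ℝ) : Fin M₀ × Vec m → ℝ
  | (i₀, x) =>
    deriv (fun s => F s (i₀, x)) t
    + ∑ j₀ with j₀ ≠ i₀, (F t (j₀, x) - F t (i₀, x)) * q₀ t i₀ j₀ x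
    + ∑ i : Fin (m + 1), ∑ j : Fin m,
        partialX (fun y => F t (i₀, y)) j x * coord x i * q t i j.castSucc i₀ x

/-- Generator of `(X, X⁰, μ^N)` in the game with `N` minor players, `X` being the state of the
singled-out minor player. -/
def minorGenN (N : ℕ) (q₀ : ℝ → Fin M₀ → Fin M₀ → Vec m → ℝ)
    (q q' : ℝ → Fin (m + 1) → Fin (m + 1) → Fin M₀ → Vec m → ℝ)
    (F : ℝ → (Fin (m + 1) × Fin M₀) × Vec m → ℝ) (t : ℝ) :
    (Fin (m + 1) × Fin M₀) × Vec m → ℝ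
  | ((i, i₀), x) =>
    deriv (fun s => F s ((i, i₀), x)) t
    + ∑ j₀ with j₀ ≠ i₀, (F t ((i, j₀), x) - F t ((i, i₀), x)) * q₀ t i₀ j₀ x
    + ∑ j with j ≠ i, (F t ((j, i₀), x + (1 / N : ℝ) • jump i j) - F t ((i, i₀), x))
        * q' t i j i₀ x
    + ∑ k, ∑ j with j ≠ k, (F t ((i, i₀), x + (1 / N : ℝ) • jump k j) - F t ((i, i₀), x))
        * (N * coord x k - if k = i then 1 else 0) * q t k j i₀ x

/-- Generator of `(X, X⁰, μ)` in the mean field limit. -/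
def minorGen (q₀ : ℝ → Fin M₀ → Fin M₀ → Vec m → ℝ)
    (q q' : ℝ → Fin (m + 1) → Fin (m + 1) → Fin M₀ → Vec m → ℝ)
    (F : ℝ → (Fin (m + 1) × Fin M₀) × Vec m → ℝ) (t : ℝ) :
    (Fin (m + 1) × Fin M₀) × Vec m → ℝ
  | ((i, i₀), x) =>
    deriv (fun s => F s ((i, i₀), x)) t
    + ∑ j₀ with j₀ ≠ i₀, (F t ((i, j₀), x) - F t ((i, i₀), x)) * q₀ t i₀ j₀ x
    + ∑ j with j ≠ i, (F t ((j, i₀), x) - F t ((i, i₀), x)) * q' t i j i₀ x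
    + ∑ k : Fin (m + 1), ∑ j : Fin m,
        partialX (fun y => F t ((i, i₀), y)) j x * coord x k * q t k j.castSucc i₀ x

end Generators

/-! ## The game -/

/-- The data of the game: horizon `T`, control sets `A₀`, `A`, jump rates `q₀`, `q` (Q-matrices),
running costs `f₀`, `f` and terminal costs `g₀`, `g`. -/
structure Game (m M₀ : ℕ) (T : ℝ) (U₀ U : Type*) [NormedAddCommGroup U₀] [NormedSpace ℝ U₀]
    [NormedAddCommGroup U] [NormedSpace ℝ U] where
  A₀ : Set U₀
  A : Set U
  convex_A₀ : Convex ℝ A₀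
  convex_A : Convex ℝ A
  q₀ : ℝ → Fin M₀ → Fin M₀ → U₀ → Vec m → ℝ
  q : ℝ → Fin (m + 1) → Fin (m + 1) → U → Fin M₀ → U₀ → Vec m → ℝ
  f₀ : ℝ → Fin M₀ → U₀ → Vec m → ℝ
  f : ℝ → Fin (m + 1) → U → Fin M₀ → U₀ → Vec m → ℝ
  g₀ : Fin M₀ → Vec m → ℝ
  g : Fin (m + 1) → Fin M₀ → Vec m → ℝ
  isQ_q₀ : ∀ t ∈ Set.Icc 0 T, ∀ a₀ ∈ A₀, ∀ x ∈ simplex m,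
    IsQMatrix (fun i₀ j₀ => q₀ t i₀ j₀ a₀ x)
  isQ_q : ∀ t ∈ Set.Icc 0 T, ∀ a ∈ A, ∀ i₀, ∀ a₀ ∈ A₀, ∀ x ∈ simplex m,
    IsQMatrix (fun i j => q t i j a i₀ a₀ x)

namespace Game

variable {m M₀ : ℕ} {T : ℝ} {U₀ U : Type*} [NormedAddCommGroup U₀] [NormedSpace ℝ U₀]
    [NormedAddCommGroup U] [NormedSpace ℝ U] (G : Game m M₀ T U₀ U)

/-- `K` is a Lipschitz constant of the rates and of the costs, in time, distribution and controls. -/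
def LipschitzData (K : ℝ) : Prop :=
  ∀ t ∈ Set.Icc 0 T, ∀ t' ∈ Set.Icc 0 T, ∀ x ∈ simplex m, ∀ x' ∈ simplex m,
  ∀ a₀ ∈ G.A₀, ∀ a₀' ∈ G.A₀, ∀ a ∈ G.A, ∀ a' ∈ G.A, ∀ i j i₀ j₀,
    |G.f t i a i₀ a₀ x - G.f t' i a' i₀ a₀' x'|
      ≤ K * (|t - t'| + ‖x - x'‖ + ‖a₀ - a₀'‖ + ‖a - a'‖) ∧
    |G.q t i j a i₀ a₀ x - G.q t' i j a' i₀ a₀' x'|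
      ≤ K * (|t - t'| + ‖x - x'‖ + ‖a₀ - a₀'‖ + ‖a - a'‖) ∧
    |G.f₀ t i₀ a₀ x - G.f₀ t' i₀ a₀' x'| ≤ K * (|t - t'| + ‖x - x'‖ + ‖a₀ - a₀'‖) ∧
    |G.q₀ t i₀ j₀ a₀ x - G.q₀ t' i₀ j₀ a₀' x'| ≤ K * (|t - t'| + ‖x - x'‖ + ‖a₀ - a₀'‖) ∧
    |G.g i i₀ x - G.g i i₀ x'| ≤ K * ‖x - x'‖ ∧
    |G.g₀ i₀ x - G.g₀ i₀ x'| ≤ K * ‖x - x'‖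

/-- The jump rates of the minor players are bounded by `C`. -/
def RateBound (C : ℝ) : Prop :=
  ∀ t ∈ Set.Icc 0 T, ∀ i j, ∀ a ∈ G.A, ∀ i₀, ∀ a₀ ∈ G.A₀, ∀ x ∈ simplex m,
    |G.q t i j a i₀ a₀ x| ≤ C

/-- No extinction: a minor player cannot leave a state whose proportion is below a threshold. -/
def NoExtinction : Prop :=
  ∃ ε > 0, ∀ t ∈ Set.Icc 0 T, ∀ i j, i ≠ j → ∀ a ∈ G.A, ∀ i₀, ∀ a₀ ∈ G.A₀, ∀ x ∈ simplex m,
    coord x i < ε → G.q t i j a i₀ a₀ x = 0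

/-- `φ₀` is a feedback function of the major player with Lipschitz constant `K`. -/
def IsMajorFeedback (K : ℝ) (φ₀ : ℝ → Fin M₀ → Vec m → U₀) : Prop :=
  (∀ t ∈ Set.Icc 0 T, ∀ i₀, ∀ x ∈ simplex m, φ₀ t i₀ x ∈ G.A₀) ∧
  ∀ t ∈ Set.Icc 0 T, ∀ t' ∈ Set.Icc 0 T, ∀ x ∈ simplex m, ∀ x' ∈ simplex m, ∀ i₀,
    ‖φ₀ t i₀ x - φ₀ t' i₀ x'‖ ≤ K * (|t - t'| + ‖x - x'‖)

/-- `φ` is a feedback function of a minor player with Lipschitz constant `K`. -/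
def IsMinorFeedback (K : ℝ) (φ : ℝ → Fin (m + 1) → Fin M₀ → Vec m → U) : Prop :=
  (∀ t ∈ Set.Icc 0 T, ∀ i i₀, ∀ x ∈ simplex m, φ t i i₀ x ∈ G.A) ∧
  ∀ t ∈ Set.Icc 0 T, ∀ t' ∈ Set.Icc 0 T, ∀ x ∈ simplex m, ∀ x' ∈ simplex m, ∀ i i₀,
    ‖φ t i i₀ x - φ t' i i₀ x'‖ ≤ K * (|t - t'| + ‖x - x'‖)

/-- Rates and running costs with the feedback functions inserted. -/
def q₀Of (φ₀ : ℝ → Fin M₀ → Vec m → U₀) (t : ℝ) (i₀ j₀ : Fin M₀) (x : Vec m) : ℝ :=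
  G.q₀ t i₀ j₀ (φ₀ t i₀ x) x

def qOf (φ₀ : ℝ → Fin M₀ → Vec m → U₀) (φ : ℝ → Fin (m + 1) → Fin M₀ → Vec m → U)
    (t : ℝ) (i j : Fin (m + 1)) (i₀ : Fin M₀) (x : Vec m) : ℝ :=
  G.q t i j (φ t i i₀ x) i₀ (φ₀ t i₀ x) x

def f₀Of (φ₀ : ℝ → Fin M₀ → Vec m → U₀) (t : ℝ) : Fin M₀ × Vec m → ℝ
  | (i₀, x) => G.f₀ t i₀ (φ₀ t i₀ x) x

def fOf (φ₀ : ℝ → Fin M₀ → Vec m → U₀) (φ : ℝ → Fin (m + 1) → Fin M₀ → Vec m → U)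
    (t : ℝ) : (Fin (m + 1) × Fin M₀) × Vec m → ℝ
  | ((i, i₀), x) => G.f t i (φ t i i₀ x) i₀ (φ₀ t i₀ x) x

/-- `B` bounds the terminal costs, and the running costs along the feedback functions. -/
def CostBound (B : ℝ) (φ₀ : ℝ → Fin M₀ → Vec m → U₀)
    (φ' : ℝ → Fin (m + 1) → Fin M₀ → Vec m → U) : Prop :=
  ∀ t ∈ Set.Icc 0 T, ∀ i i₀, ∀ x ∈ simplex m,
    |G.f₀Of φ₀ t (i₀, x)| ≤ B ∧ |G.fOf φ₀ φ' t ((i, i₀), x)| ≤ B ∧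
    |G.g₀ i₀ x| ≤ B ∧ |G.g i i₀ x| ≤ B

/-- State space of `(X, X⁰, μ^N)`: the singled-out player is one of the `N` players that `μ^N`
counts, so that `μ^N(X) ≥ 1/N`. Where no player can leave an extinct state, the dynamics also make
sense on all of `{1,…,M} × {1,…,M⁰} × 𝒫^N`. -/
def IsMinorStateSpace (N : ℕ) (S : Set ((Fin (m + 1) × Fin M₀) × Vec m)) : Prop :=
  S = {z | z.2 ∈ grid m N ∧ 1 / (N : ℝ) ≤ coord z.2 z.1.1} ∨
  (G.NoExtinction ∧ S = {z | z.2 ∈ grid m N})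

theorem IsMinorStateSpace.mem_simplex {G : Game m M₀ T U₀ U} {N : ℕ}
    {S : Set ((Fin (m + 1) × Fin M₀) × Vec m)} (hS : G.IsMinorStateSpace N S)
    {z : (Fin (m + 1) × Fin M₀) × Vec m} (hz : z ∈ S) : z.2 ∈ simplex m := by
  rcases hS with rfl | ⟨-, rfl⟩
  · exact grid_subset_simplex hz.1
  · exact grid_subset_simplex hz

/-- Law of `(X⁰, μ^N)` when the major player uses `φ₀` and all `N` minor players use `φ`. -/
abbrev MajorLawN (N : ℕ) (φ₀ : ℝ → Fin M₀ → Vec m → U₀)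
    (φ : ℝ → Fin (m + 1) → Fin M₀ → Vec m → U) :=
  MarkovLaw T {z : Fin M₀ × Vec m | z.2 ∈ grid m N} (timeC1 _)
    (majorGenN N (G.q₀Of φ₀) (G.qOf φ₀ φ))

/-- Law of `(X⁰, μ)` in the mean field limit. -/
abbrev MajorLaw (φ₀ : ℝ → Fin M₀ → Vec m → U₀)
    (φ : ℝ → Fin (m + 1) → Fin M₀ → Vec m → U) :=
  MarkovLaw T {z : Fin M₀ × Vec m | z.2 ∈ simplex m} (timeSpaceC1 _ m)
    (majorGen (G.q₀Of φ₀) (G.qOf φ₀ φ))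

/-- Law of `(X, X⁰, μ^N)` when the major player uses `φ₀`, the singled-out minor player `φ'`, and
the other `N - 1` minor players `φ`. -/
abbrev MinorLawN (N : ℕ) (S : Set ((Fin (m + 1) × Fin M₀) × Vec m))
    (φ₀ : ℝ → Fin M₀ → Vec m → U₀) (φ φ' : ℝ → Fin (m + 1) → Fin M₀ → Vec m → U) :=
  MarkovLaw T S (timeC1 _) (minorGenN N (G.q₀Of φ₀) (G.qOf φ₀ φ) (G.qOf φ₀ φ'))

/-- Law of `(X, X⁰, μ)` in the mean field limit. -/
abbrev MinorLaw (φ₀ : ℝ → Fin M₀ → Vec m → U₀)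
    (φ φ' : ℝ → Fin (m + 1) → Fin M₀ → Vec m → U) :=
  MarkovLaw T {z : (Fin (m + 1) × Fin M₀) × Vec m | z.2 ∈ simplex m} (timeSpaceC1 _ m)
    (minorGen (G.q₀Of φ₀) (G.qOf φ₀ φ) (G.qOf φ₀ φ'))

end Game

end MajorMinor

end

open MajorMinor

/-!
The major player, alone or together with the singled-out minor player, is regarded as a random
environment with finitely many states, in which the other minor players are exchangeable particles
that jump at rates depending on the environment and on their empirical distribution
(`ParticleRates`). Both estimates are instances of one theorem about such systems.

*Costs.* In the finite game the expected cost is the solution `v` of a backward equation, by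
Dynkin's formula (`MarkovLaw.cost_eq_of_backward`). Label the particles, and regard `v` as a
function of the environment and of the states of all particles. Two configurations that differ in
one particle have values that differ by `O(1 / N)` only (`IsParticleCost.norm_diffs_le`): these
differences satisfy a backward equation of their own, in which the environment enters merely through
the Lipschitz constant of its rates, and a maximum principle applies (`norm_le_of_backward`). No
regularity of the cost of the mean field game is needed.

*Comparison.* For a point `y` of the simplex, average `v` over independent particles with law `y`.
The resulting Bernstein transform is a polynomial in `y`, hence an admissible test function for the
mean field generator, and `y_k` times its derivative in the direction `e_j - e_k` is the expectation
of the finite differences of `v` over the particles in the state `k` (`coord_mul_fderiv_bernstein`).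
Therefore the mean field generator, applied to the transform, averages the generator of the particle
system, except that the rates are taken at `y` and not at the empirical distribution
(`ParticleRates.gen_bernstein`). By the law of large numbers (`sum_wt_mul_norm_emp_sub_le`) and the
bound on the differences, the transform solves the mean field equation up to `O(1 / √N)`
(`IsParticleCost.abs_gen_bernstein_add_le`). Dynkin's formula for the mean field process now shows
that its cost is within `O(1 / √N)` of the transform, and the transform is within `O(1 / √N)` of
`v`, again by the law of large numbers (`abs_cost_sub_le`).

*Existence.* The finite games are jump processes on finite sets, whose transition matrices come from
linear differential equations (`exists_transitionMatrices`, `nonempty_markovLaw_of_finite`). The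
transition kernels of the mean field processes are weak limits of those of particle systems started
with independent particles. Convergence is proved with the same test functions: Dynkin's formula for
a large system, applied to the Bernstein transform of the cost of a smaller one, shows that
expectations form Cauchy sequences (`ParticleTransitions.exists_tendsto_expect`). The limits satisfy
Dynkin's formula and the Chapman-Kolmogorov equation (`ParticleRates.Regular.nonempty_markovLaw`).

*The singled-out minor player.* On the states with `x_i ≥ 1 / N` he belongs to the environment, the
particles are the other `N - 1` players, and the game is exactly a particle system
(`isGridModel_of_count`). On the whole grid, where `x` may fail to count him, all `N` players are
taken as particles and his state is recorded by the environment in addition. His contribution to the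
distribution is then an error of the size of the influence of one particle, provided that nobody
leaves an extinct state (`isGridModel_of_extinction`).
-/

noncomputable section

namespace MajorMinor

open Set Filter Topology

/-! ### Linear differential equations on finite index sets -/

section ODE

variable {ι : Type*} [Fintype ι]

/-- Coordinatewise truncation to `[-ρ, ρ]`. It turns a globally Lipschitz field into a bounded one,
to which the Picard-Lindelöf theorem applies on intervals of any length. -/
def truncate (ρ : ℝ) (x : ι → ℝ) : ι → ℝ := fun i => max (-ρ) (min ρ (x i))

theorem lipschitzWith_truncate (ρ : ℝ) : LipschitzWith 1 (truncate (ι := ι) ρ) := by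
  refine LipschitzWith.of_dist_le_mul fun x y => ?_
  simp only [NNReal.coe_one, one_mul]
  refine (dist_pi_le_iff dist_nonneg).2 fun i => ?_
  refine le_trans ?_ (dist_le_pi_dist x y i)
  simp only [truncate, Real.dist_eq]
  refine (abs_max_sub_max_le_max _ _ _ _).trans ?_
  simp only [sub_self, abs_zero]
  refine max_le (abs_nonneg _) ?_
  refine (abs_min_sub_min_le_max _ _ _ _).trans ?_
  simp

theorem norm_truncate_le {ρ : ℝ} (hρ : 0 ≤ ρ) (x : ι → ℝ) : ‖truncate ρ x‖ ≤ ρ := by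
  refine (pi_norm_le_iff_of_nonneg hρ).2 fun i => ?_
  simp only [truncate, Real.norm_eq_abs, abs_le]
  exact ⟨le_max_left _ _, max_le (by linarith) (min_le_left _ _)⟩

theorem truncate_of_norm_le {ρ : ℝ} {x : ι → ℝ} (hx : ‖x‖ ≤ ρ) : truncate ρ x = x := by
  funext i
  have h : |x i| ≤ ρ := (norm_le_pi_norm x i).trans hx
  rw [abs_le] at h
  simp only [truncate]
  rw [min_eq_right h.2, max_eq_right h.1]

theorem norm_truncate_le_norm {ρ : ℝ} (hρ : 0 ≤ ρ) (x : ι → ℝ) : ‖truncate ρ x‖ ≤ ‖x‖ := by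
  have h := (lipschitzWith_truncate (ι := ι) ρ).dist_le_mul x 0
  rwa [truncate_of_norm_le (x := 0) (by simpa using hρ), dist_zero_right, dist_zero_right,
    NNReal.coe_one, one_mul] at h

/-- The projection of the real line to `[0, T]`. -/
def clamp (T t : ℝ) : ℝ := max 0 (min T t)

theorem continuous_clamp (T : ℝ) : Continuous (clamp T) := by unfold clamp; fun_prop

theorem clamp_mem {T : ℝ} (hT : 0 ≤ T) (t : ℝ) : clamp T t ∈ Icc 0 T :=
  ⟨le_max_left _ _, max_le hT (min_le_left _ _)⟩

theorem clamp_of_mem {T t : ℝ} (ht : t ∈ Icc 0 T) : clamp T t = t := by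
  simp [clamp, ht.1, ht.2]

/-- Global existence for a field that is Lipschitz in the space variable. The solution is extended
to a `C¹` function on the whole line. -/
theorem exists_ode_solution {f : ℝ → (ι → ℝ) → (ι → ℝ)} {T : ℝ} (hT : 0 ≤ T) {K : NNReal}
    (hf : ∀ x, ContinuousOn (fun t => f t x) (Icc 0 T))
    (hK : ∀ t ∈ Icc 0 T, LipschitzWith K (f t)) (x₀ : ι → ℝ) :
    ∃ v : ℝ → ι → ℝ, v 0 = x₀ ∧ ContDiff ℝ 1 v ∧ ∀ t ∈ Icc 0 T, HasDerivAt v (f t (v t)) t := by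
  obtain ⟨ε, hε⟩ : ∃ ε : ℝ, ∀ t ∈ Icc 0 T, ‖f t 0‖ ≤ ε := by
    obtain ⟨ε, hε⟩ := isCompact_Icc.exists_bound_of_continuousOn (hf 0)
    exact ⟨ε, hε⟩
  have hε0 : 0 ≤ ε := (norm_nonneg _).trans (hε 0 ⟨le_rfl, hT⟩)
  have hgrow : ∀ t ∈ Icc 0 T, ∀ x, ‖f t x‖ ≤ K * ‖x‖ + ε := by
    intro t ht x
    have h1 := (hK t ht).dist_le_mul x 0
    rw [dist_zero_right, dist_eq_norm] at h1
    have h2 := norm_le_norm_sub_add (f t x) (f t 0)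
    have := hε t ht
    linarith
  set ρ : ℝ := gronwallBound ‖x₀‖ (K + 1) ε T with hρdef
  have hmono := gronwallBound_mono (norm_nonneg x₀) hε0 (add_nonneg K.2 zero_le_one)
  have hρ : 0 ≤ ρ := by
    have h := hmono hT
    rw [gronwallBound_x0] at h
    exact (norm_nonneg _).trans h
  have hPL : IsPicardLindelof (fun t x => f t (truncate ρ x)) (tmin := 0) (tmax := T)
      ⟨0, le_rfl, hT⟩ x₀ (⟨(K * ρ + ε) * T, by positivity⟩ : NNReal) 0
      (⟨K * ρ + ε, by positivity⟩ : NNReal) (K * 1) := by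
    refine ⟨fun t ht => ?_, fun x _ => hf _, fun t ht x _ => ?_, ?_⟩
    · exact ((hK t ht).comp (lipschitzWith_truncate ρ)).lipschitzOnWith
    · refine (hgrow t ht _).trans ?_
      have := norm_truncate_le hρ x
      change _ ≤ (K : ℝ) * ρ + ε
      gcongr
    · change ((K : ℝ) * ρ + ε) * max (T - 0) (0 - 0) ≤ (K * ρ + ε) * T - 0
      rw [sub_zero, sub_zero, sub_zero, max_eq_left hT]
  obtain ⟨u, hu0, hu⟩ := hPL.exists_eq_forall_mem_Icc_hasDerivWithinAt₀
  have hucont : ContinuousOn u (Icc 0 T) := fun t ht => (hu t ht).continuousWithinAt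
  have hbound : ∀ t ∈ Icc 0 T, ‖u t‖ ≤ ρ := by
    intro t ht
    refine (norm_le_gronwallBound_of_norm_deriv_right_le (f := u)
      (f' := fun t => f t (truncate ρ (u t))) (δ := ‖x₀‖) (K := K + 1) (ε := ε) hucont
      (fun t ht => ?_) (by rw [← hu0]) (fun t ht => ?_) t ht).trans ?_
    · exact (hu t (Ico_subset_Icc_self ht)).mono_of_mem_nhdsWithin
        (Icc_mem_nhdsGE_of_mem ht)
    · refine (hgrow t (Ico_subset_Icc_self ht) _).trans ?_
      have h1 := norm_truncate_le_norm hρ (u t)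
      have h2 : (K : ℝ) * ‖truncate ρ (u t)‖ ≤ K * ‖u t‖ := by gcongr
      have := norm_nonneg (u t)
      nlinarith
    · rw [sub_zero]; exact hmono ht.2
  have hu' : ∀ t ∈ Icc 0 T, HasDerivWithinAt u (f t (u t)) (Icc 0 T) t := by
    intro t ht
    have := hu t ht
    rwa [truncate_of_norm_le (hbound t ht)] at this
  -- the derivative, extended continuously to the whole line
  set w : ℝ → ι → ℝ := fun t => f (clamp T t) (u (clamp T t)) with hw
  have hwcont : Continuous w := by
    have h1 : ContinuousOn (fun t => f t (u t)) (Icc 0 T) := by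
      have h2 := continuousOn_prod_of_continuousOn_lipschitzOnWith' (fun p : ℝ × (ι → ℝ) => f p.1 p.2)
        (s := Icc 0 T) (t := univ) K (fun t ht => (hK t ht).lipschitzOnWith) (fun x _ => hf x)
      exact h2.comp (continuousOn_id.prodMk hucont) fun t ht => ⟨ht, mem_univ _⟩
    exact h1.comp_continuous (continuous_clamp T) (clamp_mem hT)
  set v : ℝ → ι → ℝ := fun t => x₀ + ∫ s in (0 : ℝ)..t, w s with hv
  have hv' : ∀ t, HasDerivAt v (w t) t := fun t => by
    have := (hwcont.integral_hasStrictDerivAt 0 t).hasDerivAt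
    exact this.const_add x₀
  have huv : ∀ t ∈ Icc 0 T, v t = u t := by
    intro t ht
    have hE : ∫ s in (0 : ℝ)..t, w s = u t - u 0 := by
      refine intervalIntegral.integral_eq_sub_of_hasDeriv_right_of_le ht.1
        (hucont.mono (Icc_subset_Icc_right ht.2)) (fun s hs => ?_)
        (hwcont.intervalIntegrable _ _)
      have hs' : s ∈ Icc 0 T := ⟨hs.1.le, hs.2.le.trans ht.2⟩
      rw [hw]
      simp only [clamp_of_mem hs']
      exact (hu' s hs').mono_of_mem_nhdsWithin
        (mem_of_superset (Ioo_mem_nhdsGT (hs.2.trans_le ht.2)) fun r hr =>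
          ⟨hs'.1.trans hr.1.le, hr.2.le⟩)
    rw [hv]
    simp only
    rw [hE, hu0]
    abel
  refine ⟨v, by simp [hv], contDiff_one_iff_deriv.2
    ⟨fun t => (hv' t).differentiableAt, ?_⟩, fun t ht => ?_⟩
  · rw [show deriv v = w from funext fun t => (hv' t).deriv]; exact hwcont
  · have := hv' t
    rw [huv t ht]
    simpa only [hw, clamp_of_mem ht] using this

end ODE

/-! ### Finite jump processes -/

section Jump

variable {ι Λ : Type*} [Fintype Λ]

/-- The jump operator of a process that, for every label `e`, moves from `a` to `target e a` at rate
`rate e a`. -/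
def jumpOp (target : Λ → ι → ι) (rate : Λ → ι → ℝ) (u : ι → ℝ) (a : ι) : ℝ :=
  ∑ e, rate e a * (u (target e a) - u a)

theorem jumpOp_sub (target : Λ → ι → ι) (rate : Λ → ι → ℝ) (u w : ι → ℝ) (a : ι) :
    jumpOp target rate u a - jumpOp target rate w a = jumpOp target rate (u - w) a := by
  simp only [jumpOp, ← Finset.sum_sub_distrib, Pi.sub_apply]
  exact Finset.sum_congr rfl fun e _ => by ring

theorem continuousOn_jumpOp {target : Λ → ι → ι} {rate : ℝ → Λ → ι → ℝ} {s : Set ℝ}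
    {u : ℝ → ι → ℝ} (hrate : ∀ e a, ContinuousOn (fun t => rate t e a) s)
    (hu : ∀ a, ContinuousOn (fun t => u t a) s) (a : ι) :
    ContinuousOn (fun t => jumpOp target (rate t) (u t) a) s :=
  continuousOn_finsetSum _ fun e _ => (hrate e a).mul ((hu _).sub (hu _))

variable [Fintype ι]

theorem abs_jumpOp_le {target : Λ → ι → ι} {rate : Λ → ι → ℝ} {M : ℝ}
    (hM : ∀ e a, |rate e a| ≤ M) (u : ι → ℝ) (a : ι) :
    |jumpOp target rate u a| ≤ Fintype.card Λ * (M * (2 * ‖u‖)) := by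
  refine (Finset.abs_sum_le_sum_abs _ _).trans ?_
  refine (Finset.sum_le_card_nsmul _ _ (M * (2 * ‖u‖)) fun e _ => ?_).trans_eq (by simp)
  rw [abs_mul]
  have h1 : |u (target e a)| ≤ ‖u‖ := norm_le_pi_norm u _
  have h2 : |u a| ≤ ‖u‖ := norm_le_pi_norm u _
  have h3 := abs_sub (u (target e a)) (u a)
  gcongr
  · exact (abs_nonneg _).trans (hM e a)
  · exact hM e a
  · linarith

theorem exists_rate_bound {rate : ℝ → Λ → ι → ℝ} {T : ℝ}
    (hrate : ∀ e a, ContinuousOn (fun t => rate t e a) (Icc 0 T)) :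
    ∃ M, 0 ≤ M ∧ ∀ t ∈ Icc 0 T, ∀ e a, |rate t e a| ≤ M := by
  choose b hb using fun p : Λ × ι => isCompact_Icc.exists_bound_of_continuousOn (hrate p.1 p.2)
  refine ⟨∑ p, |b p|, Finset.sum_nonneg fun _ _ => abs_nonneg _, fun t ht e a => ?_⟩
  exact (hb (e, a) t ht).trans ((le_abs_self _).trans
    (Finset.single_le_sum (f := fun p => |b p|) (fun _ _ => abs_nonneg _) (Finset.mem_univ (e, a))))

/-- With `L` at least the total jump rate, `L + jumpOp` has nonnegative coefficients. -/
theorem abs_mul_add_jumpOp_le {target : Λ → ι → ι} {rate : Λ → ι → ℝ} {M : ℝ}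
    (h0 : ∀ e a, 0 ≤ rate e a) (hM : ∀ e a, rate e a ≤ M) (u : ι → ℝ) (a : ι) :
    |Fintype.card Λ * M * u a + jumpOp target rate u a| ≤ Fintype.card Λ * M * ‖u‖ := by
  have h : Fintype.card Λ * M * u a + jumpOp target rate u a
      = ∑ e, ((M - rate e a) * u a + rate e a * u (target e a)) := by
    simp only [jumpOp, Finset.sum_add_distrib, mul_sub, sub_mul, Finset.sum_sub_distrib]
    simp
    ring
  rw [h]
  refine (Finset.abs_sum_le_sum_abs _ _).trans ?_
  refine (Finset.sum_le_card_nsmul _ _ (M * ‖u‖) fun e _ => ?_).trans_eq (by simp; ring)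
  have h1 : |u (target e a)| ≤ ‖u‖ := norm_le_pi_norm u _
  have h2 : |u a| ≤ ‖u‖ := norm_le_pi_norm u _
  have h3 := h0 e a
  have h4 := hM e a
  refine (abs_add_le _ _).trans ?_
  rw [abs_mul, abs_mul, abs_of_nonneg h3, abs_of_nonneg (sub_nonneg.2 h4)]
  nlinarith [mul_le_mul_of_nonneg_left h2 (sub_nonneg.2 h4), mul_le_mul_of_nonneg_left h1 h3]

/-- A maximum principle for backward equations: the bound does not involve the size of the
jump rates, only the perturbation. The proof is Grönwall's inequality for `exp (L τ) • u (T - τ)`,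
where `L` is at least the total jump rate, so that `L + jumpOp` has norm at most `L`. -/
theorem norm_le_of_backward {target : Λ → ι → ι} {rate : ℝ → Λ → ι → ℝ} {T M c κ : ℝ}
    (h0 : ∀ t ∈ Icc 0 T, ∀ e a, 0 ≤ rate t e a) (hM : ∀ t ∈ Icc 0 T, ∀ e a, rate t e a ≤ M)
    (hM0 : 0 ≤ M) {u u' : ℝ → ι → ℝ}
    (hu : ∀ t ∈ Icc 0 T, ∀ a, HasDerivAt (fun s => u s a) (u' t a) t) (hc : 0 ≤ c)
    (hR : ∀ t ∈ Icc 0 T, ∀ a, |u' t a + jumpOp target (rate t) (u t) a| ≤ c * (κ + ‖u t‖))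
    (hκ : 0 ≤ κ) (huT : ‖u T‖ ≤ κ) {t : ℝ} (ht : t ∈ Icc 0 T) :
    ‖u t‖ ≤ Real.exp (2 * c * (T - t)) * κ := by
  set L : ℝ := Fintype.card Λ * M with hL
  have hL0 : 0 ≤ L := by positivity
  have hmem : ∀ τ ∈ Icc 0 T, T - τ ∈ Icc 0 T := fun τ hτ => ⟨by linarith [hτ.2], by linarith [hτ.1]⟩
  -- the second component absorbs the inhomogeneity `c * κ`
  set f : ℝ → (ι → ℝ) × ℝ := fun τ => (Real.exp (L * τ) • u (T - τ), Real.exp (L * τ) * κ) with hf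
  set f' : ℝ → (ι → ℝ) × ℝ := fun τ =>
    (Real.exp (L * τ) • (L • u (T - τ) - u' (T - τ)), Real.exp (L * τ) * (L * κ)) with hf'
  have hexp : ∀ τ, HasDerivAt (fun τ => Real.exp (L * τ)) (Real.exp (L * τ) * L) τ := fun τ => by
    simpa using ((hasDerivAt_id τ).const_mul L).exp
  have hderiv : ∀ τ ∈ Icc 0 T, HasDerivAt f (f' τ) τ := by
    intro τ hτ
    refine HasDerivAt.prodMk ?_ ?_
    · refine hasDerivAt_pi.2 fun a => ?_
      have h1 : HasDerivAt (fun τ => u (T - τ) a) (-(u' (T - τ) a)) τ := by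
        have := (hu _ (hmem τ hτ) a).comp_const_sub T τ
        simpa using this
      refine ((hexp τ).mul h1).congr_deriv ?_
      simp only [Pi.smul_apply, Pi.sub_apply, smul_eq_mul]
      ring
    · refine ((hexp τ).mul_const κ).congr_deriv (by ring)
  have hfn : ∀ τ, ‖f τ‖ = Real.exp (L * τ) * max ‖u (T - τ)‖ κ := by
    intro τ
    simp only [hf, Prod.norm_mk, norm_smul, Real.norm_eq_abs, abs_mul, Real.abs_exp, abs_of_nonneg hκ]
    rw [mul_max_of_nonneg _ _ (Real.exp_pos _).le]
  have hbd : ∀ τ ∈ Icc 0 T, ‖f' τ‖ ≤ (L + 2 * c) * ‖f τ‖ + 0 := by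
    intro τ hτ
    rw [hfn, add_zero]
    have hmax : ‖u (T - τ)‖ ≤ max ‖u (T - τ)‖ κ := le_max_left _ _
    have hmax' : κ ≤ max ‖u (T - τ)‖ κ := le_max_right _ _
    set m := max ‖u (T - τ)‖ κ
    have hm0 : 0 ≤ m := hκ.trans hmax'
    simp only [hf', Prod.norm_mk, norm_smul, Real.norm_eq_abs, Real.abs_exp, abs_mul]
    have key : ‖L • u (T - τ) - u' (T - τ)‖ ≤ (L + 2 * c) * m := by
      refine (pi_norm_le_iff_of_nonneg (by positivity)).2 fun a => ?_
      have h1 := abs_mul_add_jumpOp_le (target := target) (h0 _ (hmem τ hτ)) (hM _ (hmem τ hτ))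
        (u (T - τ)) a
      have h2 := hR _ (hmem τ hτ) a
      rw [Real.norm_eq_abs, Pi.sub_apply, Pi.smul_apply, smul_eq_mul]
      have h3 := abs_sub (L * u (T - τ) a + jumpOp target (rate (T - τ)) (u (T - τ)) a)
        (u' (T - τ) a + jumpOp target (rate (T - τ)) (u (T - τ)) a)
      rw [add_sub_add_right_eq_sub] at h3
      have h4 : c * (κ + ‖u (T - τ)‖) ≤ c * (m + m) := by gcongr
      have h5 : L * ‖u (T - τ)‖ ≤ L * m := by gcongr
      rw [← hL] at h1
      linarith
    refine max_le ?_ ?_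
    · calc _ ≤ Real.exp (L * τ) * ((L + 2 * c) * m) := by gcongr
        _ = _ := by ring
    · rw [abs_of_nonneg hL0, abs_of_nonneg hκ]
      calc Real.exp (L * τ) * (L * κ) ≤ Real.exp (L * τ) * ((L + 2 * c) * m) := by
            gcongr; linarith
        _ = _ := by ring
  have hfin := norm_le_gronwallBound_of_norm_deriv_right_le (f := f) (f' := f') (δ := κ)
    (fun τ hτ => (hderiv τ hτ).continuousAt.continuousWithinAt)
    (fun τ hτ => (hderiv τ (Ico_subset_Icc_self hτ)).hasDerivWithinAt)
    (by rw [hfn]; simp [huT]) (fun τ hτ => hbd τ (Ico_subset_Icc_self hτ)) (T - t) (hmem t ht)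
  rw [gronwallBound_ε0, hfn, sub_zero, sub_sub_cancel, add_mul, Real.exp_add] at hfin
  have h1 : Real.exp (L * (T - t)) * ‖u t‖ ≤
      Real.exp (L * (T - t)) * (Real.exp (2 * c * (T - t)) * κ) := by
    calc _ ≤ Real.exp (L * (T - t)) * max ‖u t‖ κ := by gcongr; exact le_max_left _ _
      _ ≤ _ := hfin
      _ = _ := by ring
  exact le_of_mul_le_mul_left h1 (Real.exp_pos _)

/-- Solutions of the backward equation with a source term. They are extended to `C¹` functions on
the whole line, and so can serve as test functions. -/
theorem exists_backward_solution (target : Λ → ι → ι) {rate : ℝ → Λ → ι → ℝ} {T : ℝ} (hT : 0 ≤ T)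
    (hrate : ∀ e a, ContinuousOn (fun t => rate t e a) (Icc 0 T)) {f : ℝ → ι → ℝ}
    (hf : ∀ a, ContinuousOn (fun t => f t a) (Icc 0 T)) (g : ι → ℝ) :
    ∃ v : ℝ → ι → ℝ, v T = g ∧ (∀ a, ContDiff ℝ 1 fun t => v t a) ∧
      ∀ t ∈ Icc 0 T, ∀ a,
        HasDerivAt (fun s => v s a) (-(jumpOp target (rate t) (v t) a + f t a)) t := by
  obtain ⟨M, hM0, hM⟩ := exists_rate_bound hrate
  have hmem : ∀ τ ∈ Icc 0 T, T - τ ∈ Icc 0 T := fun τ hτ => ⟨by linarith [hτ.2], by linarith [hτ.1]⟩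
  have hrev : ContinuousOn (fun τ => T - τ) (Icc 0 T) := by fun_prop
  obtain ⟨x, hx0, hx1, hx⟩ := exists_ode_solution
    (f := fun τ x a => jumpOp target (rate (T - τ)) x a + f (T - τ) a) hT
    (K := ⟨Fintype.card Λ * (M * 2), by positivity⟩) (fun x => by
      refine continuousOn_pi.2 fun a => ContinuousOn.add ?_ ((hf a).comp hrev hmem)
      exact continuousOn_jumpOp (rate := fun τ => rate (T - τ)) (u := fun _ => x)
        (fun e a => (hrate e a).comp hrev hmem) (fun a => continuousOn_const) a)
    (fun τ hτ => by
      refine LipschitzWith.of_dist_le_mul fun x y => ?_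
      refine (dist_pi_le_iff (mul_nonneg (NNReal.coe_nonneg _) dist_nonneg)).2 fun a => ?_
      rw [Real.dist_eq, add_sub_add_right_eq_sub, jumpOp_sub, dist_eq_norm]
      refine (abs_jumpOp_le (hM _ (hmem τ hτ)) _ _).trans_eq ?_
      change _ = (Fintype.card Λ * (M * 2)) * _
      ring) g
  refine ⟨fun t => x (T - t), by simp [hx0], fun a => ?_, fun t ht a => ?_⟩
  · exact (contDiff_pi.1 hx1 a).comp (contDiff_const.sub contDiff_id)
  · have h := (hasDerivAt_pi.1 (hx _ (hmem t ht)) a).comp_const_sub T t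
    simpa using h

end Jump

/-! ### Transition matrices of finite jump processes -/

section Transition

variable {ι Λ : Type*} [Fintype Λ] [Fintype ι]

/-- Linear systems with continuous coefficients have global solutions. -/
theorem exists_linear_ode_solution {A : ℝ → ι → ι → ℝ} {T : ℝ} (hT : 0 ≤ T)
    (hA : ∀ i j, ContinuousOn (fun t => A t i j) (Icc 0 T)) (x₀ : ι → ℝ) :
    ∃ v : ℝ → ι → ℝ, v 0 = x₀ ∧
      ∀ t ∈ Icc 0 T, ∀ i, HasDerivAt (fun s => v s i) (∑ j, A t i j * v t j) t := by
  obtain ⟨M, hM0, hM⟩ := exists_rate_bound hA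
  obtain ⟨v, h0, -, h⟩ := exists_ode_solution (f := fun t x i => ∑ j, A t i j * x j) hT
    (K := ⟨Fintype.card ι * M, by positivity⟩)
    (fun x => continuousOn_pi.2 fun i =>
      continuousOn_finsetSum _ fun j _ => (hA i j).mul continuousOn_const)
    (fun t ht => LipschitzWith.of_dist_le_mul fun x y => by
      refine (dist_pi_le_iff (mul_nonneg (NNReal.coe_nonneg _) dist_nonneg)).2 fun i => ?_
      rw [Real.dist_eq, ← Finset.sum_sub_distrib]
      refine (Finset.abs_sum_le_sum_abs _ _).trans ?_
      refine (Finset.sum_le_card_nsmul _ _ (M * dist x y) fun j _ => ?_).trans_eq ?_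
      · rw [← mul_sub, abs_mul, ← Real.dist_eq]
        gcongr
        · exact hM t ht i j
        · exact dist_le_pi_dist x y j
      · rw [nsmul_eq_mul, ← mul_assoc]; rfl) x₀
  exact ⟨v, h0, fun t ht i => hasDerivAt_pi.1 (h t ht) i⟩

variable [DecidableEq ι]

/-- Transition matrices of a finite jump process on `[0, T]`. The field `hasDerivAt` is the forward
equation, in weak form. -/
structure TransitionMatrices (T : ℝ) (target : Λ → ι → ι) (rate : ℝ → Λ → ι → ℝ) where
  mat : ℝ → ℝ → Matrix ι ι ℝ
  nonneg : ∀ t s, 0 ≤ t → t ≤ s → s ≤ T → ∀ i j, 0 ≤ mat t s i j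
  row_sum : ∀ t s, 0 ≤ t → t ≤ s → s ≤ T → ∀ i, ∑ j, mat t s i j = 1
  self : ∀ t ∈ Icc 0 T, mat t t = 1
  mul : ∀ t ∈ Icc 0 T, ∀ s ∈ Icc 0 T, ∀ u ∈ Icc 0 T, mat t s * mat s u = mat t u
  hasDerivAt : ∀ t ∈ Icc 0 T, ∀ s ∈ Icc 0 T, ∀ i, ∀ (w : ℝ → ι → ℝ) (w' : ι → ℝ),
    (∀ j, HasDerivAt (fun u => w u j) (w' j) s) →
    HasDerivAt (fun u => ∑ j, mat t u i j * w u j)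
      (∑ j, mat t s i j * (w' j + jumpOp target (rate s) (w s) j)) s

/-- The matrix of `jumpOp`. -/
def rateMatrix (target : Λ → ι → ι) (rate : Λ → ι → ℝ) : Matrix ι ι ℝ :=
  fun i j => jumpOp target rate (Pi.single j 1) i

theorem jumpOp_eq_sum (target : Λ → ι → ι) (rate : Λ → ι → ℝ) (w : ι → ℝ) (i : ι) :
    jumpOp target rate w i = ∑ j, rateMatrix target rate i j * w j := by
  simp only [rateMatrix, jumpOp, Finset.sum_mul]
  rw [Finset.sum_comm]
  refine Finset.sum_congr rfl fun e _ => ?_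
  simp only [mul_assoc, ← Finset.mul_sum, sub_mul, Finset.sum_sub_distrib]
  simp [Pi.single_apply]

/-- Fundamental matrices of the forward and of the backward equation. -/
theorem exists_fundamental_matrices {Q : ℝ → Matrix ι ι ℝ} {T : ℝ} (hT : 0 ≤ T)
    (hQ : ∀ i j, ContinuousOn (fun t => Q t i j) (Icc 0 T)) :
    ∃ Φ Ψ : ℝ → Matrix ι ι ℝ,
      (∀ t ∈ Icc 0 T, ∀ i j, HasDerivAt (fun s => Φ s i j) ((Φ t * Q t) i j) t) ∧
      ∀ t ∈ Icc 0 T, Φ t * Ψ t = 1 := by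
  obtain ⟨φ, hφ0, hφ⟩ := exists_linear_ode_solution (ι := ι × ι)
    (A := fun t p p' => if p.1 = p'.1 then Q t p'.2 p.2 else 0) hT
    (fun p p' => by split_ifs; exacts [hQ _ _, continuousOn_const])
    (fun p => (1 : Matrix ι ι ℝ) p.1 p.2)
  obtain ⟨ψ, hψ0, hψ⟩ := exists_linear_ode_solution (ι := ι × ι)
    (A := fun t p p' => if p.2 = p'.2 then - Q t p.1 p'.1 else 0) hT
    (fun p p' => by split_ifs; exacts [(hQ _ _).neg, continuousOn_const])
    (fun p => (1 : Matrix ι ι ℝ) p.1 p.2)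
  set Φ : ℝ → Matrix ι ι ℝ := fun t i j => φ t (i, j) with hΦ
  set Ψ : ℝ → Matrix ι ι ℝ := fun t i j => ψ t (i, j) with hΨ
  have hΦ' : ∀ t ∈ Icc 0 T, ∀ i j, HasDerivAt (fun s => Φ s i j) ((Φ t * Q t) i j) t := by
    intro t ht i j
    refine (hφ t ht (i, j)).congr_deriv ?_
    simp only [Fintype.sum_prod_type, Matrix.mul_apply, ite_mul, zero_mul]
    rw [Finset.sum_eq_single i (fun b _ hb => by simp [hb.symm]) (by simp)]
    exact Finset.sum_congr rfl fun k _ => by simp [hΦ, mul_comm]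
  have hΨ' : ∀ t ∈ Icc 0 T, ∀ i j, HasDerivAt (fun s => Ψ s i j) ((-(Q t * Ψ t)) i j) t := by
    intro t ht i j
    refine (hψ t ht (i, j)).congr_deriv ?_
    simp only [Fintype.sum_prod_type, Matrix.neg_apply, Matrix.mul_apply, ite_mul, zero_mul]
    rw [← Finset.sum_neg_distrib]
    refine Finset.sum_congr rfl fun k _ => ?_
    rw [Finset.sum_eq_single j (fun b _ hb => by simp [hb.symm]) (by simp)]
    simp [hΨ]
  refine ⟨Φ, Ψ, hΦ', fun t ht => ?_⟩
  ext i j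
  have hd : ∀ s ∈ Icc 0 T, HasDerivAt (fun s => (Φ s * Ψ s) i j) 0 s := by
    intro s hs
    have h : HasDerivAt (fun s => ∑ k, Φ s i k * Ψ s k j)
        (∑ k, ((Φ s * Q s) i k * Ψ s k j + Φ s i k * (-(Q s * Ψ s)) k j)) s :=
      HasDerivAt.fun_sum fun k _ => (hΦ' s hs i k).mul (hΨ' s hs k j)
    refine h.congr_deriv ?_
    rw [Finset.sum_add_distrib, ← Matrix.mul_apply, ← Matrix.mul_apply, Matrix.mul_neg,
      Matrix.neg_apply, Matrix.mul_assoc]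
    ring
  have hconst := constant_of_has_deriv_right_zero
    (fun s hs => (hd s hs).continuousAt.continuousWithinAt)
    (fun s hs => (hd s (Ico_subset_Icc_self hs)).hasDerivWithinAt) t ht
  have h1 : Φ 0 = 1 := by ext i j; simp [hΦ, hφ0]
  have h2 : Ψ 0 = 1 := by ext i j; simp [hΨ, hψ0]
  rw [hconst, h1, h2, one_mul]

/-- The transition matrices are `Φ(t)⁻¹ Φ(s)` for a fundamental matrix `Φ` of the forward equation.
As functions of the initial time, their columns solve the backward equation, so they are nonnegative
by the maximum principle. -/
theorem exists_transitionMatrices (target : Λ → ι → ι) {rate : ℝ → Λ → ι → ℝ} {T : ℝ} (hT : 0 ≤ T)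
    (hrate : ∀ e a, ContinuousOn (fun t => rate t e a) (Icc 0 T))
    (h0 : ∀ t ∈ Icc 0 T, ∀ e a, 0 ≤ rate t e a) :
    Nonempty (TransitionMatrices T target rate) := by
  obtain ⟨M, hM0, hM⟩ := exists_rate_bound hrate
  obtain ⟨Φ, Ψ, hΦ, hΦΨ⟩ := exists_fundamental_matrices
    (Q := fun t => rateMatrix target (rate t)) hT (fun i j =>
      continuousOn_jumpOp (u := fun _ => Pi.single j 1) hrate (fun _ => continuousOn_const) i)
  have hforward : ∀ t ∈ Icc 0 T, ∀ s ∈ Icc 0 T, ∀ i, ∀ (w : ℝ → ι → ℝ) (w' : ι → ℝ),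
      (∀ j, HasDerivAt (fun u => w u j) (w' j) s) →
      HasDerivAt (fun u => ∑ j, (Ψ t * Φ u) i j * w u j)
        (∑ j, (Ψ t * Φ s) i j * (w' j + jumpOp target (rate s) (w s) j)) s := by
    intro t ht s hs i w w' hw
    have hent : ∀ j, HasDerivAt (fun u => (Ψ t * Φ u) i j)
        ((Ψ t * Φ s * rateMatrix target (rate s)) i j) s := by
      intro j
      have h : HasDerivAt (fun u => ∑ k, Ψ t i k * Φ u k j)
        (∑ k, Ψ t i k * (Φ s * rateMatrix target (rate s)) k j) s :=
        HasDerivAt.fun_sum fun k _ => (hΦ s hs k j).const_mul _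
      rwa [← Matrix.mul_apply, ← Matrix.mul_assoc] at h
    have h : HasDerivAt (fun u => ∑ j, (Ψ t * Φ u) i j * w u j)
        (∑ j, ((Ψ t * Φ s * rateMatrix target (rate s)) i j * w s j + (Ψ t * Φ s) i j * w' j)) s :=
      HasDerivAt.fun_sum fun j _ => (hent j).mul (hw j)
    refine h.congr_deriv ?_
    simp only [mul_add, Finset.sum_add_distrib, jumpOp_eq_sum]
    rw [add_comm]
    congr 1
    simp only [Matrix.mul_apply (M := Ψ t * Φ s), Finset.sum_mul, Finset.mul_sum]
    rw [Finset.sum_comm]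
    exact Finset.sum_congr rfl fun j _ => Finset.sum_congr rfl fun k _ => by ring
  have hself : ∀ t ∈ Icc 0 T, Ψ t * Φ t = 1 := fun t ht => mul_eq_one_comm.1 (hΦΨ t ht)
  -- transition probabilities solve the backward equation, which has a maximum principle
  have hsol : ∀ t s, 0 ≤ t → t ≤ s → s ≤ T → ∀ (v : ℝ → ι → ℝ),
      (∀ u ∈ Icc 0 s, ∀ a, HasDerivAt (fun r => v r a) (-(jumpOp target (rate u) (v u) a)) u) →
      ∀ i, ∑ j, (Ψ t * Φ s) i j * v s j = v t i := by
    intro t s h0t hts hsT v hv i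
    have ht : t ∈ Icc 0 T := ⟨h0t, hts.trans hsT⟩
    have hd : ∀ u ∈ Icc t s, HasDerivAt (fun u => ∑ j, (Ψ t * Φ u) i j * v u j) 0 u := by
      intro u hu
      refine (hforward t ht u ⟨h0t.trans hu.1, hu.2.trans hsT⟩ i v _
        (hv u ⟨h0t.trans hu.1, hu.2⟩)).congr_deriv ?_
      simp
    have := constant_of_has_deriv_right_zero
      (fun u hu => (hd u hu).continuousAt.continuousWithinAt)
      (fun u hu => (hd u (Ico_subset_Icc_self hu)).hasDerivWithinAt) s ⟨hts, le_rfl⟩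
    rw [this, hself t ht]
    simp [Matrix.one_apply]
  refine ⟨⟨fun t s => Ψ t * Φ s, ?_, ?_, hself, ?_, hforward⟩⟩
  · intro t s h0t hts hsT i j
    have hsub : Icc 0 s ⊆ Icc 0 T := Icc_subset_Icc_right hsT
    obtain ⟨v, hvs, -, hv⟩ := exists_backward_solution target (h0t.trans hts)
      (fun e a => (hrate e a).mono hsub) (f := fun _ _ => 0) (fun _ => continuousOn_const)
      (Pi.single j 1)
    have h1 := hsol t s h0t hts hsT v (fun u hu a => by simpa using hv u hu a) i
    rw [hvs] at h1
    simp only [Pi.single_apply, mul_ite, mul_one, mul_zero, Finset.sum_ite_eq', Finset.mem_univ,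
      if_true] at h1
    rw [h1]
    -- `1 - 2 v` takes values in `[-1, 1]` at the terminal time, hence always
    have h2 := norm_le_of_backward (target := target) (rate := rate) (T := s) (M := M) (c := 0)
      (κ := 1) (fun t ht => h0 t (hsub ht))
      (fun t ht e a => (le_abs_self _).trans (hM t (hsub ht) e a)) hM0
      (u := fun t a => 1 - 2 * v t a)
      (u' := fun t a => 2 * jumpOp target (rate t) (v t) a)
      (fun t ht a => by
        refine (((hv t ht a).const_mul 2).const_sub 1).congr_deriv ?_
        ring)
      le_rfl (fun t _ a => by
        have : jumpOp target (rate t) (fun a => 1 - 2 * v t a) a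
            = - (2 * jumpOp target (rate t) (v t) a) := by
          simp only [jumpOp, Finset.mul_sum, ← Finset.sum_neg_distrib]
          exact Finset.sum_congr rfl fun e _ => by ring
        simp [this]) zero_le_one
      ((pi_norm_le_iff_of_nonneg zero_le_one).2 fun a => by
        rw [hvs, Pi.single_apply]
        split_ifs <;> norm_num) ⟨h0t, hts⟩
    simp only [mul_zero, zero_mul, Real.exp_zero, mul_one] at h2
    have h3 := (norm_le_pi_norm _ i).trans h2
    rw [Real.norm_eq_abs, abs_le] at h3
    linarith [h3.2]
  · intro t s h0t hts hsT i
    have := hsol t s h0t hts hsT (fun _ _ => 1) (fun u _ a => by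
      simpa [jumpOp] using hasDerivAt_const u (1 : ℝ)) i
    simpa using this
  · intro t ht s hs u hu
    rw [← Matrix.mul_assoc, Matrix.mul_assoc (Ψ t), hΦΨ s hs, mul_one]

end Transition

/-! ### Barycentric coordinates -/

section Coordinates

variable {m : ℕ}

@[simp] theorem coord_castSucc (x : Vec m) (k : Fin m) : coord x k.castSucc = x k := by
  simp [coord]

@[simp] theorem coord_last (x : Vec m) : coord x (Fin.last m) = 1 - ∑ k, x k := by
  simp [coord]

@[simp] theorem vertex_castSucc (k : Fin m) :
    (vertex k.castSucc : Vec m) = EuclideanSpace.single k 1 := by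
  simp [vertex]

@[simp] theorem vertex_last : (vertex (Fin.last m) : Vec m) = 0 := by
  simp [vertex]

theorem coord_nonneg {x : Vec m} (hx : x ∈ simplex m) (i : Fin (m + 1)) : 0 ≤ coord x i := by
  induction i using Fin.lastCases with
  | last => simpa using hx.2
  | cast k => simpa using hx.1 k

theorem sum_coord (x : Vec m) : ∑ i, coord x i = 1 := by
  simp [Fin.sum_univ_castSucc]

theorem sum_coord_smul_vertex (x : Vec m) : ∑ i, coord x i • (vertex i : Vec m) = x := by
  ext k
  simp [Fin.sum_univ_castSucc, Pi.single_apply]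

theorem norm_vertex_le (i : Fin (m + 1)) : ‖(vertex i : Vec m)‖ ≤ 1 := by
  induction i using Fin.lastCases with
  | last => simp
  | cast k => simp

theorem norm_le_one_of_mem_simplex {x : Vec m} (hx : x ∈ simplex m) : ‖x‖ ≤ 1 := by
  rw [← sum_coord_smul_vertex x]
  refine (norm_sum_le _ _).trans ?_
  rw [← sum_coord x]
  refine Finset.sum_le_sum fun i _ => ?_
  rw [norm_smul, Real.norm_of_nonneg (coord_nonneg hx i)]
  exact mul_le_of_le_one_right (coord_nonneg hx i) (norm_vertex_le i)

theorem coord_add_smul_vertex_sub (x : Vec m) (s : ℝ) (i j a : Fin (m + 1)) :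
    coord (x + s • jump i j) a
      = coord x a + s * ((if a = j then 1 else 0) - (if a = i then 1 else 0)) := by
  have hv : ∀ (i : Fin (m + 1)) (k : Fin m),
      (vertex i : Vec m) k = if k.castSucc = i then 1 else 0 := by
    intro i k
    induction i using Fin.lastCases with
    | last => simp [(Fin.castSucc_lt_last k).ne]
    | cast l => simp
  induction a using Fin.lastCases with
  | cast k => simp [jump, hv]
  | last =>
    have hs : ∀ i : Fin (m + 1),
        ∑ k, (vertex i : Vec m) k = 1 - if Fin.last m = i then 1 else 0 := by
      intro i
      induction i using Fin.lastCases with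
      | last => simp
      | cast l => simp [(Fin.castSucc_lt_last l).ne']
    simp only [coord_last, PiLp.add_apply, PiLp.smul_apply, jump, PiLp.sub_apply, smul_eq_mul,
      Finset.sum_add_distrib, ← Finset.mul_sum, Finset.sum_sub_distrib, hs]
    ring

theorem norm_jump_le (i j : Fin (m + 1)) : ‖(jump i j : Vec m)‖ ≤ 2 := by
  have h := norm_sub_le (vertex j : Vec m) (vertex i)
  have := norm_vertex_le (m := m) i
  have := norm_vertex_le (m := m) j
  unfold jump
  linarith

end Coordinates

/-! ### Particle systems in a common environment -/

/-- Jump rates of a particle system with states `Fin (m + 1)` in an environment with states `Δ`. For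
every label `ρ : R`, the environment jumps from `d` to `τ ρ d` at rate `r t ρ d x`, and every
particle jumps from `i` to `j` at rate `q t i j d x`, where `x` is the distribution of the
particles. For the major player, the environment is the state of the major player; for a singled-out
minor player, it is the pair of his own state and of the state of the major player. -/
structure ParticleRates (m : ℕ) (Δ R : Type*) where
  τ : R → Δ → Δ
  r : ℝ → R → Δ → Vec m → ℝ
  q : ℝ → Fin (m + 1) → Fin (m + 1) → Δ → Vec m → ℝ

/-- Nonnegative Lipschitz rates. Only the rates of the particles, not those of the environment, have
a bound that enters the estimates. -/
structure ParticleRates.Regular {m : ℕ} {Δ R : Type*} (𝒮 : ParticleRates m Δ R) (T κ C : ℝ) :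
    Prop where
  r_nonneg : ∀ t ∈ Icc 0 T, ∀ ρ d, ∀ x ∈ simplex m, 0 ≤ 𝒮.r t ρ d x
  q_nonneg : ∀ t ∈ Icc 0 T, ∀ i j d, ∀ x ∈ simplex m, 0 ≤ 𝒮.q t i j d x
  q_le : ∀ t ∈ Icc 0 T, ∀ i j d, ∀ x ∈ simplex m, 𝒮.q t i j d x ≤ C
  r_lip : ∀ t ∈ Icc 0 T, ∀ t' ∈ Icc 0 T, ∀ ρ d, ∀ x ∈ simplex m, ∀ x' ∈ simplex m,
    |𝒮.r t ρ d x - 𝒮.r t' ρ d x'| ≤ κ * (|t - t'| + ‖x - x'‖)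
  q_lip : ∀ t ∈ Icc 0 T, ∀ t' ∈ Icc 0 T, ∀ i j d, ∀ x ∈ simplex m, ∀ x' ∈ simplex m,
    |𝒮.q t i j d x - 𝒮.q t' i j d x'| ≤ κ * (|t - t'| + ‖x - x'‖)

/-- Bounded Lipschitz running and terminal costs. -/
structure CostRegular {m : ℕ} {Δ : Type*} (T κ B : ℝ) (f : ℝ → Δ × Vec m → ℝ) (g : Δ × Vec m → ℝ) :
    Prop where
  f_lip : ∀ t ∈ Icc 0 T, ∀ t' ∈ Icc 0 T, ∀ d, ∀ x ∈ simplex m, ∀ x' ∈ simplex m,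
    |f t (d, x) - f t' (d, x')| ≤ κ * (|t - t'| + ‖x - x'‖)
  f_le : ∀ t ∈ Icc 0 T, ∀ d, ∀ x ∈ simplex m, |f t (d, x)| ≤ B
  g_lip : ∀ d, ∀ x ∈ simplex m, ∀ x' ∈ simplex m, |g (d, x) - g (d, x')| ≤ κ * ‖x - x'‖
  g_le : ∀ d, ∀ x ∈ simplex m, |g (d, x)| ≤ B

/-- States of the environment and of `n` labelled particles. -/
abbrev Config (Δ : Type*) (m n : ℕ) : Type _ := Δ × (Fin n → Fin (m + 1))

/-- The distribution `(w d + ∑ vertex (σ l)) / N`. The weight `w d` is the contribution of players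
that belong to the environment. -/
def emp {m n : ℕ} {Δ : Type*} (N : ℕ) (w : Δ → Vec m) (c : Config Δ m n) : Vec m :=
  (1 / N : ℝ) • (w c.1 + ∑ l, vertex (c.2 l))

/-- Of `N` players, `n` are particles, and the environment contributes the others, whose number is
bounded: by `norm_le`, it does not matter for the law of large numbers whether the weight `w d` is
replaced by its expected value for players with an arbitrary law `y`. -/
structure IsWeight {m : ℕ} {Δ : Type*} (N n : ℕ) (w : Δ → Vec m) : Prop where
  pos : 0 < N
  le : n ≤ N
  mem : ∀ c : Config Δ m n, emp N w c ∈ simplex m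
  norm_le : ∀ d, ∀ y ∈ simplex m, ‖w d - ((N : ℝ) - n) • y‖ ≤ 2

/-- Move the particle `l` to the state `j`. -/
def move {m n : ℕ} {Δ : Type*} (c : Config Δ m n) (l : Fin n) (j : Fin (m + 1)) : Config Δ m n :=
  (c.1, Function.update c.2 l j)

section Particles

variable {m n : ℕ} {Δ R : Type*}

theorem emp_move (N : ℕ) (w : Δ → Vec m) (c : Config Δ m n) (l : Fin n) (j : Fin (m + 1)) :
    emp N w (move c l j) = emp N w c + (1 / N : ℝ) • jump (c.2 l) j := by
  have h : ∑ k, (vertex (Function.update c.2 l j k) : Vec m)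
      = ∑ k, vertex (c.2 k) + jump (c.2 l) j := by
    rw [← Finset.add_sum_erase _ _ (Finset.mem_univ l),
      ← Finset.add_sum_erase (a := l) _ (fun k => (vertex (c.2 k) : Vec m)) (Finset.mem_univ l)]
    have : ∑ k ∈ Finset.univ.erase l, (vertex (Function.update c.2 l j k) : Vec m)
        = ∑ k ∈ Finset.univ.erase l, vertex (c.2 k) :=
      Finset.sum_congr rfl fun k hk => by rw [Function.update_of_ne (Finset.ne_of_mem_erase hk)]
    rw [this, Function.update_self]
    simp only [jump]
    abel
  simp only [emp, move, h, ← smul_add, add_assoc]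

theorem norm_emp_move_sub_le {N : ℕ} (w : Δ → Vec m) (c : Config Δ m n)
    (l : Fin n) (j : Fin (m + 1)) : ‖emp N w (move c l j) - emp N w c‖ ≤ 2 / N := by
  rw [emp_move, add_sub_cancel_left, norm_smul, Real.norm_of_nonneg (by positivity)]
  calc (1 / N : ℝ) * ‖(jump (c.2 l) j : Vec m)‖ ≤ 1 / N * 2 := by gcongr; exact norm_jump_le _ _
    _ = 2 / N := by ring

/-- Labels of the jumps of the particle system: jumps of the environment, and moves of a particle.
-/
abbrev Label (R : Type*) (m n : ℕ) : Type _ := R ⊕ Fin n × Fin (m + 1)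

namespace ParticleRates

variable (𝒮 : ParticleRates m Δ R)

/-- Targets of the jumps of the particle system. -/
def target : Label R m n → Config Δ m n → Config Δ m n
  | .inl ρ, c => (𝒮.τ ρ c.1, c.2)
  | .inr (l, b), c => move c l b

/-- Rates of the jumps of the particle system. -/
def rate (N : ℕ) (w : Δ → Vec m) (t : ℝ) : Label R m n → Config Δ m n → ℝ
  | .inl ρ, c => 𝒮.r t ρ c.1 (emp N w c)
  | .inr (l, b), c => 𝒮.q t (c.2 l) b c.1 (emp N w c)

end ParticleRates

theorem ParticleRates.Regular.rate_nonneg {𝒮 : ParticleRates m Δ R} {N : ℕ} {w : Δ → Vec m}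
    {T κ C : ℝ} (h𝒮 : 𝒮.Regular T κ C) (hw : IsWeight N n w) {t : ℝ} (ht : t ∈ Icc 0 T)
    (e : Label R m n) (c : Config Δ m n) : 0 ≤ 𝒮.rate N w t e c := by
  rcases e with ρ | ⟨l, b⟩
  · exact h𝒮.r_nonneg t ht ρ c.1 _ (hw.mem c)
  · exact h𝒮.q_nonneg t ht (c.2 l) b c.1 _ (hw.mem c)

theorem continuousOn_of_lip {h : ℝ → ℝ} {T κ : ℝ}
    (hh : ∀ t ∈ Icc 0 T, ∀ t' ∈ Icc 0 T, |h t - h t'| ≤ κ * |t - t'|) : ContinuousOn h (Icc 0 T) := by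
  have : LipschitzOnWith κ.toNNReal h (Icc 0 T) := LipschitzOnWith.of_dist_le_mul fun x hx y hy => by
    rw [Real.dist_eq, Real.dist_eq]
    refine (hh x hx y hy).trans ?_
    gcongr
    exact Real.le_coe_toNNReal κ
  exact this.continuousOn

theorem ParticleRates.Regular.continuousOn_rate {𝒮 : ParticleRates m Δ R} {N : ℕ} {w : Δ → Vec m}
    {T κ C : ℝ} (h𝒮 : 𝒮.Regular T κ C) (hw : IsWeight N n w) (e : Label R m n) (c : Config Δ m n) :
    ContinuousOn (fun t => 𝒮.rate N w t e c) (Icc 0 T) := by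
  refine continuousOn_of_lip (κ := κ) fun t ht t' ht' => ?_
  rcases e with ρ | ⟨l, b⟩
  · simpa [ParticleRates.rate] using h𝒮.r_lip t ht t' ht' ρ c.1 _ (hw.mem c) _ (hw.mem c)
  · simpa [ParticleRates.rate] using h𝒮.q_lip t ht t' ht' (c.2 l) b c.1 _ (hw.mem c) _ (hw.mem c)

/-- Differences of a function under the moves of one particle. -/
def diffs (v : Config Δ m n → ℝ) (p : Config Δ m n × Fin n × Fin (m + 1)) : ℝ :=
  v (move p.1 p.2.1 p.2.2) - v p.1

variable [Fintype Δ] [Fintype R]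

theorem abs_diff_le (v : Config Δ m n → ℝ) (c : Config Δ m n) (l : Fin n) (j : Fin (m + 1)) :
    |v (move c l j) - v c| ≤ ‖diffs v‖ := norm_le_pi_norm (diffs v) (c, l, j)

theorem norm_diffs_le_two_mul (v : Config Δ m n → ℝ) : ‖diffs v‖ ≤ 2 * ‖v‖ := by
  refine (pi_norm_le_iff_of_nonneg (by positivity)).2 fun p => ?_
  have h1 := norm_le_pi_norm v (move p.1 p.2.1 p.2.2)
  have h2 := norm_le_pi_norm v p.1
  have h3 := norm_sub_le (v (move p.1 p.2.1 p.2.2)) (v p.1)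
  rw [diffs]
  linarith

/-- `v` is, for the particle system, the expected cost until time `T`, up to an error that is
controlled by the influence of a single particle. -/
structure IsParticleCost (𝒮 : ParticleRates m Δ R) (N : ℕ) (w : Δ → Vec m) (T A : ℝ)
    (f : ℝ → Δ × Vec m → ℝ) (g : Δ × Vec m → ℝ) (v : ℝ → Config Δ m n → ℝ) : Prop where
  contDiff : ∀ c, ContDiff ℝ 1 fun t => v t c
  equation : ∀ t ∈ Icc 0 T, ∀ c,
    |deriv (fun s => v s c) t + jumpOp 𝒮.target (𝒮.rate N w t) (v t) c + f t (c.1, emp N w c)|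
      ≤ A * ‖diffs (v t)‖
  terminal : ∀ c, v T c = g (c.1, emp N w c)

namespace IsParticleCost

variable {𝒮 : ParticleRates m Δ R} {N : ℕ} {w : Δ → Vec m} {T A κ C B : ℝ}
  {f : ℝ → Δ × Vec m → ℝ} {g : Δ × Vec m → ℝ} {v : ℝ → Config Δ m n → ℝ}

theorem hasDerivAt (hv : IsParticleCost 𝒮 N w T A f g v) (t : ℝ) (c : Config Δ m n) :
    HasDerivAt (fun s => v s c) (deriv (fun s => v s c) t) t :=
  (((hv.contDiff c).differentiable one_ne_zero) t).hasDerivAt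

end IsParticleCost

/-- Bound for the costs of particle systems, uniform in the number of particles. -/
def costBound (T A B : ℝ) : ℝ := Real.exp (2 * (1 + 2 * A) * T) * B

/-- `lipBound / N` bounds the influence of a single particle among `N`. The parameter `k` is the
number of labels for the jumps of the environment. -/
def lipBound (m k : ℕ) (T κ C A B : ℝ) : ℝ :=
  Real.exp (2 * (1 + 2 * A + (m + 1) * (2 * κ + 3 * C)) * T)
    * (2 * κ + 4 * κ * k * costBound T A B)

namespace IsParticleCost

variable {𝒮 : ParticleRates m Δ R} {N : ℕ} {w : Δ → Vec m} {T A κ C B : ℝ}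
  {f : ℝ → Δ × Vec m → ℝ} {g : Δ × Vec m → ℝ} {v : ℝ → Config Δ m n → ℝ}

theorem norm_le (hv : IsParticleCost 𝒮 N w T A f g v) (h𝒮 : 𝒮.Regular T κ C) (hw : IsWeight N n w)
    (hfg : CostRegular T κ B f g) (hA : 0 ≤ A) (hB : 0 ≤ B) {t : ℝ} (ht : t ∈ Icc 0 T) :
    ‖v t‖ ≤ costBound T A B := by
  obtain ⟨M, hM0, hM⟩ := exists_rate_bound (h𝒮.continuousOn_rate hw)
  have h := norm_le_of_backward (target := 𝒮.target) (rate := 𝒮.rate N w) (c := 1 + 2 * A) (κ := B)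
    (fun t ht => h𝒮.rate_nonneg hw ht) (fun t ht e c => (le_abs_self _).trans (hM t ht e c)) hM0
    (fun t _ c => hv.hasDerivAt t c) (by positivity) (fun t ht c => by
      have h1 := hv.equation t ht c
      have h2 := hfg.f_le t ht c.1 _ (hw.mem c)
      have h3 := mul_le_mul_of_nonneg_left (norm_diffs_le_two_mul (v t)) hA
      have h4 := abs_sub (deriv (fun s => v s c) t + jumpOp 𝒮.target (𝒮.rate N w t) (v t) c
        + f t (c.1, emp N w c)) (f t (c.1, emp N w c))
      rw [add_sub_cancel_right] at h4
      have := norm_nonneg (v t)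
      nlinarith) hB ((pi_norm_le_iff_of_nonneg hB).2 fun c => by
        rw [hv.terminal]; exact hfg.g_le _ _ (hw.mem c)) ht
  refine h.trans ?_
  unfold costBound
  have := ht.1
  gcongr
  linarith

/-- The influence of a single particle is of order `1 / N`: the central estimate. The differences
`diffs v` solve a backward equation of their own, for the system with one frozen particle. The jumps
of the environment only enter through the Lipschitz constant of their rates. -/
theorem norm_diffs_le (hv : IsParticleCost 𝒮 N w T A f g v) (h𝒮 : 𝒮.Regular T κ C)
    (hw : IsWeight N n w) (hfg : CostRegular T κ B f g) (hA : 0 ≤ A) (hB : 0 ≤ B) (hκ : 0 ≤ κ)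
    (hC : 0 ≤ C) {t : ℝ} (ht : t ∈ Icc 0 T) :
    ‖diffs (v t)‖ ≤ lipBound m (Fintype.card R) T κ C A B / N := by
  have hN : (0 : ℝ) < N := by exact_mod_cast hw.pos
  set β := costBound T A B with hβ
  have hβ0 : 0 ≤ β := by rw [hβ, costBound]; positivity
  set k := Fintype.card R with hk
  obtain ⟨M, hM0, hM⟩ := exists_rate_bound (h𝒮.continuousOn_rate (n := n) hw)
  -- the system with one frozen particle, together with a move of this particle
  set tgt : Label R m n → Config Δ m n × Fin n × Fin (m + 1) → Config Δ m n × Fin n × Fin (m + 1) :=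
    fun e p => (𝒮.target e p.1, p.2) with htgt
  set rt : ℝ → Label R m n → Config Δ m n × Fin n × Fin (m + 1) → ℝ :=
    fun t e p => match e with
      | .inl ρ => 𝒮.r t ρ p.1.1 (emp N w (move p.1 p.2.1 p.2.2))
      | .inr (l, b) => if l = p.2.1 then 0 else
          𝒮.q t (p.1.2 l) b p.1.1 (emp N w (move p.1 p.2.1 p.2.2)) with hrt
  have hrt0 : ∀ t ∈ Icc 0 T, ∀ e p, 0 ≤ rt t e p := by
    rintro t ht (ρ | ⟨l, b⟩) p
    · exact h𝒮.r_nonneg t ht _ _ _ (hw.mem _)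
    · simp only [hrt]
      split_ifs
      exacts [le_rfl, h𝒮.q_nonneg t ht _ _ _ _ (hw.mem _)]
  have hrtM : ∀ t ∈ Icc 0 T, ∀ e p, rt t e p ≤ M := by
    rintro t ht (ρ | ⟨l, b⟩) p
    · exact (le_abs_self _).trans (hM t ht (.inl ρ) (move p.1 p.2.1 p.2.2))
    · simp only [hrt]
      split_ifs with hl
      · exact hM0
      · have := (le_abs_self _).trans (hM t ht (.inr (l, b)) (move p.1 p.2.1 p.2.2))
        simpa [ParticleRates.rate, move, Function.update_of_ne hl] using this
  have key : ∀ t ∈ Icc 0 T, ∀ p,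
      |(deriv (fun s => v s (move p.1 p.2.1 p.2.2)) t - deriv (fun s => v s p.1) t)
        + jumpOp tgt (rt t) (diffs (v t)) p|
      ≤ (1 + 2 * A + (m + 1) * (2 * κ + 3 * C))
        * ((2 * κ + 4 * κ * k * β) / N + ‖diffs (v t)‖) := by
    rintro t ht ⟨c, l, j⟩
    have hvβ : ∀ c, |v t c| ≤ β := fun c =>
      (norm_le_pi_norm (v t) c).trans (hv.norm_le h𝒮 hw hfg hA hB ht)
    set c' := move c l j with hc'
    have hx : emp N w c ∈ simplex m := hw.mem c
    have hx' : emp N w c' ∈ simplex m := hw.mem c'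
    have hδ : ‖emp N w c - emp N w c'‖ ≤ 2 / N := by
      rw [norm_sub_rev]; exact norm_emp_move_sub_le w c l j
    set x := emp N w c
    set x' := emp N w c'
    set u := ‖diffs (v t)‖ with hu
    have hu0 : 0 ≤ u := norm_nonneg _
    -- jumps of the environment
    have hE1 : |∑ ρ, (rt t (.inl ρ) (c, l, j)
          * (diffs (v t) (tgt (.inl ρ) (c, l, j)) - diffs (v t) (c, l, j))
        - (𝒮.rate N w t (.inl ρ) c' * (v t (𝒮.target (.inl ρ) c') - v t c')
          - 𝒮.rate N w t (.inl ρ) c * (v t (𝒮.target (.inl ρ) c) - v t c)))|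
        ≤ k * (κ * (2 / N) * (2 * β)) := by
      refine (Finset.abs_sum_le_sum_abs _ _).trans ?_
      refine (Finset.sum_le_card_nsmul _ _ (κ * (2 / N) * (2 * β)) fun ρ _ => ?_).trans_eq
        (by simp [hk])
      have : rt t (.inl ρ) (c, l, j)
          * (diffs (v t) (tgt (.inl ρ) (c, l, j)) - diffs (v t) (c, l, j))
        - (𝒮.rate N w t (.inl ρ) c' * (v t (𝒮.target (.inl ρ) c') - v t c')
          - 𝒮.rate N w t (.inl ρ) c * (v t (𝒮.target (.inl ρ) c) - v t c))
          = (𝒮.r t ρ c.1 x - 𝒮.r t ρ c.1 x') * (v t (𝒮.τ ρ c.1, c.2) - v t c) := by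
        simp only [hrt, htgt, diffs, ParticleRates.target, ParticleRates.rate, hc', move, x, x']
        ring
      rw [this, abs_mul]
      gcongr
      · refine (h𝒮.r_lip t ht t ht ρ c.1 x hx x' hx').trans ?_
        rw [sub_self, abs_zero, zero_add]
        gcongr
      · have h1 := hvβ (𝒮.τ ρ c.1, c.2)
        have h2 := hvβ c
        have h3 := abs_sub (v t (𝒮.τ ρ c.1, c.2)) (v t c)
        linarith
    -- moves of the particles
    have hE2 : |∑ lb : Fin n × Fin (m + 1), (rt t (.inr lb) (c, l, j)
          * (diffs (v t) (tgt (.inr lb) (c, l, j)) - diffs (v t) (c, l, j))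
        - (𝒮.rate N w t (.inr lb) c' * (v t (𝒮.target (.inr lb) c') - v t c')
          - 𝒮.rate N w t (.inr lb) c * (v t (𝒮.target (.inr lb) c) - v t c)))|
        ≤ (m + 1) * (2 * κ + 3 * C) * u := by
      refine (Finset.abs_sum_le_sum_abs _ _).trans ?_
      have hterm : ∀ lb ∈ (Finset.univ : Finset (Fin n × Fin (m + 1))), |rt t (.inr lb) (c, l, j)
          * (diffs (v t) (tgt (.inr lb) (c, l, j)) - diffs (v t) (c, l, j))
        - (𝒮.rate N w t (.inr lb) c' * (v t (𝒮.target (.inr lb) c') - v t c')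
          - 𝒮.rate N w t (.inr lb) c * (v t (𝒮.target (.inr lb) c) - v t c))|
          ≤ κ * (2 / N) * u + if lb.1 = l then 3 * C * u else 0 := by
        rintro ⟨l', b⟩ -
        by_cases hl : l' = l
        · -- the frozen particle: `O(1)` terms, but only `m + 1` of them
          subst hl
          have e1 : move c' l' b = move c l' b := by simp [hc', move]
          have e2 : c'.2 l' = j := by simp [hc', move]
          simp only [hrt, if_true, zero_mul, zero_sub, ParticleRates.rate, ParticleRates.target, e1,
            e2]
          have h1 := abs_diff_le (v t) c l' b
          have h2 := abs_diff_le (v t) c l' j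
          rw [← hc'] at h2
          have h3 : |v t (move c l' b) - v t c'| ≤ 2 * u := by
            have := abs_sub (v t (move c l' b) - v t c) (v t c' - v t c)
            rw [sub_sub_sub_cancel_right] at this
            linarith
          have h4 : |𝒮.q t j b c'.1 x' * (v t (move c l' b) - v t c')| ≤ C * (2 * u) := by
            rw [abs_mul, abs_of_nonneg (h𝒮.q_nonneg t ht j b _ x' hx')]
            gcongr
            exact h𝒮.q_le t ht j b _ x' hx'
          have h5 : |𝒮.q t (c.2 l') b c.1 x * (v t (move c l' b) - v t c)| ≤ C * u := by
            rw [abs_mul, abs_of_nonneg (h𝒮.q_nonneg t ht _ b _ x hx)]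
            gcongr
            exact h𝒮.q_le t ht _ b _ x hx
          rw [abs_neg]
          refine (abs_sub _ _).trans ((add_le_add h4 h5).trans ?_)
          have : 0 ≤ κ * (2 / N) * u := by positivity
          linarith
        · -- the other particles: `O(n)` terms, each with a factor `1 / N`
          have e1 : move c' l' b = move (move c l' b) l j := by
            simp only [hc', move]
            rw [Function.update_comm (Ne.symm hl)]
          have e2 : c'.2 l' = c.2 l' := by simp [hc', move, hl]
          have : rt t (.inr (l', b)) (c, l, j)
              * (diffs (v t) (tgt (.inr (l', b)) (c, l, j)) - diffs (v t) (c, l, j))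
            - (𝒮.rate N w t (.inr (l', b)) c' * (v t (𝒮.target (.inr (l', b)) c') - v t c')
              - 𝒮.rate N w t (.inr (l', b)) c * (v t (𝒮.target (.inr (l', b)) c) - v t c))
              = (𝒮.q t (c.2 l') b c.1 x - 𝒮.q t (c.2 l') b c.1 x')
                * (v t (move c l' b) - v t c) := by
            simp only [hrt, htgt, if_neg hl, diffs, ParticleRates.target, ParticleRates.rate, e1, e2]
            simp only [hc', x, x']
            rw [show (move c l j).1 = c.1 from rfl]
            ring
          rw [this, if_neg hl, add_zero, abs_mul]
          gcongr
          · refine (h𝒮.q_lip t ht t ht _ b c.1 x hx x' hx').trans ?_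
            rw [sub_self, abs_zero, zero_add]
            gcongr
          · exact abs_diff_le (v t) c l' b
      refine (Finset.sum_le_sum hterm).trans ?_
      have hs : ∑ lb : Fin n × Fin (m + 1), (if lb.1 = l then 3 * C * u else 0)
          = (m + 1) * (3 * C * u) := by
        rw [Fintype.sum_prod_type_right]
        simp
      rw [Finset.sum_add_distrib, hs]
      simp only [Finset.sum_const, Finset.card_univ, Fintype.card_prod, Fintype.card_fin,
        nsmul_eq_mul]
      push_cast
      have hn : (n : ℝ) * (2 / N) ≤ 2 := by
        rw [mul_div_assoc', div_le_iff₀ hN]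
        have : (n : ℝ) ≤ N := by exact_mod_cast hw.le
        linarith
      have : (n : ℝ) * (m + 1) * (κ * (2 / N) * u) ≤ (m + 1) * (2 * κ) * u := by
        calc (n : ℝ) * (m + 1) * (κ * (2 / N) * u) = (n * (2 / N)) * ((m + 1) * κ * u) := by ring
          _ ≤ 2 * ((m + 1) * κ * u) := by gcongr
          _ = _ := by ring
      linarith
    have hf1 : |f t (c'.1, x') - f t (c.1, x)| ≤ κ * (2 / N) := by
      have := hfg.f_lip t ht t ht c.1 x' hx' x hx
      rw [sub_self, abs_zero, zero_add, norm_sub_rev] at this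
      exact this.trans (by gcongr)
    have h1 := hv.equation t ht c
    have h2 := hv.equation t ht c'
    have hsplit : (deriv (fun s => v s c') t - deriv (fun s => v s c) t)
        + jumpOp tgt (rt t) (diffs (v t)) (c, l, j)
        = (deriv (fun s => v s c') t + jumpOp 𝒮.target (𝒮.rate N w t) (v t) c' + f t (c'.1, x'))
          - (deriv (fun s => v s c) t + jumpOp 𝒮.target (𝒮.rate N w t) (v t) c + f t (c.1, x))
          - (f t (c'.1, x') - f t (c.1, x))
          + (∑ ρ, (rt t (.inl ρ) (c, l, j)
          * (diffs (v t) (tgt (.inl ρ) (c, l, j)) - diffs (v t) (c, l, j))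
        - (𝒮.rate N w t (.inl ρ) c' * (v t (𝒮.target (.inl ρ) c') - v t c')
          - 𝒮.rate N w t (.inl ρ) c * (v t (𝒮.target (.inl ρ) c) - v t c)))
          + ∑ lb : Fin n × Fin (m + 1), (rt t (.inr lb) (c, l, j)
          * (diffs (v t) (tgt (.inr lb) (c, l, j)) - diffs (v t) (c, l, j))
        - (𝒮.rate N w t (.inr lb) c' * (v t (𝒮.target (.inr lb) c') - v t c')
          - 𝒮.rate N w t (.inr lb) c * (v t (𝒮.target (.inr lb) c) - v t c)))) := by
      simp only [jumpOp, Fintype.sum_sum_type, Finset.sum_sub_distrib]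
      ring
    rw [hsplit]
    refine (abs_add_le _ _).trans ?_
    have h3 := (abs_sub _ (f t (c'.1, x') - f t (c.1, x))).trans
      (add_le_add ((abs_sub _ _).trans (add_le_add h2 h1)) hf1)
    have h4 := (abs_add_le _ _).trans (add_le_add hE1 hE2)
    have h5 : κ * (2 / N) + k * (κ * (2 / N) * (2 * β)) = (2 * κ + 4 * κ * k * β) / N := by ring
    have h6 : 0 ≤ (2 * κ + 4 * κ * k * β) / N := by positivity
    set η := (2 * κ + 4 * κ * k * β) / N
    have h7 : 0 ≤ (2 * A + (m + 1) * (2 * κ + 3 * C)) * η := by positivity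
    calc _ ≤ _ := add_le_add h3 h4
      _ = η + (2 * A + (m + 1) * (2 * κ + 3 * C)) * u := by rw [← h5]; ring
      _ ≤ _ := by linarith
  have h := norm_le_of_backward (target := tgt) (rate := rt)
    (c := 1 + 2 * A + (m + 1) * (2 * κ + 3 * C))
    (κ := (2 * κ + 4 * κ * k * β) / N) (u := fun t => diffs (v t))
    hrt0 hrtM hM0 (fun t _ p => (hv.hasDerivAt t _).sub (hv.hasDerivAt t _)) (by positivity) key
    (by positivity) ((pi_norm_le_iff_of_nonneg (by positivity)).2 fun p => by
      rw [diffs, hv.terminal, hv.terminal, Real.norm_eq_abs]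
      refine (hfg.g_lip p.1.1 _ (hw.mem (move p.1 p.2.1 p.2.2)) _ (hw.mem p.1)).trans ?_
      calc κ * ‖emp N w (move p.1 p.2.1 p.2.2) - emp N w p.1‖ ≤ κ * (2 / N) := by
            gcongr; exact norm_emp_move_sub_le w _ _ _
        _ = (2 * κ + 0) / N := by ring
        _ ≤ _ := by gcongr; positivity) ht
  refine h.trans ?_
  rw [lipBound, mul_div_assoc]
  have := ht.1
  gcongr
  linarith

end IsParticleCost

end Particles

/-! ### Multinomial weights -/

section Weights

variable {m n : ℕ} {Δ R : Type*}

/-- The probability of the states `σ` of `n` independent particles with common law `y`. -/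
def wt (y : Vec m) (σ : Fin n → Fin (m + 1)) : ℝ := ∏ l, coord y (σ l)

theorem wt_nonneg {y : Vec m} (hy : y ∈ simplex m) (σ : Fin n → Fin (m + 1)) : 0 ≤ wt y σ :=
  Finset.prod_nonneg fun _ _ => coord_nonneg hy _

theorem sum_wt (y : Vec m) : ∑ σ : Fin n → Fin (m + 1), wt y σ = 1 := by
  have h := Finset.prod_univ_sum (fun _ : Fin n => (Finset.univ : Finset (Fin (m + 1))))
    (fun _ k => coord y k)
  simp only [sum_coord, Finset.prod_const_one, Fintype.piFinset_univ] at h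
  exact h.symm

theorem abs_sum_wt_mul_le {y : Vec m} (hy : y ∈ simplex m) {a b : (Fin n → Fin (m + 1)) → ℝ}
    (h : ∀ σ, |a σ| ≤ b σ) : |∑ σ, wt y σ * a σ| ≤ ∑ σ, wt y σ * b σ := by
  refine (Finset.abs_sum_le_sum_abs _ _).trans (Finset.sum_le_sum fun σ _ => ?_)
  rw [abs_mul, abs_of_nonneg (wt_nonneg hy σ)]
  exact mul_le_mul_of_nonneg_left (h σ) (wt_nonneg hy σ)

/-- The variance of the sum of `n` independent particles. -/
theorem sum_wt_mul_norm_sq_le {y : Vec m} (hy : y ∈ simplex m) :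
    ∀ n : ℕ, ∑ σ : Fin n → Fin (m + 1), wt y σ * ‖∑ l, (vertex (σ l) - y)‖ ^ 2 ≤ 4 * n := by
  intro n
  induction n with
  | zero => simp
  | succ n ih =>
    rw [← (Fin.consEquiv fun _ : Fin (n + 1) => Fin (m + 1)).sum_comp, Fintype.sum_prod_type]
    have hterm : ∀ (a : Fin (m + 1)) (σ : Fin n → Fin (m + 1)),
        wt y ((Fin.consEquiv fun _ : Fin (n + 1) => Fin (m + 1)) (a, σ))
          * ‖∑ l, (vertex ((Fin.consEquiv fun _ : Fin (n + 1) => Fin (m + 1)) (a, σ) l) - y)‖ ^ 2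
        = wt y σ * (coord y a * ‖(vertex a : Vec m) - y‖ ^ 2)
          + 2 * wt y σ * inner ℝ (coord y a • ((vertex a : Vec m) - y)) (∑ l, (vertex (σ l) - y))
          + coord y a * (wt y σ * ‖∑ l, ((vertex (σ l) : Vec m) - y)‖ ^ 2) := by
      intro a σ
      simp only [wt, Fin.consEquiv, Equiv.coe_fn_mk, Fin.prod_univ_succ, Fin.sum_univ_succ,
        Fin.cons_zero, Fin.cons_succ, norm_add_sq_real, inner_smul_left]
      simp only [conj_trivial]
      ring
    simp only [hterm, Finset.sum_add_distrib]
    have hcross : ∑ a : Fin (m + 1), ∑ σ : Fin n → Fin (m + 1), 2 * wt y σ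
        * inner ℝ (coord y a • ((vertex a : Vec m) - y)) (∑ l, (vertex (σ l) - y)) = 0 := by
      rw [Finset.sum_comm]
      refine Finset.sum_eq_zero fun σ _ => ?_
      rw [← Finset.mul_sum, ← sum_inner]
      have : ∑ a, coord y a • ((vertex a : Vec m) - y) = 0 := by
        simp only [smul_sub, Finset.sum_sub_distrib, sum_coord_smul_vertex, ← Finset.sum_smul,
          sum_coord, one_smul, sub_self]
      rw [this, inner_zero_left, mul_zero]
    have hdiag : ∑ a : Fin (m + 1), ∑ σ : Fin n → Fin (m + 1),
        wt y σ * (coord y a * ‖(vertex a : Vec m) - y‖ ^ 2) ≤ 4 := by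
      simp only [← Finset.sum_mul, sum_wt, one_mul]
      calc ∑ a, coord y a * ‖(vertex a : Vec m) - y‖ ^ 2 ≤ ∑ a, coord y a * 4 := by
            refine Finset.sum_le_sum fun a _ => ?_
            refine mul_le_mul_of_nonneg_left ?_ (coord_nonneg hy a)
            have h1 := norm_sub_le (vertex a : Vec m) y
            have h2 := norm_vertex_le (m := m) a
            have h3 := norm_le_one_of_mem_simplex hy
            nlinarith [norm_nonneg ((vertex a : Vec m) - y)]
        _ = 4 := by rw [← Finset.sum_mul, sum_coord, one_mul]
    have hrest : ∑ a : Fin (m + 1), ∑ σ : Fin n → Fin (m + 1),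
        coord y a * (wt y σ * ‖∑ l, ((vertex (σ l) : Vec m) - y)‖ ^ 2) ≤ 4 * n := by
      simp only [← Finset.mul_sum]
      rw [← Finset.sum_mul, sum_coord, one_mul]
      exact ih
    rw [hcross]
    push_cast
    linarith

/-- The law of large numbers, with the rate `1 / √N`. -/
theorem sum_wt_mul_norm_emp_sub_le {N : ℕ} {w : Δ → Vec m} (hw : IsWeight N n w) (d : Δ)
    {y : Vec m} (hy : y ∈ simplex m) :
    ∑ σ : Fin n → Fin (m + 1), wt y σ * ‖emp N w (d, σ) - y‖ ≤ 5 / √(N : ℝ) := by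
  have hN : (1 : ℝ) ≤ N := by exact_mod_cast hw.pos
  have hn : (n : ℝ) ≤ N := by exact_mod_cast hw.le
  set s := √(N : ℝ) with hs
  have hs2 : s * s = N := Real.mul_self_sqrt (by positivity)
  have hs1 : 1 ≤ s := Real.one_le_sqrt.2 hN
  have hs0 : 0 < s := by linarith
  have hpt : ∀ σ : Fin n → Fin (m + 1), wt y σ * ‖emp N w (d, σ) - y‖
      ≤ wt y σ * ((2 + s / 2) / N) + wt y σ * ‖∑ l, ((vertex (σ l) : Vec m) - y)‖ ^ 2
        * (1 / (2 * s * N)) := by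
    intro σ
    have h1 : emp N w (d, σ) - y
        = (1 / N : ℝ) • ((w d - ((N : ℝ) - n) • y) + ∑ l, (vertex (σ l) - y)) := by
      have hN0 : (N : ℝ) ≠ 0 := by positivity
      have : y = (1 / N : ℝ) • ((N : ℝ) • y) := by rw [smul_smul, one_div_mul_cancel hN0, one_smul]
      conv_lhs => rw [this]
      rw [emp, ← smul_sub]
      congr 1
      simp only [Finset.sum_sub_distrib, Finset.sum_const, Finset.card_univ, Fintype.card_fin,
        sub_smul, ← Nat.cast_smul_eq_nsmul ℝ]
      abel
    set S := ∑ l, ((vertex (σ l) : Vec m) - y)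
    have h2 : ‖emp N w (d, σ) - y‖ ≤ (1 / N : ℝ) * (2 + ‖S‖) := by
      rw [h1, norm_smul, Real.norm_of_nonneg (by positivity)]
      gcongr
      refine (norm_add_le _ _).trans ?_
      gcongr
      exact hw.norm_le d y hy
    have h3 : ‖S‖ ≤ s / 2 + ‖S‖ ^ 2 * (1 / (2 * s)) := by
      rw [← sub_nonneg]
      have : s / 2 + ‖S‖ ^ 2 * (1 / (2 * s)) - ‖S‖ = (s - ‖S‖) ^ 2 / (2 * s) := by
        field_simp
        ring
      rw [this]
      positivity
    calc wt y σ * ‖emp N w (d, σ) - y‖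
        ≤ wt y σ * ((1 / N : ℝ) * (2 + (s / 2 + ‖S‖ ^ 2 * (1 / (2 * s))))) := by
          refine mul_le_mul_of_nonneg_left (h2.trans ?_) (wt_nonneg hy σ)
          gcongr
      _ = _ := by
          field_simp
          ring
  refine (Finset.sum_le_sum fun σ _ => hpt σ).trans ?_
  rw [Finset.sum_add_distrib, ← Finset.sum_mul, ← Finset.sum_mul, sum_wt, one_mul]
  have hvar := sum_wt_mul_norm_sq_le hy n
  have h4 : (∑ σ : Fin n → Fin (m + 1), wt y σ * ‖∑ l, ((vertex (σ l) : Vec m) - y)‖ ^ 2)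
      * (1 / (2 * s * N)) ≤ 4 * N * (1 / (2 * s * N)) := by
    gcongr
    linarith
  refine (add_le_add le_rfl h4).trans ?_
  rw [← hs2]
  have h5 : (2 + s / 2) / (s * s) + 4 * (s * s) * (1 / (2 * s * (s * s))) = (2 / s + 5 / 2) / s := by
    field_simp
    ring
  rw [h5]
  gcongr
  have : 2 / s ≤ 2 := div_le_self (by norm_num) hs1
  linarith

/-- The Bernstein operator: the expected value of `v (d, σ)`, at the point `(d, y)`, for independent
particles `σ` with common law `y`. It turns functions of the particles into polynomials in `y`. -/
def bernstein (v : Config Δ m n → ℝ) (z : Δ × Vec m) : ℝ := ∑ σ, wt z.2 σ * v (z.1, σ)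

theorem contDiff_coord (i : Fin (m + 1)) : ContDiff ℝ 1 fun y : Vec m => coord y i := by
  induction i using Fin.lastCases with
  | last => simp only [coord_last]; fun_prop
  | cast k => simp only [coord_castSucc]; fun_prop

theorem contDiff_wt (σ : Fin n → Fin (m + 1)) : ContDiff ℝ 1 fun y : Vec m => wt y σ :=
  contDiff_prod fun l _ => contDiff_coord (σ l)

theorem contDiff_bernstein (v : Config Δ m n → ℝ) (d : Δ) :
    ContDiff ℝ 1 fun y => bernstein v (d, y) :=
  ContDiff.sum fun σ _ => (contDiff_wt σ).mul (contDiff_const (c := v (d, σ)))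

theorem bernstein_mem_timeSpaceC1 {v : ℝ → Config Δ m n → ℝ} (hv : ∀ c, ContDiff ℝ 1 fun t => v t c) :
    (fun t => bernstein (v t)) ∈ timeSpaceC1 Δ m := fun d =>
  ContDiff.sum fun σ _ => ((contDiff_wt σ).comp contDiff_snd).mul ((hv (d, σ)).comp contDiff_fst)

/-- Reindexing: a particle in the state `j` becomes a particle in the state `k`. -/
theorem sum_ite_eq_sum_ite_move (G : (Fin n → Fin (m + 1)) → ℝ) (P : (Fin n → Fin (m + 1)) → ℝ)
    (l : Fin n) (hP : ∀ σ a, P (Function.update σ l a) = P σ) (j k : Fin (m + 1)) :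
    ∑ σ, (if σ l = j then P σ * G σ else 0)
      = ∑ σ, if σ l = k then P σ * G (Function.update σ l j) else 0 := by
  rw [← Finset.sum_filter, ← Finset.sum_filter]
  refine Finset.sum_nbij' (fun σ => Function.update σ l k) (fun σ => Function.update σ l j)
    (fun σ _ => by simp) (fun σ _ => by simp) (fun σ hσ => ?_) (fun σ hσ => ?_) (fun σ hσ => ?_)
  · have : σ l = j := by simpa using hσ
    rw [Function.update_idem, ← this, Function.update_eq_self]
  · have : σ l = k := by simpa using hσ
    rw [Function.update_idem, ← this, Function.update_eq_self]
  · have : σ l = j := by simpa using hσ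
    rw [hP, Function.update_idem, ← this, Function.update_eq_self]

/-- The derivative of a Bernstein polynomial is the expectation of the finite differences, taken
with one particle in the state `k` moved to `j`. Thus the transport term of the mean field generator
is exactly the expectation of the jumps of the particles. -/
theorem coord_mul_fderiv_bernstein (v : Config Δ m n → ℝ) (d : Δ) (y : Vec m) (k j : Fin (m + 1)) :
    coord y k * fderiv ℝ (fun y => bernstein v (d, y)) y (jump k j)
      = ∑ σ, wt y σ * ∑ l, if σ l = k then v (move (d, σ) l j) - v (d, σ) else 0 := by
  have hline : fderiv ℝ (fun y => bernstein v (d, y)) y (jump k j)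
      = deriv (fun s : ℝ => bernstein v (d, y + s • jump k j)) 0 :=
    (((contDiff_bernstein v d).differentiable one_ne_zero) y).lineDeriv_eq_fderiv.symm
  have hcoord : ∀ a : Fin (m + 1), HasDerivAt (fun s : ℝ => coord (y + s • jump k j) a)
      ((if a = j then 1 else 0) - (if a = k then 1 else 0)) 0 := by
    intro a
    simp only [coord_add_smul_vertex_sub]
    simpa using ((hasDerivAt_id (0 : ℝ)).mul_const
      ((if a = j then (1 : ℝ) else 0) - (if a = k then 1 else 0))).const_add (coord y a)
  set P : Fin n → (Fin n → Fin (m + 1)) → ℝ :=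
    fun l σ => ∏ l' ∈ Finset.univ.erase l, coord y (σ l') with hP
  have hd : HasDerivAt (fun s : ℝ => bernstein v (d, y + s • jump k j))
      (∑ σ, (∑ l, P l σ * ((if σ l = j then 1 else 0) - (if σ l = k then 1 else 0))) * v (d, σ)) 0 := by
    refine HasDerivAt.fun_sum fun σ _ => HasDerivAt.mul_const (d := v (d, σ)) ?_
    have := HasDerivAt.fun_finsetProd (u := Finset.univ) (fun l _ => hcoord (σ l))
    simpa [hP, wt] using this
  have hPl : ∀ l σ, wt y σ = coord y (σ l) * P l σ := fun l σ =>
    (Finset.mul_prod_erase _ _ (Finset.mem_univ l)).symm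
  have hPu : ∀ l σ a, P l (Function.update σ l a) = P l σ := fun l σ a =>
    Finset.prod_congr rfl fun l' hl' => by rw [Function.update_of_ne (Finset.ne_of_mem_erase hl')]
  rw [hline, hd.deriv]
  simp only [Finset.sum_mul, Finset.mul_sum]
  rw [Finset.sum_comm]
  conv_rhs => rw [Finset.sum_comm]
  refine Finset.sum_congr rfl fun l _ => ?_
  have h := sum_ite_eq_sum_ite_move (fun σ => v (d, σ)) (P l) l (hPu l) j k
  calc ∑ σ, coord y k * (P l σ * ((if σ l = j then 1 else 0) - (if σ l = k then 1 else 0)) * v (d, σ))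
      = coord y k * (∑ σ, (if σ l = j then P l σ * v (d, σ) else 0)
          - ∑ σ, (if σ l = k then P l σ * v (d, σ) else 0)) := by
        rw [← Finset.sum_sub_distrib, Finset.mul_sum]
        refine Finset.sum_congr rfl fun σ _ => ?_
        split_ifs <;> ring
    _ = ∑ σ, wt y σ * if σ l = k then v (move (d, σ) l j) - v (d, σ) else 0 := by
        rw [h, ← Finset.sum_sub_distrib, Finset.mul_sum]
        refine Finset.sum_congr rfl fun σ _ => ?_
        rw [hPl l σ]
        split_ifs with hσ
        · rw [hσ]; simp only [move]; ring
        · ring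

end Weights

/-! ### The mean field generator and Bernstein transforms of particle costs -/

section Generator

variable {m n : ℕ} {Δ R : Type*} [Fintype R]

/-- Generator of the mean field limit of a particle system: the environment jumps, and the
distribution follows the flow of the jump rates of the particles. -/
def ParticleRates.gen (𝒮 : ParticleRates m Δ R) (F : ℝ → Δ × Vec m → ℝ) (t : ℝ) (z : Δ × Vec m) : ℝ :=
  deriv (fun s => F s z) t
  + ∑ ρ, 𝒮.r t ρ z.1 z.2 * (F t (𝒮.τ ρ z.1, z.2) - F t z)
  + ∑ i, ∑ j, coord z.2 i * 𝒮.q t i j z.1 z.2 * fderiv ℝ (fun y => F t (z.1, y)) z.2 (jump i j)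

/-- On Bernstein transforms, the mean field generator averages the generator of the particle system,
except that the rates are evaluated at the common law `y` of the particles instead of their
empirical distribution. -/
theorem ParticleRates.gen_bernstein (𝒮 : ParticleRates m Δ R) {v : ℝ → Config Δ m n → ℝ}
    (hv : ∀ c, Differentiable ℝ fun t => v t c) (t : ℝ) (d : Δ) (y : Vec m) :
    𝒮.gen (fun t => bernstein (v t)) t (d, y)
      = ∑ σ, wt y σ * (deriv (fun s => v s (d, σ)) t
          + ∑ ρ, 𝒮.r t ρ d y * (v t (𝒮.τ ρ d, σ) - v t (d, σ))
          + ∑ l, ∑ j, 𝒮.q t (σ l) j d y * (v t (move (d, σ) l j) - v t (d, σ))) := by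
  have h1 : deriv (fun s => bernstein (v s) (d, y)) t = ∑ σ, wt y σ * deriv (fun s => v s (d, σ)) t :=
    (HasDerivAt.fun_sum fun σ _ => ((hv (d, σ) t).hasDerivAt.const_mul (wt y σ))).deriv
  have h2 : ∑ ρ, 𝒮.r t ρ d y * (bernstein (v t) (𝒮.τ ρ d, y) - bernstein (v t) (d, y))
      = ∑ σ, wt y σ * ∑ ρ, 𝒮.r t ρ d y * (v t (𝒮.τ ρ d, σ) - v t (d, σ)) := by
    simp only [bernstein, ← Finset.sum_sub_distrib, Finset.mul_sum]
    rw [Finset.sum_comm]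
    exact Finset.sum_congr rfl fun σ _ => Finset.sum_congr rfl fun ρ _ => by ring
  have h3 : ∑ i, ∑ j, coord y i * 𝒮.q t i j d y
        * fderiv ℝ (fun y => bernstein (v t) (d, y)) y (jump i j)
      = ∑ σ, wt y σ * ∑ l, ∑ j, 𝒮.q t (σ l) j d y * (v t (move (d, σ) l j) - v t (d, σ)) := by
    have : ∀ i j, coord y i * 𝒮.q t i j d y
        * fderiv ℝ (fun y => bernstein (v t) (d, y)) y (jump i j)
        = ∑ σ, wt y σ * ∑ l, if σ l = i then
            𝒮.q t (σ l) j d y * (v t (move (d, σ) l j) - v t (d, σ)) else 0 := by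
      intro i j
      rw [mul_right_comm, coord_mul_fderiv_bernstein, Finset.sum_mul]
      refine Finset.sum_congr rfl fun σ _ => ?_
      rw [mul_assoc, Finset.sum_mul]
      congr 1
      refine Finset.sum_congr rfl fun l _ => ?_
      split_ifs with h
      · rw [h]; ring
      · ring
    simp only [this]
    have hswap : ∀ i, ∑ j, ∑ σ, wt y σ * ∑ l, (if σ l = i then
        𝒮.q t (σ l) j d y * (v t (move (d, σ) l j) - v t (d, σ)) else 0)
        = ∑ σ, wt y σ * ∑ l, if σ l = i then
          ∑ j, 𝒮.q t (σ l) j d y * (v t (move (d, σ) l j) - v t (d, σ)) else 0 := by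
      intro i
      rw [Finset.sum_comm]
      refine Finset.sum_congr rfl fun σ _ => ?_
      rw [← Finset.mul_sum, Finset.sum_comm]
      congr 1
      refine Finset.sum_congr rfl fun l _ => ?_
      split_ifs <;> simp
    simp only [hswap]
    rw [Finset.sum_comm]
    refine Finset.sum_congr rfl fun σ _ => ?_
    rw [← Finset.mul_sum, Finset.sum_comm]
    congr 1
    refine Finset.sum_congr rfl fun l _ => ?_
    simp
  rw [ParticleRates.gen]
  simp only
  rw [h1, h2, h3, ← Finset.sum_add_distrib, ← Finset.sum_add_distrib]
  exact Finset.sum_congr rfl fun σ _ => by ring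

variable [Fintype Δ]

/-- `genBound / √N` bounds the error with which the Bernstein transform of a particle cost solves
the mean field equation. -/
def genBound (m k : ℕ) (T κ C A B : ℝ) : ℝ :=
  A * lipBound m k T κ C A B
    + 5 * (κ + k * κ * (2 * costBound T A B) + (m + 1) * κ * lipBound m k T κ C A B)

namespace IsParticleCost

variable {𝒮 : ParticleRates m Δ R} {N : ℕ} {w : Δ → Vec m} {T A κ C B : ℝ}
  {f : ℝ → Δ × Vec m → ℝ} {g : Δ × Vec m → ℝ} {v : ℝ → Config Δ m n → ℝ}

theorem abs_gen_bernstein_add_le (hv : IsParticleCost 𝒮 N w T A f g v) (h𝒮 : 𝒮.Regular T κ C)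
    (hw : IsWeight N n w) (hfg : CostRegular T κ B f g) (hA : 0 ≤ A) (hB : 0 ≤ B) (hκ : 0 ≤ κ)
    (hC : 0 ≤ C) {t : ℝ} (ht : t ∈ Icc 0 T) (d : Δ) {y : Vec m} (hy : y ∈ simplex m) :
    |𝒮.gen (fun t => bernstein (v t)) t (d, y) + f t (d, y)|
      ≤ genBound m (Fintype.card R) T κ C A B / √(N : ℝ) := by
  have hN : (1 : ℝ) ≤ N := by exact_mod_cast hw.pos
  have hN0 : (0 : ℝ) < N := by linarith
  set k := Fintype.card R with hk
  set β := costBound T A B with hβ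
  set Λ := lipBound m k T κ C A B with hΛ
  have hβ0 : 0 ≤ β := by rw [hβ, costBound]; positivity
  have hΛ0 : 0 ≤ Λ := by rw [hΛ, lipBound, ← hβ]; positivity
  have hD : ‖diffs (v t)‖ ≤ Λ / N := hv.norm_diffs_le h𝒮 hw hfg hA hB hκ hC ht
  have hvβ : ∀ c, |v t c| ≤ β := fun c =>
    (norm_le_pi_norm (v t) c).trans (hv.norm_le h𝒮 hw hfg hA hB ht)
  set K := κ + k * κ * (2 * β) + (m + 1) * κ * Λ with hK
  have hK0 : 0 ≤ K := by positivity
  have hsum : 𝒮.gen (fun t => bernstein (v t)) t (d, y) + f t (d, y)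
      = ∑ σ, wt y σ * ((deriv (fun s => v s (d, σ)) t
          + ∑ ρ, 𝒮.r t ρ d y * (v t (𝒮.τ ρ d, σ) - v t (d, σ))
          + ∑ l, ∑ j, 𝒮.q t (σ l) j d y * (v t (move (d, σ) l j) - v t (d, σ))) + f t (d, y)) := by
    rw [𝒮.gen_bernstein (fun c => (hv.contDiff c).differentiable one_ne_zero)]
    simp only [mul_add, Finset.sum_add_distrib]
    rw [← Finset.sum_mul _ _ (f t (d, y)), sum_wt, one_mul]
  rw [hsum]
  have hpt : ∀ σ : Fin n → Fin (m + 1), |(deriv (fun s => v s (d, σ)) t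
          + ∑ ρ, 𝒮.r t ρ d y * (v t (𝒮.τ ρ d, σ) - v t (d, σ))
          + ∑ l, ∑ j, 𝒮.q t (σ l) j d y * (v t (move (d, σ) l j) - v t (d, σ))) + f t (d, y)|
      ≤ A * (Λ / N) + K * ‖emp N w (d, σ) - y‖ := by
    intro σ
    have hx : emp N w (d, σ) ∈ simplex m := hw.mem (d, σ)
    set x := emp N w (d, σ) with hxdef
    set δ := ‖x - y‖ with hδ
    have hδ' : ‖y - x‖ = δ := norm_sub_rev _ _
    have e1 : |∑ ρ, (𝒮.r t ρ d y - 𝒮.r t ρ d x) * (v t (𝒮.τ ρ d, σ) - v t (d, σ))|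
        ≤ k * (κ * δ * (2 * β)) := by
      refine (Finset.abs_sum_le_sum_abs _ _).trans ?_
      refine (Finset.sum_le_card_nsmul _ _ (κ * δ * (2 * β)) fun ρ _ => ?_).trans_eq (by simp [hk])
      rw [abs_mul]
      gcongr
      · refine (h𝒮.r_lip t ht t ht ρ d y hy x hx).trans_eq ?_
        rw [sub_self, abs_zero, zero_add, hδ']
      · have h1 := hvβ (𝒮.τ ρ d, σ)
        have h2 := hvβ (d, σ)
        have h3 := abs_sub (v t (𝒮.τ ρ d, σ)) (v t (d, σ))
        linarith
    have e2 : |∑ l, ∑ j, (𝒮.q t (σ l) j d y - 𝒮.q t (σ l) j d x)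
        * (v t (move (d, σ) l j) - v t (d, σ))| ≤ n * ((m + 1) * (κ * δ * (Λ / N))) := by
      refine (Finset.abs_sum_le_sum_abs _ _).trans ?_
      refine (Finset.sum_le_card_nsmul _ _ ((m + 1) * (κ * δ * (Λ / N))) fun l _ => ?_).trans_eq
        (by simp)
      refine (Finset.abs_sum_le_sum_abs _ _).trans ?_
      refine (Finset.sum_le_card_nsmul _ _ (κ * δ * (Λ / N)) fun j _ => ?_).trans_eq (by simp)
      rw [abs_mul]
      gcongr
      · refine (h𝒮.q_lip t ht t ht (σ l) j d y hy x hx).trans_eq ?_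
        rw [sub_self, abs_zero, zero_add, hδ']
      · exact (abs_diff_le (v t) (d, σ) l j).trans hD
    have e3 : |f t (d, y) - f t (d, x)| ≤ κ * δ := by
      refine (hfg.f_lip t ht t ht d y hy x hx).trans_eq ?_
      rw [sub_self, abs_zero, zero_add, hδ']
    have e4 := hv.equation t ht (d, σ)
    have hsplit : (deriv (fun s => v s (d, σ)) t
          + ∑ ρ, 𝒮.r t ρ d y * (v t (𝒮.τ ρ d, σ) - v t (d, σ))
          + ∑ l, ∑ j, 𝒮.q t (σ l) j d y * (v t (move (d, σ) l j) - v t (d, σ))) + f t (d, y)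
        = (deriv (fun s => v s (d, σ)) t + jumpOp 𝒮.target (𝒮.rate N w t) (v t) (d, σ)
            + f t (d, x))
          + ∑ ρ, (𝒮.r t ρ d y - 𝒮.r t ρ d x) * (v t (𝒮.τ ρ d, σ) - v t (d, σ))
          + ∑ l, ∑ j, (𝒮.q t (σ l) j d y - 𝒮.q t (σ l) j d x)
            * (v t (move (d, σ) l j) - v t (d, σ))
          + (f t (d, y) - f t (d, x)) := by
      simp only [jumpOp, Fintype.sum_sum_type, Fintype.sum_prod_type, ParticleRates.target,
        ParticleRates.rate, ← hxdef, sub_mul, Finset.sum_sub_distrib]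
      ring
    rw [hsplit]
    have h5 := (abs_add_le _ _).trans (add_le_add
      ((abs_add_le _ _).trans (add_le_add ((abs_add_le _ _).trans (add_le_add e4 e1)) e2)) e3)
    refine h5.trans ?_
    have h6 : (n : ℝ) * (Λ / N) ≤ Λ := by
      rw [mul_div_assoc', div_le_iff₀ hN0, mul_comm]
      gcongr
      exact_mod_cast hw.le
    have hδ0 : 0 ≤ δ := norm_nonneg _
    calc _ ≤ A * (Λ / N) + k * (κ * δ * (2 * β)) + (m + 1) * κ * δ * Λ + κ * δ := by
          have h7 : (n : ℝ) * ((m + 1) * (κ * δ * (Λ / N))) ≤ (m + 1) * κ * δ * Λ := by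
            calc (n : ℝ) * ((m + 1) * (κ * δ * (Λ / N)))
                = (m + 1) * κ * δ * (n * (Λ / N)) := by ring
              _ ≤ _ := by gcongr
          gcongr
      _ = _ := by rw [hK]; ring
  refine (abs_sum_wt_mul_le hy hpt).trans ?_
  have hlln := sum_wt_mul_norm_emp_sub_le hw d hy
  have : ∑ σ : Fin n → Fin (m + 1), wt y σ * (A * (Λ / N) + K * ‖emp N w (d, σ) - y‖)
      = A * (Λ / N) + K * ∑ σ : Fin n → Fin (m + 1), wt y σ * ‖emp N w (d, σ) - y‖ := by
    simp only [mul_add, Finset.sum_add_distrib, Finset.mul_sum]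
    rw [← Finset.sum_mul, sum_wt, one_mul]
    congr 1
    exact Finset.sum_congr rfl fun σ _ => by ring
  rw [this]
  have hs : √(N : ℝ) ≤ N := Real.sqrt_le_iff.2 ⟨hN0.le, by nlinarith⟩
  have hs0 : 0 < √(N : ℝ) := Real.sqrt_pos.2 hN0
  calc A * (Λ / N) + K * ∑ σ : Fin n → Fin (m + 1), wt y σ * ‖emp N w (d, σ) - y‖
      ≤ A * (Λ / √(N : ℝ)) + K * (5 / √(N : ℝ)) := by gcongr
    _ = genBound m k T κ C A B / √(N : ℝ) := by
      rw [genBound, ← hβ, ← hΛ, hK]; ring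

theorem abs_bernstein_terminal_sub_le (hv : IsParticleCost 𝒮 N w T A f g v)
    (hw : IsWeight N n w) (hfg : CostRegular T κ B f g) (hκ : 0 ≤ κ) (d : Δ)
    {y : Vec m} (hy : y ∈ simplex m) :
    |bernstein (v T) (d, y) - g (d, y)| ≤ 5 * κ / √(N : ℝ) := by
  have : bernstein (v T) (d, y) - g (d, y)
      = ∑ σ : Fin n → Fin (m + 1), wt y σ * (g (d, emp N w (d, σ)) - g (d, y)) := by
    simp only [bernstein, hv.terminal, mul_sub, Finset.sum_sub_distrib]
    rw [← Finset.sum_mul, sum_wt, one_mul]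
  rw [this]
  refine (abs_sum_wt_mul_le hy fun σ => hfg.g_lip d _ (hw.mem (d, σ)) y hy).trans ?_
  calc ∑ σ : Fin n → Fin (m + 1), wt y σ * (κ * ‖emp N w (d, σ) - y‖)
      = κ * ∑ σ : Fin n → Fin (m + 1), wt y σ * ‖emp N w (d, σ) - y‖ := by
        rw [Finset.mul_sum]; exact Finset.sum_congr rfl fun σ _ => by ring
    _ ≤ κ * (5 / √(N : ℝ)) := by gcongr; exact sum_wt_mul_norm_emp_sub_le hw d hy
    _ = _ := by ring

end IsParticleCost

end Generator

/-! ### Symmetric functions of the particles -/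

section Symmetric

variable {m n : ℕ} {Δ : Type*}

/-- The number of particles in the state `a`. -/
def count (σ : Fin n → Fin (m + 1)) (a : Fin (m + 1)) : ℕ := ∑ l, if σ l = a then 1 else 0

theorem sum_count (σ : Fin n → Fin (m + 1)) : ∑ a, count σ a = n := by
  simp only [count]
  rw [Finset.sum_comm]
  simp

theorem sum_vertex_eq (σ : Fin n → Fin (m + 1)) :
    ∑ l, (vertex (σ l) : Vec m) = ∑ a, (count σ a : ℝ) • vertex a := by
  simp only [count, Nat.cast_sum, Finset.sum_smul]
  rw [Finset.sum_comm]
  refine Finset.sum_congr rfl fun l _ => ?_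
  simp

theorem count_update (σ : Fin n → Fin (m + 1)) (l : Fin n) (j a : Fin (m + 1)) :
    count (Function.update σ l j) a + (if σ l = a then 1 else 0)
      = count σ a + if j = a then 1 else 0 := by
  simp only [count]
  rw [← Finset.add_sum_erase _ _ (Finset.mem_univ l),
    ← Finset.add_sum_erase (a := l) _ (fun k => if σ k = a then 1 else 0) (Finset.mem_univ l)]
  have : ∑ k ∈ Finset.univ.erase l, (if Function.update σ l j k = a then 1 else 0)
      = ∑ k ∈ Finset.univ.erase l, if σ k = a then 1 else 0 :=
    Finset.sum_congr rfl fun k hk => by rw [Function.update_of_ne (Finset.ne_of_mem_erase hk)]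
  rw [this, Function.update_self]
  omega

theorem coord_emp_sub (N : ℕ) (w : Δ → Vec m) (d : Δ) (σ σ' : Fin n → Fin (m + 1))
    (a : Fin (m + 1)) :
    coord (emp N w (d, σ)) a - coord (emp N w (d, σ')) a
      = 1 / N * ((count σ a : ℝ) - count σ' a) := by
  have hv : ∀ (σ : Fin n → Fin (m + 1)) (k : Fin m),
      (∑ l, (vertex (σ l) : Vec m)) k = count σ k.castSucc := by
    intro σ k
    rw [sum_vertex_eq, Fin.sum_univ_castSucc]
    simp [Pi.single_apply]
  have hk : ∀ k : Fin m, emp N w (d, σ) k - emp N w (d, σ') k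
      = 1 / N * ((count σ k.castSucc : ℝ) - count σ' k.castSucc) := by
    intro k
    simp only [emp, PiLp.smul_apply, PiLp.add_apply, hv, smul_eq_mul]
    ring
  induction a using Fin.lastCases with
  | cast k => simpa only [coord_castSucc] using hk k
  | last =>
    simp only [coord_last]
    have h1 := congrArg (Nat.cast (R := ℝ)) (sum_count σ)
    have h2 := congrArg (Nat.cast (R := ℝ)) (sum_count σ')
    rw [Fin.sum_univ_castSucc] at h1 h2
    push_cast at h1 h2
    have h3 : ∑ k, emp N w (d, σ) k - ∑ k, emp N w (d, σ') k
        = 1 / N * (∑ k : Fin m, (count σ k.castSucc : ℝ) - ∑ k : Fin m, (count σ' k.castSucc : ℝ)) := by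
      rw [← Finset.sum_sub_distrib, ← Finset.sum_sub_distrib, Finset.mul_sum]
      exact Finset.sum_congr rfl fun k _ => hk k
    have h4 : (count σ (Fin.last m) : ℝ) - count σ' (Fin.last m)
        = -(∑ k : Fin m, (count σ k.castSucc : ℝ) - ∑ k : Fin m, (count σ' k.castSucc : ℝ)) := by
      linarith
    rw [h4]
    linarith

variable [Fintype Δ]

/-- A function that only depends on the numbers of particles in each state is Lipschitz in these
numbers: particles in overcrowded states are moved, one at a time. -/
theorem abs_sub_le_of_symmetric {v : Config Δ m n → ℝ} (d : Δ)
    (hv : ∀ σ σ', count σ = count σ' → v (d, σ) = v (d, σ')) (σ' : Fin n → Fin (m + 1)) :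
    ∀ (D : ℕ) (σ : Fin n → Fin (m + 1)), ∑ a, (count σ a - count σ' a) ≤ D →
      |v (d, σ) - v (d, σ')| ≤ D * ‖diffs v‖ := by
  intro D
  induction D with
  | zero =>
    intro σ hσ
    have h0 : ∀ a, count σ a ≤ count σ' a := fun a => by
      have := Finset.single_le_sum (f := fun a => count σ a - count σ' a)
        (fun _ _ => Nat.zero_le _) (Finset.mem_univ a)
      omega
    have h1 : count σ = count σ' := funext fun a =>
      (Finset.sum_eq_sum_iff_of_le fun a _ => h0 a).1 (by rw [sum_count, sum_count]) a
        (Finset.mem_univ a)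
    rw [hv σ σ' h1]
    simp
  | succ D ih =>
    intro σ hσ
    by_cases hle : ∀ a, count σ a ≤ count σ' a
    · refine (ih σ ?_).trans ?_
      · rw [Finset.sum_eq_zero fun a _ => Nat.sub_eq_zero_of_le (hle a)]
        exact Nat.zero_le _
      · gcongr
        exact Nat.le_succ D
    · push Not at hle
      obtain ⟨k, hk⟩ := hle
      obtain ⟨j, hj⟩ : ∃ j, count σ j < count σ' j := by
        by_contra! h
        have := Finset.sum_lt_sum (fun a _ => h a) ⟨k, Finset.mem_univ k, hk⟩
        rw [sum_count, sum_count] at this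
        exact lt_irrefl _ this
      obtain ⟨l, hl⟩ : ∃ l, σ l = k := by
        by_contra! h
        have : count σ k = 0 := Finset.sum_eq_zero fun l _ => if_neg (h l)
        omega
      have hkj : k ≠ j := by rintro rfl; omega
      have hlt : ∑ a, (count (Function.update σ l j) a - count σ' a)
          < ∑ a, (count σ a - count σ' a) := by
        refine Finset.sum_lt_sum (fun a _ => ?_) ⟨k, Finset.mem_univ k, ?_⟩
        · have h1 := count_update σ l j a
          by_cases ha : j = a
          · subst ha
            rw [hl, if_neg hkj, if_pos rfl] at h1
            omega
          · rw [if_neg ha] at h1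
            omega
        · have h1 := count_update σ l j k
          rw [if_pos hl, if_neg hkj.symm] at h1
          omega
      have h1 := ih (Function.update σ l j) (by omega)
      have h2 := abs_diff_le v (d, σ) l j
      simp only [move] at h2
      have h3 := abs_sub_le (v (d, σ)) (v (d, Function.update σ l j)) (v (d, σ'))
      rw [abs_sub_comm (v (d, σ)) (v (d, Function.update σ l j))] at h3
      push_cast
      linarith

/-- In terms of the empirical distribution, a symmetric function whose differences are of order
`1 / N` is Lipschitz with a constant independent of `N`. -/
theorem abs_sub_le_mul_norm_emp_sub {v : Config Δ m n → ℝ} {N : ℕ} (hN : 0 < N) (w : Δ → Vec m)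
    (d : Δ) (hv : ∀ σ σ', count σ = count σ' → v (d, σ) = v (d, σ')) (σ σ' : Fin n → Fin (m + 1)) :
    |v (d, σ) - v (d, σ')|
      ≤ 2 * m * N * ‖diffs v‖ * ‖emp N w (d, σ) - emp N w (d, σ')‖ := by
  have hN0 : (0 : ℝ) < N := by exact_mod_cast hN
  set x := emp N w (d, σ)
  set x' := emp N w (d, σ')
  have hcoord : ∑ a, |coord x a - coord x' a| ≤ 2 * m * ‖x - x'‖ := by
    have hk : ∀ k : Fin m, |x k - x' k| ≤ ‖x - x'‖ := fun k => by
      have := PiLp.norm_apply_le (x - x') k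
      simpa using this
    have hs : ∑ k : Fin m, |x k - x' k| ≤ m * ‖x - x'‖ :=
      (Finset.sum_le_card_nsmul _ _ _ fun k _ => hk k).trans_eq (by simp)
    rw [Fin.sum_univ_castSucc]
    simp only [coord_castSucc, coord_last]
    have hl : |1 - ∑ k, x k - (1 - ∑ k, x' k)| ≤ ∑ k : Fin m, |x k - x' k| := by
      rw [show 1 - ∑ k, x k - (1 - ∑ k, x' k) = -∑ k, (x k - x' k) by
        rw [Finset.sum_sub_distrib]; ring, abs_neg]
      exact Finset.abs_sum_le_sum_abs _ _
    linarith
  have hD : ((∑ a, (count σ a - count σ' a) : ℕ) : ℝ) ≤ N * (2 * m * ‖x - x'‖) := by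
    push_cast
    calc ∑ a, ((count σ a - count σ' a : ℕ) : ℝ) ≤ ∑ a, N * |coord x a - coord x' a| := by
          refine Finset.sum_le_sum fun a _ => ?_
          rw [coord_emp_sub, abs_mul, abs_of_pos (by positivity : (0 : ℝ) < 1 / N), ← mul_assoc,
            mul_one_div_cancel hN0.ne', one_mul]
          rcases le_total (count σ a) (count σ' a) with h | h
          · rw [Nat.sub_eq_zero_of_le h]; simp
          · rw [Nat.cast_sub h]; exact le_abs_self _
      _ ≤ _ := by rw [← Finset.mul_sum]; gcongr
  refine (abs_sub_le_of_symmetric d hv σ' _ σ le_rfl).trans ?_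
  calc _ ≤ N * (2 * m * ‖x - x'‖) * ‖diffs v‖ := by gcongr
    _ = _ := by ring

end Symmetric

/-! ### Regularity on the simplex -/

section Regularity

variable {m n : ℕ} {Δ R : Type*}

theorem vertex_apply_nonneg (i : Fin (m + 1)) (k : Fin m) : 0 ≤ (vertex i : Vec m) k := by
  induction i using Fin.lastCases with
  | last => simp
  | cast l => simp only [vertex_castSucc, PiLp.single_apply]; split_ifs <;> norm_num

theorem sum_vertex_apply_le (i : Fin (m + 1)) : ∑ k, (vertex i : Vec m) k ≤ 1 := by
  induction i using Fin.lastCases with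
  | last => simp
  | cast l => simp

theorem emp_mem_simplex {N : ℕ} (hN : 0 < N) {w : Δ → Vec m} {c : Config Δ m n}
    (hw0 : ∀ k, 0 ≤ w c.1 k) (hw1 : ∑ k, w c.1 k ≤ N - n) : emp N w c ∈ simplex m := by
  have hN0 : (0 : ℝ) < N := by exact_mod_cast hN
  have happ : ∀ k, emp N w c k = 1 / N * (w c.1 k + ∑ l, (vertex (c.2 l) : Vec m) k) := by
    intro k
    simp only [emp, PiLp.smul_apply, PiLp.add_apply, WithLp.ofLp_sum, Finset.sum_apply, smul_eq_mul]
  refine ⟨fun k => ?_, ?_⟩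
  · rw [happ]
    have := hw0 k
    have : 0 ≤ ∑ l, (vertex (c.2 l) : Vec m) k :=
      Finset.sum_nonneg fun l _ => vertex_apply_nonneg _ _
    positivity
  · simp only [happ]
    rw [← Finset.mul_sum, Finset.sum_add_distrib, Finset.sum_comm, one_div, inv_mul_le_iff₀ hN0,
      mul_one]
    have : ∑ l, ∑ k, (vertex (c.2 l) : Vec m) k ≤ n :=
      (Finset.sum_le_card_nsmul _ _ 1 fun l _ => sum_vertex_apply_le _).trans_eq (by simp)
    linarith

/-- All players are particles. -/
theorem isWeight_zero {N : ℕ} (hN : 0 < N) : IsWeight N N (fun _ : Δ => (0 : Vec m)) where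
  pos := hN
  le := le_rfl
  mem c := emp_mem_simplex hN (fun k => by simp) (by simp)
  norm_le d y _ := by simp

/-- One player belongs to the environment. -/
theorem isWeight_vertex (ν : Δ → Fin (m + 1)) :
    IsWeight (n + 1) n (fun d => (vertex (ν d) : Vec m)) where
  pos := Nat.succ_pos n
  le := Nat.le_succ n
  mem c := emp_mem_simplex (Nat.succ_pos n) (fun k => vertex_apply_nonneg _ _)
    ((sum_vertex_apply_le _).trans_eq (by push_cast; ring))
  norm_le d y hy := by
    have h1 := norm_sub_le (vertex (ν d) : Vec m) y
    have h2 := norm_vertex_le (m := m) (ν d)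
    have h3 := norm_le_one_of_mem_simplex hy
    have : (((n + 1 : ℕ) : ℝ) - n) • y = y := by push_cast; rw [add_sub_cancel_left, one_smul]
    rw [this]
    linarith

theorem isClosed_simplex : IsClosed (simplex m) := by
  have h1 : IsClosed {x : Vec m | ∀ k, 0 ≤ x k} := by
    simp only [Set.ofPred_forall]
    exact isClosed_iInter fun k => isClosed_le continuous_const (by fun_prop)
  have h2 : Continuous fun x : Vec m => ∑ k, x k := by fun_prop
  exact h1.inter (isClosed_le h2 continuous_const)

theorem isCompact_simplex : IsCompact (simplex m) :=
  (isCompact_closedBall (0 : Vec m) 1).of_isClosed_subset isClosed_simplex fun x hx => by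
    simpa using norm_le_one_of_mem_simplex hx

theorem continuous_coord (i : Fin (m + 1)) : Continuous fun y : Vec m => coord y i :=
  (contDiff_coord i).continuous

theorem continuousOn_prod_of_lip {h : ℝ → Vec m → ℝ} {T κ : ℝ}
    (hh : ∀ t ∈ Icc 0 T, ∀ t' ∈ Icc 0 T, ∀ x ∈ simplex m, ∀ x' ∈ simplex m,
      |h t x - h t' x'| ≤ κ * (|t - t'| + ‖x - x'‖)) :
    ContinuousOn (fun p : ℝ × Vec m => h p.1 p.2) (Icc 0 T ×ˢ simplex m) := by
  have : LipschitzOnWith (2 * κ.toNNReal) (fun p : ℝ × Vec m => h p.1 p.2) (Icc 0 T ×ˢ simplex m) := by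
    refine LipschitzOnWith.of_dist_le_mul fun p hp p' hp' => ?_
    rw [Real.dist_eq]
    refine (hh _ hp.1 _ hp'.1 _ hp.2 _ hp'.2).trans ?_
    rw [← Real.dist_eq, ← dist_eq_norm]
    have h1 : dist p.1 p'.1 ≤ dist p p' := le_max_left _ _
    have h2 : dist p.2 p'.2 ≤ dist p p' := le_max_right _ _
    calc κ * (dist p.1 p'.1 + dist p.2 p'.2) ≤ κ.toNNReal * (dist p p' + dist p p') := by
          gcongr
          exact Real.le_coe_toNNReal κ
      _ = _ := by push_cast; ring
  exact this.continuousOn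

variable [Fintype R]

theorem ParticleRates.Regular.continuousOn_gen {𝒮 : ParticleRates m Δ R} {T κ C : ℝ}
    (h𝒮 : 𝒮.Regular T κ C) {F : ℝ → Δ × Vec m → ℝ} (hF : F ∈ timeSpaceC1 Δ m) (d : Δ) :
    ContinuousOn (fun p : ℝ × Vec m => 𝒮.gen F p.1 (d, p.2)) (Icc 0 T ×ˢ simplex m) := by
  have hFc : ∀ d, Continuous fun p : ℝ × Vec m => F p.1 (d, p.2) := fun d => (hF d).continuous
  set D := fderiv ℝ fun p : ℝ × Vec m => F p.1 (d, p.2) with hD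
  have hDc : Continuous D := (hF d).continuous_fderiv one_ne_zero
  have hdiff : ∀ p, HasFDerivAt (fun p : ℝ × Vec m => F p.1 (d, p.2)) (D p) p := fun p =>
    ((hF d).differentiable one_ne_zero p).hasFDerivAt
  have h1 : ∀ p : ℝ × Vec m, deriv (fun s => F s (d, p.2)) p.1 = D p (1, 0) := fun p => by
    have := (hdiff (p.1, p.2)).comp_hasDerivAt p.1
      ((hasDerivAt_id p.1).prodMk (hasDerivAt_const p.1 p.2))
    exact this.deriv
  have h2 : ∀ (p : ℝ × Vec m) (v : Vec m),
      fderiv ℝ (fun y => F p.1 (d, y)) p.2 v = D p (0, v) := fun p v => by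
    have := (hdiff (p.1, p.2)).comp p.2
      ((hasFDerivAt_const p.1 p.2).prodMk (hasFDerivAt_id p.2))
    have h3 := this.fderiv
    change fderiv ℝ (fun y => F p.1 (d, y)) p.2 = _ at h3
    rw [h3]
    simp
  simp only [ParticleRates.gen, h1, h2]
  refine ContinuousOn.add (ContinuousOn.add ?_ ?_) ?_
  · exact (hDc.clm_apply continuous_const).continuousOn
  · exact continuousOn_finsetSum _ fun ρ _ => (continuousOn_prod_of_lip fun t ht t' ht' x hx x' hx' =>
      h𝒮.r_lip t ht t' ht' ρ d x hx x' hx').mul ((hFc _).sub (hFc d)).continuousOn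
  · exact continuousOn_finsetSum _ fun i _ => continuousOn_finsetSum _ fun j _ =>
      (((continuous_coord i).comp continuous_snd).continuousOn.mul
        (continuousOn_prod_of_lip fun t ht t' ht' x hx x' hx' =>
          h𝒮.q_lip t ht t' ht' i j d x hx x' hx')).mul
        (hDc.clm_apply continuous_const).continuousOn

variable [Fintype Δ] [MeasurableSpace Δ] [DiscreteMeasurableSpace Δ]

/-- The state space of the mean field processes. -/
abbrev meanFieldSpace (Δ : Type*) (m : ℕ) : Set (Δ × Vec m) := {z | z.2 ∈ simplex m}

theorem measurable_of_continuousOn {h : Δ × Vec m → ℝ}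
    (hh : ∀ d, ContinuousOn (fun x => h (d, x)) (simplex m)) :
    Measurable fun z : meanFieldSpace Δ m => h z := by
  classical
  set h' : Δ × Vec m → ℝ := fun z => (simplex m).piecewise (fun x => h (z.1, x)) 0 z.2 with hh'
  have hmeas : Measurable h' := by
    refine measurable_from_prod_countable_right fun d => ?_
    exact (hh d).measurable_piecewise continuous_const.continuousOn isClosed_simplex.measurableSet
  have : (fun z : meanFieldSpace Δ m => h z) = fun z : meanFieldSpace Δ m => h' z := by
    funext z
    simp only [hh']
    rw [piecewise_eq_of_mem (simplex m) _ _ z.2]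
  rw [this]
  exact hmeas.comp measurable_subtype_coe

theorem integrable_of_continuousOn {h : Δ × Vec m → ℝ}
    (hh : ∀ d, ContinuousOn (fun x => h (d, x)) (simplex m)) (μ : Measure (meanFieldSpace Δ m))
    [IsFiniteMeasure μ] : Integrable (fun z : meanFieldSpace Δ m => h z) μ := by
  choose b hb using fun d => isCompact_simplex.exists_bound_of_continuousOn (hh d)
  refine Integrable.of_bound (measurable_of_continuousOn hh).aestronglyMeasurable (∑ d, |b d|)
    (ae_of_all _ fun z => ?_)
  exact (hb z.1.1 _ z.2).trans ((le_abs_self _).trans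
    (Finset.single_le_sum (f := fun d => |b d|) (fun _ _ => abs_nonneg _) (Finset.mem_univ z.1.1)))

end Regularity

/-! ### Comparison of particle costs with mean field costs -/

section Comparison

variable {m n : ℕ} {Δ R : Type*} [Fintype R]

theorem CostRegular.continuousOn_f {T κ B : ℝ} {f : ℝ → Δ × Vec m → ℝ} {g : Δ × Vec m → ℝ}
    (hfg : CostRegular T κ B f g) {t : ℝ} (ht : t ∈ Icc 0 T) (d : Δ) :
    ContinuousOn (fun x => f t (d, x)) (simplex m) :=
  (continuousOn_prod_of_lip fun t ht t' ht' x hx x' hx' =>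
    hfg.f_lip t ht t' ht' d x hx x' hx').comp (f := fun x => (t, x)) (by fun_prop) fun _ hx => ⟨ht, hx⟩

theorem CostRegular.continuousOn_g {T κ B : ℝ} {f : ℝ → Δ × Vec m → ℝ} {g : Δ × Vec m → ℝ}
    (hfg : CostRegular T κ B f g) (d : Δ) :
    ContinuousOn (fun x => g (d, x)) (simplex m) := by
  have : LipschitzOnWith κ.toNNReal (fun x => g (d, x)) (simplex m) :=
    LipschitzOnWith.of_dist_le_mul fun x hx x' hx' => by
      rw [Real.dist_eq, dist_eq_norm]
      refine (hfg.g_lip d x hx x' hx').trans ?_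
      gcongr
      exact Real.le_coe_toNNReal κ
  exact this.continuousOn

variable [Fintype Δ]

theorem exists_particleCost {𝒮 : ParticleRates m Δ R} {N : ℕ} {w : Δ → Vec m} {T κ C B : ℝ}
    {f : ℝ → Δ × Vec m → ℝ} {g : Δ × Vec m → ℝ} (h𝒮 : 𝒮.Regular T κ C) (hw : IsWeight N n w)
    (hfg : CostRegular T κ B f g) (hT : 0 ≤ T) :
    ∃ v : ℝ → Config Δ m n → ℝ, IsParticleCost 𝒮 N w T 0 f g v := by
  obtain ⟨v, hvT, hv1, hv⟩ := exists_backward_solution 𝒮.target hT (h𝒮.continuousOn_rate hw)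
    (f := fun t c => f t (c.1, emp N w c)) (fun c => by
      refine continuousOn_of_lip (κ := κ) fun t ht t' ht' => ?_
      simpa using hfg.f_lip t ht t' ht' c.1 _ (hw.mem c) _ (hw.mem c))
    (fun c => g (c.1, emp N w c))
  refine ⟨v, hv1, fun t ht c => ?_, fun c => by rw [hvT]⟩
  rw [(hv t ht c).deriv, zero_mul]
  refine (abs_eq_zero.2 ?_).le
  ring

theorem genBound_nonneg {k : ℕ} {T κ C A B : ℝ} (hA : 0 ≤ A) (hB : 0 ≤ B) (hκ : 0 ≤ κ) :
    0 ≤ genBound m k T κ C A B := by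
  unfold genBound lipBound costBound
  positivity

variable [MeasurableSpace Δ] [DiscreteMeasurableSpace Δ]

/-- Dynkin's formula for the mean field process, applied to the Bernstein transform of the cost of
the particle system. Only the defining properties of a `MarkovLaw` are available for `P`; that the
running cost is integrable in time has to be derived from Dynkin's formula as well. -/
theorem abs_cost_sub_bernstein_le {𝒮 : ParticleRates m Δ R} {N : ℕ} {w : Δ → Vec m}
    {T A κ C B : ℝ} {f : ℝ → Δ × Vec m → ℝ} {g : Δ × Vec m → ℝ} {v : ℝ → Config Δ m n → ℝ}
    (hv : IsParticleCost 𝒮 N w T A f g v) (h𝒮 : 𝒮.Regular T κ C)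
    (hw : IsWeight N n w) (hfg : CostRegular T κ B f g) (hA : 0 ≤ A) (hB : 0 ≤ B) (hκ : 0 ≤ κ)
    (hC : 0 ≤ C) {𝒢 : (ℝ → Δ × Vec m → ℝ) → ℝ → Δ × Vec m → ℝ}
    (h𝒢 : ∀ F ∈ timeSpaceC1 Δ m, ∀ t ∈ Icc 0 T, ∀ z ∈ meanFieldSpace Δ m, 𝒢 F t z = 𝒮.gen F t z)
    (P : MarkovLaw T (meanFieldSpace Δ m) (timeSpaceC1 Δ m) 𝒢) {t : ℝ} (ht : t ∈ Icc 0 T)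
    (z : meanFieldSpace Δ m) :
    |P.cost f g t z - bernstein (v t) z|
      ≤ (T * genBound m (Fintype.card R) T κ C A B + 5 * κ) / √(N : ℝ) := by
  have hT : 0 ≤ T := ht.1.trans ht.2
  have hprob : ∀ u, t ≤ u → u ≤ T → IsProbabilityMeasure (P.kernel t u z) := fun u h1 h2 => by
    have := P.isMarkov t u ht.1 h1 h2
    infer_instance
  set a : ℝ → ℝ := fun u => ∫ y : meanFieldSpace Δ m, f u y ∂(P.kernel t u z) with ha
  -- the Dynkin integrands approximate the running cost
  have happrox : ∀ {N n : ℕ} {w : Δ → Vec m} {A : ℝ} {v : ℝ → Config Δ m n → ℝ},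
      IsParticleCost 𝒮 N w T A f g v → IsWeight N n w → 0 ≤ A → ∀ u ∈ Icc t T,
      |a u + ∫ y : meanFieldSpace Δ m, 𝒢 (fun t => bernstein (v t)) u y ∂(P.kernel t u z)|
        ≤ genBound m (Fintype.card R) T κ C A B / √(N : ℝ) := by
    intro N n w A v hv hw hA u hu
    have hu' : u ∈ Icc 0 T := ⟨ht.1.trans hu.1, hu.2⟩
    have := hprob u hu.1 hu.2
    have hF := bernstein_mem_timeSpaceC1 hv.contDiff
    have h1 : (fun y : meanFieldSpace Δ m => 𝒢 (fun t => bernstein (v t)) u y)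
        = fun y : meanFieldSpace Δ m => 𝒮.gen (fun t => bernstein (v t)) u y :=
      funext fun y => h𝒢 _ hF u hu' _ y.2
    have h2 : Integrable (fun y : meanFieldSpace Δ m => 𝒮.gen (fun t => bernstein (v t)) u y)
        (P.kernel t u z) := integrable_of_continuousOn (fun d =>
          (h𝒮.continuousOn_gen hF d).comp (f := fun x => (u, x)) (by fun_prop)
            fun _ hx => ⟨hu', hx⟩) _
    have h3 : Integrable (fun y : meanFieldSpace Δ m => f u y) (P.kernel t u z) :=
      integrable_of_continuousOn (fun d => hfg.continuousOn_f hu' d) _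
    rw [h1, ha]
    simp only
    rw [← integral_add h3 h2]
    have h4 := norm_integral_le_of_norm_le_const (μ := P.kernel t u z)
      (f := fun y : meanFieldSpace Δ m => f u y + 𝒮.gen (fun t => bernstein (v t)) u y)
      (C := genBound m (Fintype.card R) T κ C A B / √(N : ℝ)) (ae_of_all _ fun y => by
        rw [add_comm, Real.norm_eq_abs]
        exact hv.abs_gen_bernstein_add_le h𝒮 hw hfg hA hB hκ hC hu' y.1.1 y.2)
    simpa using h4
  have hdynkin : ∀ {N n : ℕ} {w : Δ → Vec m} {A : ℝ} {v : ℝ → Config Δ m n → ℝ},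
      IsParticleCost 𝒮 N w T A f g v → _ := fun hv =>
    P.generator _ (bernstein_mem_timeSpaceC1 hv.contDiff) t T ht.1 ht.2 le_rfl z
  -- as a limit of the Dynkin integrands, the running cost is measurable
  have haint : IntervalIntegrable a volume t T := by
    choose vs hvs using fun p : ℕ => exists_particleCost (N := p + 1) (n := p + 1) h𝒮
      (isWeight_zero p.succ_pos) hfg hT
    rw [intervalIntegrable_iff_integrableOn_Ioc_of_le ht.2]
    have hlim : ∀ u ∈ Ioc t T, Tendsto (fun p : ℕ => -∫ y : meanFieldSpace Δ m,
        𝒢 (fun t => bernstein (vs p t)) u y ∂(P.kernel t u z)) atTop (𝓝 (a u)) := by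
      intro u hu
      have h0 : Tendsto (fun p : ℕ => genBound m (Fintype.card R) T κ C 0 B / √((p + 1 : ℕ) : ℝ))
          atTop (𝓝 0) :=
        Tendsto.div_atTop tendsto_const_nhds (Real.tendsto_sqrt_atTop.comp
          (tendsto_natCast_atTop_atTop.comp (tendsto_add_atTop_nat 1)))
      rw [tendsto_iff_dist_tendsto_zero]
      refine squeeze_zero (fun _ => dist_nonneg) (fun p => ?_) h0
      rw [dist_comm, Real.dist_eq, sub_neg_eq_add]
      exact happrox (hvs p) (isWeight_zero p.succ_pos) le_rfl u ⟨hu.1.le, hu.2⟩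
    have hmeas : AEStronglyMeasurable a (volume.restrict (Ioc t T)) := by
      refine aestronglyMeasurable_of_tendsto_ae atTop (fun p => ?_)
        ((ae_restrict_iff' measurableSet_Ioc).2 (ae_of_all _ hlim))
      exact ((hdynkin (hvs p)).1.1.aestronglyMeasurable).neg
    refine Integrable.of_bound hmeas B ((ae_restrict_iff' measurableSet_Ioc).2
      (ae_of_all _ fun u hu => ?_))
    have := hprob u hu.1.le hu.2
    have h4 := norm_integral_le_of_norm_le_const (μ := P.kernel t u z)
      (f := fun y : meanFieldSpace Δ m => f u y) (C := B) (ae_of_all _ fun y =>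
        hfg.f_le u ⟨ht.1.trans hu.1.le, hu.2⟩ y.1.1 _ y.2)
    simpa using h4
  obtain ⟨hbint, hb⟩ := hdynkin hv
  have hgT : |∫ y : meanFieldSpace Δ m, g y ∂(P.kernel t T z)
      - ∫ y : meanFieldSpace Δ m, bernstein (v T) y ∂(P.kernel t T z)| ≤ 5 * κ / √(N : ℝ) := by
    have := hprob T ht.2 le_rfl
    rw [← integral_sub (integrable_of_continuousOn (fun d => hfg.continuousOn_g d) _)
      (integrable_of_continuousOn (fun d => (contDiff_bernstein (v T) d).continuous.continuousOn) _)]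
    have h4 := norm_integral_le_of_norm_le_const (μ := P.kernel t T z)
      (f := fun y : meanFieldSpace Δ m => g y - bernstein (v T) y) (C := 5 * κ / √(N : ℝ))
      (ae_of_all _ fun y => by
        rw [Real.norm_eq_abs, abs_sub_comm]
        exact hv.abs_bernstein_terminal_sub_le hw hfg hκ y.1.1 y.2)
    simpa using h4
  set b : ℝ → ℝ := fun u => ∫ y : meanFieldSpace Δ m,
    𝒢 (fun t => bernstein (v t)) u y ∂(P.kernel t u z) with hbdef
  have hrun : |∫ u in t..T, (a u + b u)|
      ≤ T * (genBound m (Fintype.card R) T κ C A B / √(N : ℝ)) := by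
    have h5 := intervalIntegral.norm_integral_le_of_norm_le_const (a := t) (b := T)
      (f := fun u => a u + b u) (C := genBound m (Fintype.card R) T κ C A B / √(N : ℝ)) fun u hu => by
        rw [uIoc_of_le ht.2] at hu
        exact happrox hv hw hA u ⟨hu.1.le, hu.2⟩
    refine h5.trans ?_
    rw [mul_comm, abs_of_nonneg (sub_nonneg.2 ht.2)]
    have := genBound_nonneg (m := m) (k := Fintype.card R) (T := T) (C := C) hA hB hκ
    have := ht.1
    gcongr
    linarith
  have hsplit : P.cost f g t z - bernstein (v t) z = (∫ u in t..T, (a u + b u))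
      + (∫ y : meanFieldSpace Δ m, g y ∂(P.kernel t T z)
      - ∫ y : meanFieldSpace Δ m, bernstein (v T) y ∂(P.kernel t T z)) := by
    rw [intervalIntegral.integral_add haint hbint, hb, MarkovLaw.cost]
    ring
  rw [hsplit]
  refine (abs_add_le _ _).trans ((add_le_add hrun hgT).trans_eq ?_)
  ring

/-- `compBound / √N` bounds the difference of the costs of the particle system and of its limit. -/
def compBound (m k : ℕ) (T κ C A B : ℝ) : ℝ :=
  T * genBound m k T κ C A B + 5 * κ + 10 * m * lipBound m k T κ C A B

/-- For symmetric particle costs, the starting configuration `c` can be compared with independent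
particles whose law is the empirical distribution of `c`. -/
theorem abs_cost_sub_le {𝒮 : ParticleRates m Δ R} {N : ℕ} {w : Δ → Vec m}
    {T A κ C B : ℝ} {f : ℝ → Δ × Vec m → ℝ} {g : Δ × Vec m → ℝ} {v : ℝ → Config Δ m n → ℝ}
    (hv : IsParticleCost 𝒮 N w T A f g v) (h𝒮 : 𝒮.Regular T κ C)
    (hw : IsWeight N n w) (hfg : CostRegular T κ B f g) (hA : 0 ≤ A) (hB : 0 ≤ B) (hκ : 0 ≤ κ)
    (hC : 0 ≤ C) {𝒢 : (ℝ → Δ × Vec m → ℝ) → ℝ → Δ × Vec m → ℝ}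
    (h𝒢 : ∀ F ∈ timeSpaceC1 Δ m, ∀ t ∈ Icc 0 T, ∀ z ∈ meanFieldSpace Δ m, 𝒢 F t z = 𝒮.gen F t z)
    (P : MarkovLaw T (meanFieldSpace Δ m) (timeSpaceC1 Δ m) 𝒢) {t : ℝ} (ht : t ∈ Icc 0 T)
    (c : Config Δ m n) (hsymm : ∀ σ σ', count σ = count σ' → v t (c.1, σ) = v t (c.1, σ')) :
    |v t c - P.cost f g t ⟨(c.1, emp N w c), hw.mem c⟩|
      ≤ compBound m (Fintype.card R) T κ C A B / √(N : ℝ) := by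
  have hN0 : (0 : ℝ) < N := by exact_mod_cast hw.pos
  have h1 := abs_cost_sub_bernstein_le hv h𝒮 hw hfg hA hB hκ hC h𝒢 P ht
    ⟨(c.1, emp N w c), hw.mem c⟩
  simp only at h1
  set x := emp N w c with hx
  set Λ := lipBound m (Fintype.card R) T κ C A B with hΛ
  have hΛ0 : 0 ≤ Λ := by rw [hΛ, lipBound, costBound]; positivity
  have hD : N * ‖diffs (v t)‖ ≤ Λ := by
    have := hv.norm_diffs_le h𝒮 hw hfg hA hB hκ hC ht
    rw [le_div_iff₀ hN0] at this
    linarith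
  have h2 : |bernstein (v t) (c.1, x) - v t c| ≤ 10 * m * Λ / √(N : ℝ) := by
    have : bernstein (v t) (c.1, x) - v t c = ∑ σ, wt x σ * (v t (c.1, σ) - v t c) := by
      simp only [bernstein, mul_sub, Finset.sum_sub_distrib]
      rw [← Finset.sum_mul, sum_wt, one_mul]
    rw [this]
    refine (abs_sum_wt_mul_le (hw.mem c) (b := fun σ => 2 * m * Λ * ‖emp N w (c.1, σ) - x‖)
      fun σ => ?_).trans ?_
    · refine (abs_sub_le_mul_norm_emp_sub hw.pos w c.1 hsymm σ c.2).trans ?_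
      calc 2 * m * N * ‖diffs (v t)‖ * ‖emp N w (c.1, σ) - emp N w (c.1, c.2)‖
          = 2 * m * (N * ‖diffs (v t)‖) * ‖emp N w (c.1, σ) - x‖ := by rw [hx]; ring
        _ ≤ _ := by gcongr
    · calc ∑ σ : Fin n → Fin (m + 1), wt x σ * (2 * m * Λ * ‖emp N w (c.1, σ) - x‖)
          = 2 * m * Λ * ∑ σ : Fin n → Fin (m + 1), wt x σ * ‖emp N w (c.1, σ) - x‖ := by
            rw [Finset.mul_sum]; exact Finset.sum_congr rfl fun σ _ => by ring
        _ ≤ 2 * m * Λ * (5 / √(N : ℝ)) := by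
            gcongr; exact sum_wt_mul_norm_emp_sub_le hw c.1 (hw.mem c)
        _ = _ := by ring
  rw [abs_sub_comm]
  refine (abs_sub_le _ (bernstein (v t) (c.1, x)) _).trans ((add_le_add h1 h2).trans_eq ?_)
  rw [compBound]
  ring

end Comparison

/-! ### Weak convergence on the mean field state space -/

section WeakConvergence

theorem exists_measure_of_weights {ι X : Type*} [Fintype ι] [MeasurableSpace X]
    [MeasurableSingletonClass X] {a : ι → ℝ} (ha : ∀ i, 0 ≤ a i) (ha1 : ∑ i, a i = 1) (x : ι → X) :
    ∃ μ : Measure X, IsProbabilityMeasure μ ∧ ∀ h : X → ℝ, ∫ y, h y ∂μ = ∑ i, a i * h (x i) := by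
  refine ⟨∑ i, ENNReal.ofReal (a i) • Measure.dirac (x i), ⟨?_⟩, fun h => ?_⟩
  · simp only [Measure.coe_finsetSum, Finset.sum_apply, Measure.smul_apply, measure_univ,
      smul_eq_mul, mul_one]
    rw [← ENNReal.ofReal_sum_of_nonneg fun i _ => ha i, ha1, ENNReal.ofReal_one]
  · rw [integral_finsetSum_measure fun i _ =>
      (integrable_dirac (by finiteness)).smul_measure ENNReal.ofReal_ne_top]
    refine Finset.sum_congr rfl fun i _ => ?_
    rw [integral_smul_measure, integral_dirac, ENNReal.toReal_ofReal (ha i), smul_eq_mul]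

/-- On a compact space, convergence of the integrals of Lipschitz functions, to limits that need not
be given by a measure, implies weak convergence. -/
theorem exists_tendsto_of_lipschitz {Z : Type*} [MetricSpace Z] [CompactSpace Z] [MeasurableSpace Z]
    [BorelSpace Z] {μ : ℕ → ProbabilityMeasure Z}
    (H : ∀ h : Z → ℝ, (∃ L, LipschitzWith L h) →
      ∃ ℓ, Tendsto (fun p => ∫ z, h z ∂(μ p : Measure Z)) atTop (𝓝 ℓ)) :
    ∃ ν, Tendsto μ atTop (𝓝 ν) := by
  obtain ⟨ν, -, hν⟩ := isCompact_univ (X := ProbabilityMeasure Z).ultrafilter_le_nhds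
    ((hyperfilter ℕ).map μ) (by simp)
  have hν' : Tendsto μ (hyperfilter ℕ) (𝓝 ν) := hν
  refine ⟨ν, tendsto_iff_forall_lipschitz_integral_tendsto.2 fun h _ hL => ?_⟩
  obtain ⟨ℓ, hℓ⟩ := H h hL
  obtain ⟨L, hL⟩ := hL
  have h1 := (ProbabilityMeasure.tendsto_iff_forall_integral_tendsto.1 hν')
    (BoundedContinuousFunction.mkOfCompact ⟨h, hL.continuous⟩)
  have h2 := hℓ.mono_left Nat.hyperfilter_le_atTop
  rwa [tendsto_nhds_unique h2 h1] at hℓ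

theorem measurable_of_measurable_integral {α Z : Type*} [MeasurableSpace α] [MetricSpace Z]
    [CompactSpace Z] [MeasurableSpace Z] [BorelSpace Z] {ν : α → Measure Z}
    [∀ a, IsProbabilityMeasure (ν a)]
    (H : ∀ h : Z → ℝ, Continuous h → Measurable fun a => ∫ z, h z ∂(ν a)) : Measurable ν := by
  refine Measurable.measure_of_isPiSystem_of_isProbabilityMeasure
    ((BorelSpace.measurable_eq (α := Z)).trans borel_eq_generateFrom_isClosed) isPiSystem_isClosed
    fun F hF => ?_
  refine measurable_of_tendsto_metrizable (f := fun p a => ∫⁻ z, hF.apprSeq p z ∂(ν a)) (fun p => ?_)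
    (tendsto_pi_nhds.2 fun a => HasOuterApproxClosed.tendsto_lintegral_apprSeq hF (ν a))
  have h1 : Continuous fun z => ((hF.apprSeq p z : NNReal) : ℝ) :=
    NNReal.continuous_coe.comp (hF.apprSeq p).continuous
  have h2 : ∀ a, ∫⁻ z, hF.apprSeq p z ∂(ν a)
      = ENNReal.ofReal (∫ z, ((hF.apprSeq p z : NNReal) : ℝ) ∂(ν a)) := fun a => by
    rw [ofReal_integral_eq_lintegral_ofReal]
    · simp only [ENNReal.ofReal_coe_nnreal]
    · exact (BoundedContinuousFunction.mkOfCompact ⟨_, h1⟩).integrable _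
    · exact ae_of_all _ fun z => NNReal.coe_nonneg _
  simp only [h2]
  exact ENNReal.measurable_ofReal.comp (H _ h1)

variable {m : ℕ} {Δ : Type*}

theorem continuous_of_fibers [TopologicalSpace Δ] [DiscreteTopology Δ] {h : Δ × Vec m → ℝ}
    (hh : ∀ d, ContinuousOn (fun x => h (d, x)) (simplex m)) :
    Continuous fun z : meanFieldSpace Δ m => h z := by
  have : ContinuousOn h (meanFieldSpace Δ m) := continuousOn_prod_of_discrete_left.2 fun d => hh d
  exact continuousOn_iff_continuous_domRestrict.1 this

theorem compactSpace_meanFieldSpace [Fintype Δ] [TopologicalSpace Δ] [DiscreteTopology Δ] :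
    CompactSpace (meanFieldSpace Δ m) := by
  have : (meanFieldSpace Δ m) = univ ×ˢ simplex m := by ext; simp
  refine isCompact_iff_compactSpace.1 ?_
  rw [this]
  exact isCompact_univ.prod isCompact_simplex

variable [Fintype Δ]

/-- A metric on the finite set of the states of the environment. Its choice does not matter, as
every metric on a finite set induces the discrete topology. -/
abbrev finiteMetric (Δ : Type*) [Fintype Δ] : MetricSpace Δ :=
  MetricSpace.induced (fun d => ((Fintype.equivFin Δ d : ℕ) : ℝ))
    (fun _ _ h => (Fintype.equivFin Δ).injective (Fin.val_injective (Nat.cast_injective h)))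
    inferInstance

/-- Lipschitz functions on the state space are Lipschitz terminal costs. -/
theorem costRegular_of_lipschitz [MetricSpace Δ] {h : meanFieldSpace Δ m → ℝ} {L : NNReal}
    (hL : LipschitzWith L h) : ∃ (g : Δ × Vec m → ℝ) (B : ℝ), 0 ≤ B ∧
      (∀ T, CostRegular T L B (fun _ _ => 0) g) ∧ ∀ z : meanFieldSpace Δ m, g z = h z := by
  classical
  have := compactSpace_meanFieldSpace (Δ := Δ) (m := m)
  obtain ⟨B, hB⟩ := (isCompact_univ (X := meanFieldSpace Δ m)).exists_bound_of_continuousOn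
    hL.continuous.continuousOn
  refine ⟨fun z => if hz : z ∈ meanFieldSpace Δ m then h ⟨z, hz⟩ else 0, |B|, abs_nonneg _,
    fun T => ⟨fun t _ t' _ d x _ x' _ => ?_, fun t _ d x _ => by simp, fun d x hx x' hx' => ?_,
    fun d x hx => ?_⟩, fun z => dif_pos z.2⟩
  · simp only [sub_self, abs_zero]
    positivity
  · rw [dif_pos (show (d, x) ∈ meanFieldSpace Δ m from hx),
      dif_pos (show (d, x') ∈ meanFieldSpace Δ m from hx'), ← Real.dist_eq]
    refine (hL.dist_le_mul _ _).trans_eq ?_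
    rw [Subtype.dist_eq, Prod.dist_eq, dist_self, max_eq_right dist_nonneg, dist_eq_norm]
  · rw [dif_pos (show (d, x) ∈ meanFieldSpace Δ m from hx)]
    exact (hB _ (mem_univ _)).trans (le_abs_self B)

variable [MeasurableSpace Δ] [DiscreteMeasurableSpace Δ]

/-- If the integrals of Lipschitz functions converge, so do the measures, to a probability measure.
-/
theorem exists_weak_limit {μ : ℕ → Measure (meanFieldSpace Δ m)} [∀ p, IsProbabilityMeasure (μ p)]
    (H : ∀ (g : Δ × Vec m → ℝ) (κ B : ℝ), 0 ≤ κ → 0 ≤ B → (∀ T, CostRegular T κ B (fun _ _ => 0) g) →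
      ∃ ℓ, Tendsto (fun p => ∫ z : meanFieldSpace Δ m, g z ∂(μ p)) atTop (𝓝 ℓ)) :
    ∃ ν : Measure (meanFieldSpace Δ m), IsProbabilityMeasure ν ∧
      ∀ h : Δ × Vec m → ℝ, (∀ d, ContinuousOn (fun x => h (d, x)) (simplex m)) →
        Tendsto (fun p => ∫ z : meanFieldSpace Δ m, h z ∂(μ p)) atTop
          (𝓝 (∫ z : meanFieldSpace Δ m, h z ∂ν)) := by
  let _ := finiteMetric Δ
  have := compactSpace_meanFieldSpace (Δ := Δ) (m := m)
  obtain ⟨ν, hν⟩ := exists_tendsto_of_lipschitz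
    (μ := fun p => (⟨μ p, inferInstance⟩ : ProbabilityMeasure (meanFieldSpace Δ m)))
    fun h ⟨L, hL⟩ => by
      obtain ⟨g, B, hB, hg, hgh⟩ := costRegular_of_lipschitz hL
      obtain ⟨ℓ, hℓ⟩ := H g L B L.2 hB hg
      exact ⟨ℓ, by simp only [hgh] at hℓ; exact hℓ⟩
  refine ⟨ν, inferInstance, fun h hh => ?_⟩
  exact (ProbabilityMeasure.tendsto_iff_forall_integral_tendsto.1 hν)
    (BoundedContinuousFunction.mkOfCompact ⟨_, continuous_of_fibers hh⟩)

/-- Integrals of Lipschitz functions determine a probability measure. -/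
theorem measure_eq_of_integral_eq {μ ν : Measure (meanFieldSpace Δ m)} [IsProbabilityMeasure μ]
    [IsProbabilityMeasure ν]
    (H : ∀ (g : Δ × Vec m → ℝ) (κ B : ℝ), 0 ≤ κ → 0 ≤ B → (∀ T, CostRegular T κ B (fun _ _ => 0) g) →
      ∫ z : meanFieldSpace Δ m, g z ∂μ = ∫ z : meanFieldSpace Δ m, g z ∂ν) : μ = ν := by
  let _ := finiteMetric Δ
  set μ' : ProbabilityMeasure (meanFieldSpace Δ m) := ⟨μ, inferInstance⟩
  set ν' : ProbabilityMeasure (meanFieldSpace Δ m) := ⟨ν, inferInstance⟩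
  have h : Tendsto (fun _ : ℕ => μ') atTop (𝓝 ν') :=
    tendsto_iff_forall_lipschitz_integral_tendsto.2 fun h _ ⟨L, hL⟩ => by
      obtain ⟨g, B, hB, hg, hgh⟩ := costRegular_of_lipschitz hL
      have := H g L B L.2 hB hg
      simp only [hgh] at this
      change Tendsto (fun _ : ℕ => ∫ z, h z ∂μ) atTop (𝓝 (∫ z, h z ∂ν))
      rw [this]
      exact tendsto_const_nhds
  have h' : μ' = ν' := tendsto_nhds_unique tendsto_const_nhds h
  exact congrArg (fun x : ProbabilityMeasure (meanFieldSpace Δ m) =>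
    (x : Measure (meanFieldSpace Δ m))) h'

theorem measurable_of_fiberwise {α : Type*} [MeasurableSpace α]
    {ν : α → Measure (meanFieldSpace Δ m)} [∀ a, IsProbabilityMeasure (ν a)]
    (H : ∀ h : Δ × Vec m → ℝ, (∀ d, ContinuousOn (fun x => h (d, x)) (simplex m)) →
      Measurable fun a => ∫ z : meanFieldSpace Δ m, h z ∂(ν a)) : Measurable ν := by
  classical
  let _ := finiteMetric Δ
  have := compactSpace_meanFieldSpace (Δ := Δ) (m := m)
  refine measurable_of_measurable_integral fun h hh => ?_
  set h' : Δ × Vec m → ℝ := fun z => if hz : z ∈ meanFieldSpace Δ m then h ⟨z, hz⟩ else 0 with hh'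
  have h1 : ∀ z : meanFieldSpace Δ m, h' z = h z := fun z => dif_pos z.2
  have h2 := H h' fun d => by
    have : ContinuousOn h' (meanFieldSpace Δ m) := by
      refine continuousOn_iff_continuous_domRestrict.2 ?_
      have : (meanFieldSpace Δ m).domRestrict h' = h := funext h1
      rwa [this]
    exact this.comp (f := fun x => (d, x)) (by fun_prop) fun x hx => hx
  simpa only [h1] using h2

end WeakConvergence

/-! ### Convergence of the generators of particle systems -/

section TransitionAverages

variable {ι Λ : Type*} [Fintype Λ] {T : ℝ} {target : Λ → ι → ι} {rate : ℝ → Λ → ι → ℝ}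

/-- The generator of the space-time process. -/
def jumpGen (target : Λ → ι → ι) (rate : ℝ → Λ → ι → ℝ) (w : ℝ → ι → ℝ) (t : ℝ) (i : ι) : ℝ :=
  deriv (fun s => w s i) t + jumpOp target (rate t) (w t) i

theorem continuousOn_jumpGen (hrate : ∀ e a, ContinuousOn (fun t => rate t e a) (Icc 0 T))
    {w : ℝ → ι → ℝ} (hw : ∀ j, ContDiff ℝ 1 fun u => w u j) (i : ι) :
    ContinuousOn (fun t => jumpGen target rate w t i) (Icc 0 T) :=
  ((hw i).continuous_deriv le_rfl).continuousOn.add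
    (continuousOn_jumpOp hrate (fun a => (hw a).continuous.continuousOn) i)

variable [Fintype ι] [DecidableEq ι]

namespace TransitionMatrices

/-- The expected value of `w` at time `s`, as a function of the state at time `t`. -/
def avg (X : TransitionMatrices T target rate) (t s : ℝ) (w : ι → ℝ) (i : ι) : ℝ :=
  ∑ j, X.mat t s i j * w j

variable (X : TransitionMatrices T target rate)

theorem avg_self {t : ℝ} (ht : t ∈ Icc 0 T) (w : ι → ℝ) : X.avg t t w = w := by
  funext i
  simp [avg, X.self t ht, Matrix.one_apply]

theorem abs_avg_sub_le {t s b : ℝ} (h0t : 0 ≤ t) (hts : t ≤ s) (hsT : s ≤ T) {w w' : ι → ℝ}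
    (h : ∀ j, |w j - w' j| ≤ b) (i : ι) : |X.avg t s w i - X.avg t s w' i| ≤ b := by
  simp only [avg, ← Finset.sum_sub_distrib, ← mul_sub]
  refine (Finset.abs_sum_le_sum_abs _ _).trans ?_
  calc ∑ j, |X.mat t s i j * (w j - w' j)| ≤ ∑ j, X.mat t s i j * b :=
        Finset.sum_le_sum fun j _ => by
          rw [abs_mul, abs_of_nonneg (X.nonneg t s h0t hts hsT i j)]
          exact mul_le_mul_of_nonneg_left (h j) (X.nonneg t s h0t hts hsT i j)
    _ = b := by rw [← Finset.sum_mul, X.row_sum t s h0t hts hsT, one_mul]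

theorem continuousOn_avg {t : ℝ} (ht : t ∈ Icc 0 T) {w : ℝ → ι → ℝ}
    (hw : ∀ j, ContinuousOn (fun u => w u j) (Icc 0 T)) (i : ι) :
    ContinuousOn (fun u => X.avg t u (w u) i) (Icc 0 T) := by
  refine continuousOn_finsetSum _ fun j _ => ContinuousOn.mul (fun s hs => ?_) (hw j)
  have h := (X.hasDerivAt t ht s hs i (fun _ => Pi.single j 1) 0
    (fun k => hasDerivAt_const s _)).continuousAt
  have h1 : (fun u => ∑ k, X.mat t u i k * (Pi.single j 1 : ι → ℝ) k) = fun u => X.mat t u i j := by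
    funext u
    simp [Pi.single_apply]
  rw [h1] at h
  exact h.continuousWithinAt

/-- Dynkin's formula. -/
theorem avg_eq_add_integral (hrate : ∀ e a, ContinuousOn (fun t => rate t e a) (Icc 0 T))
    {t s : ℝ} (h0t : 0 ≤ t) (hts : t ≤ s) (hsT : s ≤ T) {w : ℝ → ι → ℝ}
    (hw : ∀ j, ContDiff ℝ 1 fun u => w u j) (i : ι) :
    X.avg t s (w s) i = w t i + ∫ u in t..s, X.avg t u (jumpGen target rate w u) i := by
  have hsub : uIcc t s ⊆ Icc 0 T := by
    rw [uIcc_of_le hts]; exact Icc_subset_Icc h0t hsT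
  have ht : t ∈ Icc 0 T := ⟨h0t, hts.trans hsT⟩
  have h := intervalIntegral.integral_eq_sub_of_hasDerivAt (a := t) (b := s)
    (f := fun u => X.avg t u (w u) i) (f' := fun u => X.avg t u (jumpGen target rate w u) i)
    (fun u hu => X.hasDerivAt t ht u (hsub hu) i w _ fun j =>
      ((hw j).differentiable one_ne_zero u).hasDerivAt)
    ((X.continuousOn_avg ht (continuousOn_jumpGen hrate hw) i).mono hsub).intervalIntegrable
  rw [h, X.avg_self ht]
  ring

end TransitionMatrices

end TransitionAverages

section GeneratorConvergence

variable {m n : ℕ} {Δ R : Type*}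

theorem emp_apply (N : ℕ) (w : Δ → Vec m) (c : Config Δ m n) (k : Fin m) :
    emp N w c k = (1 / N : ℝ) * (w c.1 k + count c.2 k.castSucc) := by
  have h : (∑ l, (vertex (c.2 l) : Vec m)) k = count c.2 k.castSucc := by
    rw [sum_vertex_eq, Fin.sum_univ_castSucc]
    simp [Pi.single_apply]
  simp only [emp, PiLp.smul_apply, PiLp.add_apply, h, smul_eq_mul]

/-- If all players are particles, the players in the state `a` are the particles in this state. -/
theorem coord_emp_zero (hn : 0 < n) (c : Config Δ m n) (a : Fin (m + 1)) :
    n * coord (emp n (fun _ => 0) c) a = count c.2 a := by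
  have hn0 : (n : ℝ) ≠ 0 := by positivity
  induction a using Fin.lastCases with
  | cast k =>
    rw [coord_castSucc, emp_apply]
    simp only [PiLp.zero_apply]
    field_simp
    ring
  | last =>
    have h1 := congrArg (Nat.cast (R := ℝ)) (sum_count c.2)
    rw [Fin.sum_univ_castSucc] at h1
    push_cast at h1
    simp only [coord_last, emp_apply, PiLp.zero_apply, zero_add, ← Finset.mul_sum]
    field_simp
    linarith

theorem sum_eq_sum_count_mul (σ : Fin n → Fin (m + 1)) (ψ : Fin (m + 1) → ℝ) :
    ∑ l, ψ (σ l) = ∑ i, count σ i * ψ i := by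
  simp only [count, Nat.cast_sum, Finset.sum_mul]
  rw [Finset.sum_comm]
  refine Finset.sum_congr rfl fun l _ => ?_
  simp

/-- The generator of the particle system converges to the mean field generator. -/
theorem ParticleRates.Regular.eventually_abs_gen_sub_le [Fintype R] [Finite Δ]
    {𝒮 : ParticleRates m Δ R} {T κ C : ℝ}
    (h𝒮 : 𝒮.Regular T κ C) (hC : 0 ≤ C) {F : ℝ → Δ × Vec m → ℝ} (hF : F ∈ timeSpaceC1 Δ m) {ε : ℝ}
    (hε : 0 < ε) : ∀ᶠ n : ℕ in atTop, ∀ u ∈ Icc 0 T, ∀ c : Config Δ m n,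
      |jumpGen 𝒮.target (𝒮.rate n fun _ => 0)
        (fun s c => F s (c.1, emp n (fun _ => 0) c)) u c - 𝒮.gen F u (c.1, emp n (fun _ => 0) c)| ≤ ε := by
  set η : ℝ := ε / ((m + 1) * (C + 1) * 2) with hη
  have hη0 : 0 < η := by positivity
  -- uniform continuity of the derivative in space
  have hunif : ∀ d : Δ, ∀ᶠ n : ℕ in atTop, ∀ u ∈ Icc 0 T, ∀ x ∈ simplex m, ∀ y ∈ Metric.closedBall x (2 / n),
      ‖fderiv ℝ (fun y => F u (d, y)) y - fderiv ℝ (fun y => F u (d, y)) x‖ ≤ η := by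
    intro d
    set D : ℝ × Vec m → Vec m →L[ℝ] ℝ := fun p =>
      (fderiv ℝ (fun p : ℝ × Vec m => F p.1 (d, p.2)) p).comp (ContinuousLinearMap.inr ℝ ℝ (Vec m))
      with hD
    have hDF : ∀ p : ℝ × Vec m, fderiv ℝ (fun y => F p.1 (d, y)) p.2 = D p := fun p => by
      have h1 := ((hF d).differentiable one_ne_zero p).hasFDerivAt.comp p.2
        (hasFDerivAt_prodMk_right (𝕜 := ℝ) p.1 p.2)
      exact h1.fderiv
    have hDc : Continuous D :=
      ((hF d).continuous_fderiv one_ne_zero).clm_comp continuous_const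
    have huc := (isCompact_Icc (a := (0 : ℝ)) (b := T)).prod
      (isCompact_closedBall (0 : Vec m) 3) |>.uniformContinuousOn_of_continuous hDc.continuousOn
    obtain ⟨δ, hδ0, hδ⟩ := Metric.uniformContinuousOn_iff.1 huc η hη0
    have hlim : Tendsto (fun n : ℕ => (2 : ℝ) / n) atTop (𝓝 0) :=
      tendsto_const_div_atTop_nhds_zero_nat 2
    filter_upwards [hlim.eventually_lt_const (lt_min hδ0 two_pos)] with n hn u hu x hx y hy
    have hx1 := norm_le_one_of_mem_simplex hx
    rw [mem_closedBall_iff_norm] at hy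
    have hy1 : ‖y‖ ≤ 3 := by
      have := norm_sub_norm_le y x
      have := hn.le.trans (min_le_right _ _)
      linarith
    have h1 := hδ (u, y) ⟨hu, by simpa using hy1⟩ (u, x) ⟨hu, by simpa using by linarith⟩ (by
      rw [Prod.dist_eq, dist_self, max_eq_right dist_nonneg, dist_eq_norm]
      exact hy.trans_lt (hn.trans_le (min_le_left _ _)))
    rw [dist_eq_norm] at h1
    rw [hDF (u, y), hDF (u, x)]
    exact h1.le
  filter_upwards [eventually_all.2 hunif, eventually_gt_atTop 0] with n hn hn0 u hu c
  have hn0' : (0 : ℝ) < n := by exact_mod_cast hn0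
  have hx := (isWeight_zero (Δ := Δ) hn0).mem c
  set x := emp n (fun _ => 0) c with hxdef
  set D := fderiv ℝ (fun y => F u (c.1, y)) x with hD
  have hstep : ∀ i j, |F u (c.1, x + (1 / n : ℝ) • jump i j) - F u (c.1, x)
      - (1 / n : ℝ) * D (jump i j)| ≤ η * (2 / n) := by
    intro i j
    have hj : ‖(1 / n : ℝ) • (jump i j : Vec m)‖ ≤ 2 / n := by
      rw [norm_smul, Real.norm_of_nonneg (by positivity)]
      calc (1 / n : ℝ) * ‖(jump i j : Vec m)‖ ≤ 1 / n * 2 := by gcongr; exact norm_jump_le _ _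
        _ = 2 / n := by ring
    have h1 := (convex_closedBall x (2 / n : ℝ)).norm_image_sub_le_of_norm_hasFDerivWithin_le'
      (f := fun y => F u (c.1, y)) (f' := fun y => fderiv ℝ (fun y => F u (c.1, y)) y) (φ := D)
      (C := η) (x := x) (y := x + (1 / n : ℝ) • jump i j) (fun y _ =>
        (((hF c.1).comp (contDiff_prodMk_right u)).differentiable one_ne_zero
          y).hasFDerivAt.hasFDerivWithinAt)
      (fun y hy => hn c.1 u hu x hx y hy) (Metric.mem_closedBall_self (by positivity))
      (by simpa [mem_closedBall_iff_norm] using hj)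
    rw [add_sub_cancel_left, map_smul, smul_eq_mul, Real.norm_eq_abs] at h1
    exact h1.trans (by gcongr)
  have hkey : jumpGen 𝒮.target (𝒮.rate n fun _ => 0)
        (fun s c => F s (c.1, emp n (fun _ => 0) c)) u c - 𝒮.gen F u (c.1, x)
      = ∑ l, ∑ j, 𝒮.q u (c.2 l) j c.1 x * (F u (c.1, x + (1 / n : ℝ) • jump (c.2 l) j)
        - F u (c.1, x) - (1 / n : ℝ) * D (jump (c.2 l) j)) := by
    have h1 : ∑ i, ∑ j, coord x i * 𝒮.q u i j c.1 x * D (jump i j)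
        = ∑ l, ∑ j, 𝒮.q u (c.2 l) j c.1 x * ((1 / n : ℝ) * D (jump (c.2 l) j)) := by
      rw [sum_eq_sum_count_mul c.2 fun i => ∑ j, 𝒮.q u i j c.1 x * ((1 / n : ℝ) * D (jump i j))]
      refine Finset.sum_congr rfl fun i _ => ?_
      rw [Finset.mul_sum, ← coord_emp_zero hn0 c]
      refine Finset.sum_congr rfl fun j _ => ?_
      rw [← hxdef]
      field_simp
    simp only [jumpGen, ParticleRates.gen, jumpOp, Fintype.sum_sum_type,
      Fintype.sum_prod_type, ParticleRates.rate, ParticleRates.target, emp_move]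
    rw [← hxdef, ← hD, h1]
    simp only [mul_sub, Finset.sum_sub_distrib]
    have h2 : ∀ ρ, emp n (fun _ => 0) (𝒮.τ ρ c.1, c.2) = x := fun ρ => rfl
    simp only [h2, move]
    ring
  rw [hkey]
  refine (Finset.abs_sum_le_sum_abs _ _).trans ?_
  refine (Finset.sum_le_card_nsmul _ _ ((m + 1) * (C * (η * (2 / n)))) fun l _ => ?_).trans ?_
  · refine (Finset.abs_sum_le_sum_abs _ _).trans ?_
    refine (Finset.sum_le_card_nsmul _ _ (C * (η * (2 / n))) fun j _ => ?_).trans_eq (by simp)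
    rw [abs_mul, abs_of_nonneg (h𝒮.q_nonneg u hu _ _ _ _ hx)]
    gcongr
    exacts [h𝒮.q_le u hu _ _ _ _ hx, hstep _ _]
  · simp only [Finset.card_univ, Fintype.card_fin, nsmul_eq_mul]
    have : (n : ℝ) * ((m + 1) * (C * (η * (2 / n)))) = (m + 1) * C * 2 * η := by
      field_simp
    rw [this, hη, mul_div_assoc', div_le_iff₀ (by positivity)]
    nlinarith [mul_nonneg hε.le (by positivity : (0 : ℝ) ≤ m + 1)]

/-- Bernstein's theorem, pointwise. -/
theorem tendsto_bernstein {h : Δ × Vec m → ℝ} {z : Δ × Vec m} (hz : z.2 ∈ simplex m)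
    (hh : ContinuousOn (fun x => h (z.1, x)) (simplex m)) :
    Tendsto (fun n : ℕ => bernstein (fun c : Config Δ m n => h (c.1, emp n (fun _ => 0) c)) z) atTop
      (𝓝 (h z)) := by
  obtain ⟨M, hM⟩ := isCompact_simplex.exists_bound_of_continuousOn hh
  have hM0 : 0 ≤ M := (norm_nonneg _).trans (hM _ hz)
  refine Metric.tendsto_atTop'.2 fun ε hε => ?_
  obtain ⟨δ, hδ0, hδ⟩ := Metric.continuousOn_iff.1 hh z.2 hz (ε / 2) (by positivity)
  have hlim : Tendsto (fun n : ℕ => 2 * M / δ * (5 / √(n : ℝ))) atTop (𝓝 (2 * M / δ * 0)) :=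
    (Tendsto.div_atTop tendsto_const_nhds
      (Real.tendsto_sqrt_atTop.comp tendsto_natCast_atTop_atTop)).const_mul _
  rw [mul_zero] at hlim
  obtain ⟨n₀, hn₀⟩ := eventually_atTop.1 (hlim.eventually_lt_const (by positivity : 0 < ε / 2))
  refine ⟨n₀, fun n hn => ?_⟩
  have hw := isWeight_zero (m := m) (Δ := Δ) (N := n) (by omega)
  have h1 : bernstein (fun c : Config Δ m n => h (c.1, emp n (fun _ => 0) c)) z - h z
      = ∑ σ : Fin n → Fin (m + 1), wt z.2 σ * (h (z.1, emp n (fun _ => 0) (z.1, σ)) - h z) := by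
    simp only [bernstein, mul_sub, Finset.sum_sub_distrib]
    rw [← Finset.sum_mul, sum_wt, one_mul]
  rw [Real.dist_eq, h1]
  have h2 := abs_sum_wt_mul_le hz (n := n) (a := fun σ => h (z.1, emp n (fun _ => 0) (z.1, σ)) - h z)
    (b := fun σ => ε / 2 + 2 * M / δ * ‖emp n (fun _ => 0) (z.1, σ) - z.2‖) fun σ => by
      have hx := hw.mem (z.1, σ)
      rcases lt_or_ge ‖emp n (fun _ => 0) (z.1, σ) - z.2‖ δ with hlt | hge
      · have h3 := hδ _ hx (by rwa [dist_eq_norm])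
        rw [Real.dist_eq] at h3
        have : 0 ≤ 2 * M / δ * ‖emp n (fun _ => 0) (z.1, σ) - z.2‖ := by positivity
        linarith
      · have h3 := hM _ hx
        have h4 := hM _ hz
        have h5 := norm_sub_le (h (z.1, emp n (fun _ => 0) (z.1, σ))) (h z)
        have h6 : 2 * M ≤ 2 * M / δ * ‖emp n (fun _ => 0) (z.1, σ) - z.2‖ := by
          rw [div_mul_eq_mul_div, le_div_iff₀ hδ0]
          gcongr
        rw [Real.norm_eq_abs] at h5
        linarith
  refine h2.trans_lt ?_
  simp only [mul_add, Finset.sum_add_distrib, ← Finset.sum_mul, sum_wt, one_mul]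
  have h7 := sum_wt_mul_norm_emp_sub_le hw z.1 hz
  have h8 : ∑ σ : Fin n → Fin (m + 1), wt z.2 σ * (2 * M / δ * ‖emp n (fun _ => 0) (z.1, σ) - z.2‖)
      ≤ 2 * M / δ * (5 / √(n : ℝ)) := by
    calc _ = 2 * M / δ * ∑ σ : Fin n → Fin (m + 1),
          wt z.2 σ * ‖emp n (fun _ => 0) (z.1, σ) - z.2‖ := by
          rw [Finset.mul_sum]; exact Finset.sum_congr rfl fun σ _ => by ring
      _ ≤ _ := by gcongr
  have := hn₀ n hn.le
  linarith

end GeneratorConvergence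

/-! ### Existence of the mean field process -/

section MeanFieldLaw

theorem ParticleRates.Regular.mono {m : ℕ} {Δ R : Type*} {𝒮 : ParticleRates m Δ R}
    {T κ C T' κ' : ℝ} (h : 𝒮.Regular T κ C) (hT : T' ≤ T) (hκ : κ ≤ κ') : 𝒮.Regular T' κ' C where
  r_nonneg t ht := h.r_nonneg t (Icc_subset_Icc_right hT ht)
  q_nonneg t ht := h.q_nonneg t (Icc_subset_Icc_right hT ht)
  q_le t ht := h.q_le t (Icc_subset_Icc_right hT ht)
  r_lip t ht t' ht' ρ d x hx x' hx' := (h.r_lip t (Icc_subset_Icc_right hT ht) t'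
    (Icc_subset_Icc_right hT ht') ρ d x hx x' hx').trans (by gcongr)
  q_lip t ht t' ht' i j d x hx x' hx' := (h.q_lip t (Icc_subset_Icc_right hT ht) t'
    (Icc_subset_Icc_right hT ht') i j d x hx x' hx').trans (by gcongr)

theorem CostRegular.mono {m : ℕ} {Δ : Type*} {T κ κ' B : ℝ} {f : ℝ → Δ × Vec m → ℝ}
    {g : Δ × Vec m → ℝ} (h : CostRegular T κ B f g) (hκ : κ ≤ κ') : CostRegular T κ' B f g where
  f_lip t ht t' ht' d x hx x' hx' := (h.f_lip t ht t' ht' d x hx x' hx').trans (by gcongr)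
  f_le := h.f_le
  g_lip d x hx x' hx' := (h.g_lip d x hx x' hx').trans (by gcongr)
  g_le := h.g_le

variable {m : ℕ} {Δ R : Type*}

theorem abs_bernstein_sub_le {n : ℕ} {v v' : Config Δ m n → ℝ} {b : ℝ} (h : ∀ c, |v c - v' c| ≤ b)
    {z : Δ × Vec m} (hz : z.2 ∈ simplex m) : |bernstein v z - bernstein v' z| ≤ b := by
  simp only [bernstein, ← Finset.sum_sub_distrib, ← mul_sub]
  refine (abs_sum_wt_mul_le hz fun σ => h (z.1, σ)).trans_eq ?_
  rw [← Finset.sum_mul, sum_wt, one_mul]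

theorem tendsto_bernstein_succ {h : Δ × Vec m → ℝ} {z : Δ × Vec m} (hz : z.2 ∈ simplex m)
    (hh : ContinuousOn (fun x => h (z.1, x)) (simplex m)) :
    Tendsto (fun p : ℕ => bernstein (fun c : Config Δ m (p + 1) =>
      h (c.1, emp (p + 1) (fun _ => 0) c)) z) atTop (𝓝 (h z)) :=
  (tendsto_bernstein hz hh).comp (tendsto_add_atTop_nat 1)

variable [Fintype R]

theorem ParticleRates.Regular.exists_gen_bound [Fintype Δ] {𝒮 : ParticleRates m Δ R} {T κ C : ℝ}
    (h𝒮 : 𝒮.Regular T κ C) {F : ℝ → Δ × Vec m → ℝ} (hF : F ∈ timeSpaceC1 Δ m) :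
    ∃ M, 0 ≤ M ∧ ∀ t ∈ Icc 0 T, ∀ d, ∀ x ∈ simplex m, |𝒮.gen F t (d, x)| ≤ M := by
  choose b hb using fun d => (isCompact_Icc.prod isCompact_simplex).exists_bound_of_continuousOn
    (h𝒮.continuousOn_gen hF d)
  refine ⟨∑ d, |b d|, Finset.sum_nonneg fun _ _ => abs_nonneg _, fun t ht d x hx => ?_⟩
  exact (hb d (t, x) ⟨ht, hx⟩).trans ((le_abs_self _).trans
    (Finset.single_le_sum (f := fun d => |b d|) (fun _ _ => abs_nonneg _) (Finset.mem_univ d)))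

variable [Fintype Δ] [DecidableEq Δ] {𝒮 : ParticleRates m Δ R} {T κ C : ℝ}

/-- Transition matrices of the particle system with `p + 1` particles. -/
abbrev ParticleTransitions (𝒮 : ParticleRates m Δ R) (T : ℝ) (p : ℕ) : Type _ :=
  TransitionMatrices T (𝒮.target (n := p + 1)) (𝒮.rate (p + 1) fun _ => 0)

/-- The expected value, for `p + 1` particles that at time `t` are independent with law `z.2`, of
the value of `h` at time `s`. -/
def ParticleTransitions.expect {p : ℕ} (X : ParticleTransitions 𝒮 T p) (t s : ℝ)
    (h : Δ × Vec m → ℝ) (z : Δ × Vec m) : ℝ :=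
  bernstein (X.avg t s fun c => h (c.1, emp (p + 1) (fun _ => 0) c)) z

namespace ParticleTransitions

theorem abs_expect_sub_le {p : ℕ} (X : ParticleTransitions 𝒮 T p) {t s b : ℝ} (h0t : 0 ≤ t)
    (hts : t ≤ s) (hsT : s ≤ T) {h h' : Δ × Vec m → ℝ}
    (hh : ∀ d, ∀ x ∈ simplex m, |h (d, x) - h' (d, x)| ≤ b) {z : Δ × Vec m} (hz : z.2 ∈ simplex m) :
    |X.expect t s h z - X.expect t s h' z| ≤ b :=
  abs_bernstein_sub_le (X.abs_avg_sub_le h0t hts hsT fun c =>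
    hh c.1 _ ((isWeight_zero p.succ_pos).mem c)) hz

theorem abs_expect_le {p : ℕ} (X : ParticleTransitions 𝒮 T p) {t s b : ℝ} (h0t : 0 ≤ t)
    (hts : t ≤ s) (hsT : s ≤ T) {h : Δ × Vec m → ℝ}
    (hh : ∀ d, ∀ x ∈ simplex m, |h (d, x)| ≤ b) {z : Δ × Vec m} (hz : z.2 ∈ simplex m) :
    |X.expect t s h z| ≤ b := by
  have := X.abs_expect_sub_le h0t hts hsT (h := h) (h' := fun _ => 0) (b := b)
    (by simpa using hh) hz
  simpa [expect, TransitionMatrices.avg, bernstein] using this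

/-- Dynkin's formula for particle systems, with an error that comes from the replacement of the
generator of the particle system by the mean field generator. -/
theorem expect_eq_add_integral (h𝒮 : 𝒮.Regular T κ C) (hC : 0 ≤ C) {F : ℝ → Δ × Vec m → ℝ}
    (hF : F ∈ timeSpaceC1 Δ m) (X : ∀ p, ParticleTransitions 𝒮 T p) {t s : ℝ} (h0t : 0 ≤ t)
    (hts : t ≤ s) (hsT : s ≤ T) {z : Δ × Vec m} (hz : z.2 ∈ simplex m) :
    ∃ I : ℕ → ℝ → ℝ, (∀ p, ContinuousOn (I p) (Icc 0 T)) ∧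
      (∀ p, (X p).expect t s (F s) z
        = bernstein (fun c : Config Δ m (p + 1) => F t (c.1, emp (p + 1) (fun _ => 0) c)) z
          + ∫ u in t..s, I p u) ∧
      ∀ ε > 0, ∀ᶠ p in atTop, ∀ u ∈ Icc t T, |I p u - (X p).expect t u (𝒮.gen F u) z| ≤ ε := by
  set W : ∀ p : ℕ, ℝ → Config Δ m (p + 1) → ℝ :=
    fun p s c => F s (c.1, emp (p + 1) (fun _ => 0) c) with hW
  have hWc : ∀ p c, ContDiff ℝ 1 fun u => W p u c := fun p c =>
    (hF c.1).comp (contDiff_prodMk_left _)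
  have hrate := fun p : ℕ => h𝒮.continuousOn_rate (n := p + 1) (N := p + 1) (isWeight_zero p.succ_pos)
  have ht : t ∈ Icc 0 T := ⟨h0t, hts.trans hsT⟩
  refine ⟨fun p u => bernstein ((X p).avg t u (jumpGen 𝒮.target
    (𝒮.rate (p + 1) fun _ => 0) (W p) u)) z, fun p => ?_, fun p => ?_, fun ε hε => ?_⟩
  · exact continuousOn_finsetSum _ fun σ _ => continuousOn_const.mul
      ((X p).continuousOn_avg ht (continuousOn_jumpGen (hrate p) (hWc p)) (z.1, σ))
  · have hint : ∀ σ : Fin (p + 1) → Fin (m + 1), IntervalIntegrable (fun u => wt z.2 σ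
        * (X p).avg t u (jumpGen 𝒮.target
          (𝒮.rate (p + 1) fun _ => 0) (W p) u) (z.1, σ)) volume t s := fun σ => by
      refine ContinuousOn.intervalIntegrable (ContinuousOn.mono (continuousOn_const.mul
        ((X p).continuousOn_avg ht (continuousOn_jumpGen (hrate p) (hWc p)) (z.1, σ)))
        ?_)
      rw [uIcc_of_le hts]
      exact Icc_subset_Icc h0t hsT
    simp only [expect, bernstein]
    rw [intervalIntegral.integral_finsetSum fun σ _ => hint σ, ← Finset.sum_add_distrib]
    refine Finset.sum_congr rfl fun σ _ => ?_
    rw [intervalIntegral.integral_const_mul, ← mul_add]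
    congr 1
    exact (X p).avg_eq_add_integral (hrate p) h0t hts hsT (hWc p) (z.1, σ)
  · filter_upwards [(tendsto_add_atTop_nat 1).eventually
      (h𝒮.eventually_abs_gen_sub_le hC hF hε)] with p hp u hu
    have hu' : u ∈ Icc 0 T := ⟨h0t.trans hu.1, hu.2⟩
    exact abs_bernstein_sub_le ((X p).abs_avg_sub_le h0t hu.1 hu.2 (hp u hu')) hz

/-- Expectations of Lipschitz functions converge as the number of particles grows: with the
Bernstein transform of the cost of `q` particles as test function, Dynkin's formula for `p`
particles shows that they are close to the value of this transform. -/
theorem exists_tendsto_expect (h𝒮 : 𝒮.Regular T κ C) (hκ : 0 ≤ κ) (hC : 0 ≤ C)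
    (X : ∀ p, ParticleTransitions 𝒮 T p) {t s : ℝ} (h0t : 0 ≤ t)
    (hts : t ≤ s) (hsT : s ≤ T) {z : Δ × Vec m} (hz : z.2 ∈ simplex m) {g : Δ × Vec m → ℝ}
    {κ' B : ℝ} (hB : 0 ≤ B) (hg : ∀ T, CostRegular T κ' B (fun _ _ => 0) g) :
    ∃ ℓ, Tendsto (fun p => (X p).expect t s g z) atTop (𝓝 ℓ) := by
  have hs0 : 0 ≤ s := h0t.trans hts
  have hT : 0 ≤ T := hs0.trans hsT
  set K := max κ κ'
  have hK : 0 ≤ K := hκ.trans (le_max_left _ _)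
  have h𝒮' : 𝒮.Regular s K C := h𝒮.mono hsT (le_max_left _ _)
  have hg' : CostRegular s K B (fun _ _ => 0) g := (hg s).mono (le_max_right _ _)
  set A := genBound m (Fintype.card R) s K C 0 B with hA
  have hA0 : 0 ≤ A := genBound_nonneg le_rfl hB hK
  have key : ∀ ε > 0, ∃ b, ∀ᶠ p in atTop, |(X p).expect t s g z - b| ≤ ε := by
    intro ε hε
    have h0 : Tendsto (fun q : ℕ => (5 * K + T * A) / √((q + 1 : ℕ) : ℝ)) atTop (𝓝 0) :=
      Tendsto.div_atTop tendsto_const_nhds (Real.tendsto_sqrt_atTop.comp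
        (tendsto_natCast_atTop_atTop.comp (tendsto_add_atTop_nat 1)))
    obtain ⟨q, hq⟩ := (h0.eventually_lt_const (by positivity : 0 < ε / 3)).exists
    obtain ⟨v, hv⟩ := exists_particleCost (N := q + 1) (n := q + 1) h𝒮' (isWeight_zero q.succ_pos)
      hg' hs0
    have hF := bernstein_mem_timeSpaceC1 hv.contDiff
    obtain ⟨I, hIc, hI, hIε⟩ := expect_eq_add_integral h𝒮 hC hF X h0t hts hsT hz
    refine ⟨bernstein (v t) z, ?_⟩
    have hδ : 0 < ε / (3 * (T + 1)) := by positivity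
    have hinit := tendsto_bernstein_succ (Δ := Δ) (h := bernstein (v t)) hz
      (contDiff_bernstein (v t) z.1).continuous.continuousOn
    filter_upwards [hIε _ hδ, (Metric.tendsto_nhds.1 hinit) (ε / 3) (by positivity)] with p hp1 hp2
    rw [Real.dist_eq] at hp2
    have h1 := (X p).abs_expect_sub_le h0t hts hsT (h := g) (h' := bernstein (v s))
      (b := 5 * K / √((q + 1 : ℕ) : ℝ)) (fun d x hx => by
        rw [abs_sub_comm]
        exact hv.abs_bernstein_terminal_sub_le (isWeight_zero q.succ_pos) hg' hK d hx) hz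
    have h2 : |∫ u in t..s, I p u| ≤ T * (ε / (3 * (T + 1)) + A / √((q + 1 : ℕ) : ℝ)) := by
      have h5 := intervalIntegral.norm_integral_le_of_norm_le_const (a := t) (b := s)
        (f := I p) (C := ε / (3 * (T + 1)) + A / √((q + 1 : ℕ) : ℝ)) fun u hu => by
          rw [uIoc_of_le hts] at hu
          have h6 := hp1 u ⟨hu.1.le, hu.2.trans hsT⟩
          have h7 := (X p).abs_expect_le h0t hu.1.le (hu.2.trans hsT)
            (h := 𝒮.gen (fun t => bernstein (v t)) u) (fun d x hx => by
              have := hv.abs_gen_bernstein_add_le h𝒮' (isWeight_zero q.succ_pos) hg' le_rfl hB hK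
                hC ⟨h0t.trans hu.1.le, hu.2⟩ d hx
              simp only [add_zero] at this
              exact this) hz
          rw [Real.norm_eq_abs]
          have h8 := abs_sub_abs_le_abs_sub (I p u)
            ((X p).expect t u (𝒮.gen (fun t => bernstein (v t)) u) z)
          linarith
      refine h5.trans ?_
      rw [mul_comm, abs_of_nonneg (sub_nonneg.2 hts)]
      gcongr
      linarith
    have h3 : T * (ε / (3 * (T + 1))) ≤ ε / 3 := by
      rw [mul_div_assoc', div_le_div_iff₀ (by positivity) (by positivity)]
      nlinarith
    rw [add_div, mul_div_assoc T] at hq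
    rw [mul_add] at h2
    have h4 : (X p).expect t s g z - bernstein (v t) z
        = ((X p).expect t s g z - (X p).expect t s (bernstein (v s)) z)
        + (bernstein (fun c : Config Δ m (p + 1) =>
          bernstein (v t) (c.1, emp (p + 1) (fun _ => 0) c)) z - bernstein (v t) z)
        + ∫ u in t..s, I p u := by
      rw [hI p]
      ring
    rw [h4]
    refine (abs_add_three _ _ _).trans ?_
    linarith
  refine cauchySeq_tendsto_of_complete (Metric.cauchySeq_iff'.2 fun ε hε => ?_)
  obtain ⟨b, hb⟩ := key (ε / 3) (by positivity)
  obtain ⟨p₀, hp₀⟩ := eventually_atTop.1 hb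
  refine ⟨p₀, fun p hp => ?_⟩
  have h1 := hp₀ p hp
  have h2 := hp₀ p₀ le_rfl
  rw [Real.dist_eq]
  have h3 := abs_sub_le ((X p).expect t s g z) b ((X p₀).expect t s g z)
  rw [abs_sub_comm b] at h3
  linarith

variable [MeasurableSpace Δ] [DiscreteMeasurableSpace Δ]

/-- The transition probabilities of the mean field process, as limits of those of particle systems
that start with independent particles. -/
theorem exists_limit_kernel (h𝒮 : 𝒮.Regular T κ C) (hκ : 0 ≤ κ) (hC : 0 ≤ C)
    (X : ∀ p, ParticleTransitions 𝒮 T p) {t s : ℝ} (h0t : 0 ≤ t) (hts : t ≤ s) (hsT : s ≤ T) :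
    ∃ K : Kernel (meanFieldSpace Δ m) (meanFieldSpace Δ m), IsMarkovKernel K ∧
      ∀ h : Δ × Vec m → ℝ, (∀ d, ContinuousOn (fun x => h (d, x)) (simplex m)) →
        ∀ z : meanFieldSpace Δ m, Tendsto (fun p => (X p).expect t s h z) atTop
          (𝓝 (∫ y : meanFieldSpace Δ m, h y ∂(K z))) := by
  have hμ : ∀ (z : meanFieldSpace Δ m) (p : ℕ), ∃ μ : Measure (meanFieldSpace Δ m),
      IsProbabilityMeasure μ ∧ ∀ h : Δ × Vec m → ℝ, ∫ y : meanFieldSpace Δ m, h y ∂μ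
        = (X p).expect t s h z := by
    intro z p
    obtain ⟨μ, hμ, hμ'⟩ := exists_measure_of_weights
      (a := fun e : (Fin (p + 1) → Fin (m + 1)) × Config Δ m (p + 1) =>
        wt z.1.2 e.1 * (X p).mat t s (z.1.1, e.1) e.2)
      (fun e => mul_nonneg (wt_nonneg z.2 _) ((X p).nonneg t s h0t hts hsT _ _)) (by
        rw [Fintype.sum_prod_type]
        simp only [← Finset.mul_sum, (X p).row_sum t s h0t hts hsT, mul_one, sum_wt])
      (fun e => (⟨(e.2.1, emp (p + 1) (fun _ => 0) e.2),
        (isWeight_zero p.succ_pos).mem e.2⟩ : meanFieldSpace Δ m))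
    refine ⟨μ, hμ, fun h => ?_⟩
    rw [hμ' fun y => h y, Fintype.sum_prod_type]
    simp only [expect, bernstein, TransitionMatrices.avg, Finset.mul_sum, mul_assoc]
  choose μ hμp hμ using hμ
  have hν : ∀ z : meanFieldSpace Δ m, ∃ ν : Measure (meanFieldSpace Δ m), IsProbabilityMeasure ν ∧
      ∀ h : Δ × Vec m → ℝ, (∀ d, ContinuousOn (fun x => h (d, x)) (simplex m)) →
        Tendsto (fun p => (X p).expect t s h z) atTop
          (𝓝 (∫ y : meanFieldSpace Δ m, h y ∂ν)) := by
    intro z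
    have := hμp z
    obtain ⟨ν, hν, hν'⟩ := exists_weak_limit (μ := μ z) fun g κ' B _ hB hg => by
      simp only [hμ]
      exact exists_tendsto_expect h𝒮 hκ hC X h0t hts hsT z.2 hB hg
    simp only [hμ] at hν'
    exact ⟨ν, hν, hν'⟩
  choose ν hνp hν using hν
  have hmeas : Measurable ν := measurable_of_fiberwise fun h hh => by
    refine measurable_of_tendsto_metrizable (f := fun p (z : meanFieldSpace Δ m) => (X p).expect t s h z) (fun p => ?_)
      (tendsto_pi_nhds.2 fun z => hν z h hh)
    exact measurable_of_continuousOn fun d => (contDiff_bernstein _ d).continuous.continuousOn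
  exact ⟨⟨ν, hmeas⟩, ⟨hνp⟩, fun h hh z => hν z h hh⟩

end ParticleTransitions

end MeanFieldLaw

section MeanFieldLaw

variable {m : ℕ} {Δ R : Type*} [Fintype R] [Fintype Δ] [MeasurableSpace Δ]
  {𝒮 : ParticleRates m Δ R} {T κ C : ℝ}

/-- Dynkin's formula passes to the limit. -/
theorem ParticleTransitions.generator_of_tendsto [DecidableEq Δ] (h𝒮 : 𝒮.Regular T κ C) (hC : 0 ≤ C)
    (X : ∀ p, ParticleTransitions 𝒮 T p)
    {K : ℝ → ℝ → Kernel (meanFieldSpace Δ m) (meanFieldSpace Δ m)}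
    (hK : ∀ t s, 0 ≤ t → t ≤ s → s ≤ T → ∀ h : Δ × Vec m → ℝ,
      (∀ d, ContinuousOn (fun x => h (d, x)) (simplex m)) → ∀ z : meanFieldSpace Δ m,
        Tendsto (fun p => (X p).expect t s h z) atTop (𝓝 (∫ y : meanFieldSpace Δ m, h y ∂(K t s z))))
    {F : ℝ → Δ × Vec m → ℝ} (hF : F ∈ timeSpaceC1 Δ m) {t s : ℝ} (h0t : 0 ≤ t) (hts : t ≤ s)
    (hsT : s ≤ T) (z : meanFieldSpace Δ m) :
    IntervalIntegrable (fun u => ∫ y : meanFieldSpace Δ m, 𝒮.gen F u y ∂(K t u z)) volume t s ∧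
    ∫ y : meanFieldSpace Δ m, F s y ∂(K t s z)
      = F t z + ∫ u in t..s, ∫ y : meanFieldSpace Δ m, 𝒮.gen F u y ∂(K t u z) := by
  have hFc : ∀ u d, ContinuousOn (fun x => F u (d, x)) (simplex m) := fun u d =>
    ((hF d).comp (contDiff_prodMk_right u)).continuous.continuousOn
  obtain ⟨M, hM0, hM⟩ := h𝒮.exists_gen_bound hF
  obtain ⟨I, hIc, hI, hIε⟩ := expect_eq_add_integral h𝒮 hC hF X h0t hts hsT z.2
  have hlim : ∀ u ∈ Ioc t s, Tendsto (fun p => I p u) atTop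
      (𝓝 (∫ y : meanFieldSpace Δ m, 𝒮.gen F u y ∂(K t u z))) := by
    intro u hu
    have hu' : u ∈ Icc t T := ⟨hu.1.le, hu.2.trans hsT⟩
    have h1 := hK t u h0t hu'.1 hu'.2 (𝒮.gen F u) (fun d =>
      (h𝒮.continuousOn_gen hF d).comp (f := fun x => (u, x)) (by fun_prop)
        fun _ hx => ⟨⟨h0t.trans hu'.1, hu'.2⟩, hx⟩) z
    have h2 : Tendsto (fun p => I p u - (X p).expect t u (𝒮.gen F u) z) atTop (𝓝 0) := by
      refine Metric.tendsto_nhds.2 fun ε hε => ?_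
      filter_upwards [hIε (ε / 2) (by positivity)] with p hp
      rw [Real.dist_eq, sub_zero]
      linarith [hp u hu']
    simpa using h2.add h1
  have hbound : ∀ᶠ p in atTop, ∀ u ∈ Ioc t s, |I p u| ≤ M + 1 := by
    filter_upwards [hIε 1 one_pos] with p hp u hu
    have hu' : u ∈ Icc t T := ⟨hu.1.le, hu.2.trans hsT⟩
    have h1 := (X p).abs_expect_le h0t hu'.1 hu'.2 (h := 𝒮.gen F u)
      (fun d x hx => hM u ⟨h0t.trans hu'.1, hu'.2⟩ d x hx) z.2
    have h2 := hp u hu'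
    have h3 := abs_sub_abs_le_abs_sub (I p u) ((X p).expect t u (𝒮.gen F u) z)
    linarith
  have hmeas : ∀ p, AEStronglyMeasurable (I p) (volume.restrict (uIoc t s)) := fun p => by
    rw [uIoc_of_le hts]
    exact ((hIc p).mono (Ioc_subset_Icc_self.trans (Icc_subset_Icc h0t hsT))).aestronglyMeasurable
      measurableSet_Ioc
  have hint : IntervalIntegrable (fun u => ∫ y : meanFieldSpace Δ m, 𝒮.gen F u y ∂(K t u z))
      volume t s := by
    rw [intervalIntegrable_iff_integrableOn_Ioc_of_le hts]
    refine Integrable.of_bound (aestronglyMeasurable_of_tendsto_ae atTop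
      (fun p => by simpa only [uIoc_of_le hts] using hmeas p)
      ((ae_restrict_iff' measurableSet_Ioc).2 (ae_of_all _ hlim))) (M + 1)
      ((ae_restrict_iff' measurableSet_Ioc).2 (ae_of_all _ fun u hu => ?_))
    refine le_of_tendsto (hlim u hu).norm ?_
    filter_upwards [hbound] with p hp using hp u hu
  refine ⟨hint, ?_⟩
  have h1 := hK t s h0t hts hsT (F s) (hFc s) z
  simp only [hI] at h1
  refine tendsto_nhds_unique h1 ((tendsto_bernstein_succ z.2 (hFc t z.1.1)).add ?_)
  refine intervalIntegral.tendsto_integral_filter_of_dominated_convergence (fun _ => M + 1)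
    (Eventually.of_forall hmeas) ?_ intervalIntegrable_const ?_
  · filter_upwards [hbound] with p hp
    refine ae_of_all _ fun u hu => hp u ?_
    rwa [uIoc_of_le hts] at hu
  · refine ae_of_all _ fun u hu => hlim u ?_
    rwa [uIoc_of_le hts] at hu

variable [DiscreteMeasurableSpace Δ]

/-- Mean field processes exist: they are the limits of particle systems. The Chapman-Kolmogorov
equation does not follow from the limit alone, since particles started independently do not stay
independent; it holds because, for every terminal condition, some Bernstein transform is a
martingale up to an arbitrarily small error. -/
theorem ParticleRates.Regular.nonempty_markovLaw (h𝒮 : 𝒮.Regular T κ C) (hκ : 0 ≤ κ)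
    (hC : 0 ≤ C) (hT : 0 ≤ T) :
    Nonempty (MarkovLaw T (meanFieldSpace Δ m) (timeSpaceC1 Δ m) 𝒮.gen) := by
  classical
  have hX : ∀ p, Nonempty (ParticleTransitions 𝒮 T p) := fun p =>
    exists_transitionMatrices _ hT (h𝒮.continuousOn_rate (isWeight_zero p.succ_pos))
      fun t ht => h𝒮.rate_nonneg (isWeight_zero p.succ_pos) ht
  have X := fun p => (hX p).some
  have hker : ∀ t s, ∃ K : Kernel (meanFieldSpace Δ m) (meanFieldSpace Δ m),
      0 ≤ t → t ≤ s → s ≤ T → IsMarkovKernel K ∧ ∀ h : Δ × Vec m → ℝ,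
      (∀ d, ContinuousOn (fun x => h (d, x)) (simplex m)) → ∀ z : meanFieldSpace Δ m,
        Tendsto (fun p => (X p).expect t s h z) atTop (𝓝 (∫ y : meanFieldSpace Δ m, h y ∂(K z))) := by
    intro t s
    by_cases h : 0 ≤ t ∧ t ≤ s ∧ s ≤ T
    · obtain ⟨K, h1, h2⟩ := ParticleTransitions.exists_limit_kernel h𝒮 hκ hC X h.1 h.2.1 h.2.2
      exact ⟨K, fun _ _ _ => ⟨h1, h2⟩⟩
    · exact ⟨Kernel.id, fun h1 h2 h3 => absurd ⟨h1, h2, h3⟩ h⟩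
  choose K hK using hker
  have hmarkov : ∀ t s, 0 ≤ t → t ≤ s → s ≤ T → IsMarkovKernel (K t s) :=
    fun t s h1 h2 h3 => (hK t s h1 h2 h3).1
  have hlim := fun t s h1 h2 h3 => (hK t s h1 h2 h3).2
  have hprob : ∀ t s, 0 ≤ t → t ≤ s → s ≤ T → ∀ z, IsProbabilityMeasure (K t s z) :=
    fun t s h1 h2 h3 z => by
      have := hmarkov t s h1 h2 h3
      infer_instance
  have hgen : ∀ F ∈ timeSpaceC1 Δ m, ∀ t s, 0 ≤ t → t ≤ s → s ≤ T → ∀ z : meanFieldSpace Δ m, _ :=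
    fun F hF t s h1 h2 h3 z =>
      ParticleTransitions.generator_of_tendsto h𝒮 hC X hlim hF h1 h2 h3 z
  refine ⟨⟨K, hmarkov, fun t h0t htT => ?_, fun t s u h0t hts hsu huT => ?_, hgen⟩⟩
  · ext1 z
    have := hprob t t h0t le_rfl htT z
    rw [Kernel.id_apply]
    refine measure_eq_of_integral_eq fun g κ' B _ _ hg => ?_
    have hgc := fun d => (hg T).continuousOn_g d
    rw [integral_dirac' (fun y : meanFieldSpace Δ m => g y) z
      (measurable_of_continuousOn hgc).stronglyMeasurable]
    refine tendsto_nhds_unique (hlim t t h0t le_rfl htT g hgc z) ?_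
    refine (tendsto_bernstein_succ z.2 (hgc z.1.1)).congr fun p => ?_
    rw [ParticleTransitions.expect, (X p).avg_self ⟨h0t, htT⟩]
  · have hm1 := hmarkov t s h0t hts (hsu.trans huT)
    have hm2 := hmarkov s u (h0t.trans hts) hsu huT
    have hm3 := hmarkov t u h0t (hts.trans hsu) huT
    ext1 z
    refine measure_eq_of_integral_eq fun g κ' B hκ' hB hg => ?_
    have hgc := fun d => (hg T).continuousOn_g d
    rw [Kernel.integral_comp (integrable_of_continuousOn hgc _)]
    have hu0 : 0 ≤ u := (h0t.trans hts).trans hsu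
    set κ'' := max κ κ'
    have hκ'' : 0 ≤ κ'' := hκ.trans (le_max_left _ _)
    have h𝒮' : 𝒮.Regular u κ'' C := h𝒮.mono huT (le_max_left _ _)
    have hg' : CostRegular u κ'' B (fun _ _ => 0) g := (hg u).mono (le_max_right _ _)
    set A := genBound m (Fintype.card R) u κ'' C 0 B with hA
    have hA0 : 0 ≤ A := genBound_nonneg le_rfl hB hκ''
    have hlim0 : Tendsto (fun q : ℕ => (3 * (T * A + 5 * κ'')) / √((q + 1 : ℕ) : ℝ)) atTop (𝓝 0) :=
      Tendsto.div_atTop tendsto_const_nhds (Real.tendsto_sqrt_atTop.comp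
        (tendsto_natCast_atTop_atTop.comp (tendsto_add_atTop_nat 1)))
    rw [← sub_eq_zero, ← abs_eq_zero]
    refine le_antisymm (ge_of_tendsto' hlim0 fun q => ?_) (abs_nonneg _)
    obtain ⟨v, hv⟩ := exists_particleCost (N := q + 1) (n := q + 1) h𝒮' (isWeight_zero q.succ_pos)
      hg' hu0
    have hF := bernstein_mem_timeSpaceC1 hv.contDiff
    have hvc : ∀ r d, ContinuousOn (fun x => bernstein (v r) (d, x)) (simplex m) := fun r d =>
      (contDiff_bernstein (v r) d).continuous.continuousOn
    set δ := √((q + 1 : ℕ) : ℝ)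
    -- the Bernstein transform is almost a martingale
    have hmart : ∀ r r', 0 ≤ r → r ≤ r' → r' ≤ u → ∀ y : meanFieldSpace Δ m,
        |∫ x : meanFieldSpace Δ m, bernstein (v r') x ∂(K r r' y) - bernstein (v r) y|
          ≤ T * A / δ := by
      intro r r' h0r hrr' hr'u y
      obtain ⟨-, h1⟩ := hgen _ hF r r' h0r hrr' (hr'u.trans huT) y
      rw [h1, add_sub_cancel_left]
      have h5 := intervalIntegral.norm_integral_le_of_norm_le_const (a := r) (b := r')
        (f := fun w => ∫ x : meanFieldSpace Δ m, 𝒮.gen (fun t => bernstein (v t)) w x ∂(K r w y))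
        (C := A / δ) fun w hw => by
          rw [uIoc_of_le hrr'] at hw
          have := hprob r w h0r hw.1.le (hw.2.trans (hr'u.trans huT)) y
          have h6 := norm_integral_le_of_norm_le_const (μ := K r w y)
            (f := fun x : meanFieldSpace Δ m => 𝒮.gen (fun t => bernstein (v t)) w x) (C := A / δ)
            (ae_of_all _ fun x => by
              have := hv.abs_gen_bernstein_add_le h𝒮' (isWeight_zero q.succ_pos) hg' le_rfl hB hκ''
                hC ⟨h0r.trans hw.1.le, hw.2.trans hr'u⟩ x.1.1 x.2
              simp only [add_zero] at this
              exact this)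
          simpa using h6
      refine h5.trans ?_
      rw [mul_comm, abs_of_nonneg (sub_nonneg.2 hrr'), mul_div_assoc]
      gcongr
      linarith
    have hterm : ∀ r, 0 ≤ r → r ≤ u → ∀ y : meanFieldSpace Δ m,
        |∫ x : meanFieldSpace Δ m, g x ∂(K r u y) - bernstein (v r) y| ≤ (T * A + 5 * κ'') / δ := by
      intro r h0r hru y
      have := hprob r u h0r hru huT y
      have h1 : |∫ x : meanFieldSpace Δ m, g x ∂(K r u y)
          - ∫ x : meanFieldSpace Δ m, bernstein (v u) x ∂(K r u y)| ≤ 5 * κ'' / δ := by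
        rw [← integral_sub (integrable_of_continuousOn hgc _) (integrable_of_continuousOn (hvc u) _)]
        have h4 := norm_integral_le_of_norm_le_const (μ := K r u y)
          (f := fun x : meanFieldSpace Δ m => g x - bernstein (v u) x) (C := 5 * κ'' / δ)
          (ae_of_all _ fun x => by
            rw [Real.norm_eq_abs, abs_sub_comm]
            exact hv.abs_bernstein_terminal_sub_le (isWeight_zero q.succ_pos) hg' hκ'' x.1.1 x.2)
        simpa using h4
      have h2 := hmart r u h0r hru le_rfl y
      have h3 := abs_sub_le (∫ x : meanFieldSpace Δ m, g x ∂(K r u y))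
        (∫ x : meanFieldSpace Δ m, bernstein (v u) x ∂(K r u y)) (bernstein (v r) y)
      rw [add_div]
      linarith
    have hs0 := h0t.trans hts
    have := hprob t s h0t hts (hsu.trans huT) z
    have h1 : |∫ y : meanFieldSpace Δ m, (∫ x : meanFieldSpace Δ m, g x ∂(K s u y)) ∂(K t s z)
        - ∫ y : meanFieldSpace Δ m, bernstein (v s) y ∂(K t s z)| ≤ (T * A + 5 * κ'') / δ := by
      rw [← integral_sub (Integrable.integral_comp (integrable_of_continuousOn hgc _))
        (integrable_of_continuousOn (hvc s) _)]
      have h4 := norm_integral_le_of_norm_le_const (μ := K t s z)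
        (f := fun y : meanFieldSpace Δ m =>
          (∫ x : meanFieldSpace Δ m, g x ∂(K s u y)) - bernstein (v s) y)
        (C := (T * A + 5 * κ'') / δ) (ae_of_all _ fun y => hterm s hs0 hsu y)
      simpa using h4
    have h2 := hmart t s h0t hts hsu z
    have h3 := hterm t h0t (hts.trans hsu) z
    rw [abs_le] at h1 h2 h3 ⊢
    have h4 : (3 * (T * A + 5 * κ'')) / δ = (T * A + 5 * κ'') / δ + (T * A + 5 * κ'') / δ
        + T * A / δ + 5 * κ'' / δ := by ring
    have h5 : 0 ≤ 5 * κ'' / δ := by positivity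
    constructor <;> linarith [h1.1, h1.2, h2.1, h2.2, h3.1, h3.2]

end MeanFieldLaw

/-! ### Markov laws on finite state spaces -/

section FiniteLaw

/-- Only the values of the generator on the state space matter for Markov laws. -/
def MarkovLaw.congr {E : Type*} [MeasurableSpace E] {T : ℝ} {S : Set E} {D : Set (ℝ → E → ℝ)}
    {𝒢 𝒢' : (ℝ → E → ℝ) → ℝ → E → ℝ} (P : MarkovLaw T S D 𝒢)
    (h : ∀ F ∈ D, ∀ t ∈ Icc 0 T, ∀ z ∈ S, 𝒢' F t z = 𝒢 F t z) : MarkovLaw T S D 𝒢' where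
  kernel := P.kernel
  isMarkov := P.isMarkov
  initial := P.initial
  chapmanKolmogorov := P.chapmanKolmogorov
  generator F hF t s h0t hts hsT z := by
    obtain ⟨h1, h2⟩ := P.generator F hF t s h0t hts hsT z
    have h3 : ∀ u ∈ uIcc t s, ∫ y : S, 𝒢' F u y ∂(P.kernel t u z)
        = ∫ y : S, 𝒢 F u y ∂(P.kernel t u z) := fun u hu => by
      rw [uIcc_of_le hts] at hu
      exact integral_congr_ae (ae_of_all _ fun y => h F hF u ⟨h0t.trans hu.1, hu.2.trans hsT⟩ y y.2)
    refine ⟨h1.congr fun u hu => (h3 u (uIoc_subset_uIcc hu)).symm, ?_⟩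
    rw [h2, intervalIntegral.integral_congr h3]

/-- The Feynman-Kac formula: the expected cost is the solution of the backward equation. -/
theorem MarkovLaw.cost_eq_of_backward {E : Type*} [MeasurableSpace E] {T : ℝ} {S : Set E}
    {D : Set (ℝ → E → ℝ)} {𝒢 : (ℝ → E → ℝ) → ℝ → E → ℝ} (P : MarkovLaw T S D 𝒢)
    {f F : ℝ → E → ℝ} {g : E → ℝ} (hF : F ∈ D) (hg : ∀ z ∈ S, F T z = g z)
    (hf : ∀ t ∈ Icc 0 T, ∀ z ∈ S, 𝒢 F t z = -f t z) {t : ℝ} (ht : t ∈ Icc 0 T) (z : S) :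
    P.cost f g t z = F t z := by
  obtain ⟨-, h⟩ := P.generator F hF t T ht.1 ht.2 le_rfl z
  have h1 : ∫ y : S, F T y ∂(P.kernel t T z) = ∫ y : S, g y ∂(P.kernel t T z) :=
    integral_congr_ae (ae_of_all _ fun y => hg y y.2)
  have h2 : ∫ u in t..T, ∫ y : S, 𝒢 F u y ∂(P.kernel t u z)
      = ∫ u in t..T, -∫ y : S, f u y ∂(P.kernel t u z) := by
    refine intervalIntegral.integral_congr fun u hu => ?_
    rw [uIcc_of_le ht.2] at hu
    rw [← integral_neg]
    exact integral_congr_ae (ae_of_all _ fun y => hf u ⟨ht.1.trans hu.1, hu.2⟩ y y.2)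
  rw [h1, h2, intervalIntegral.integral_neg] at h
  rw [MarkovLaw.cost, h]
  ring

variable {E Λ : Type*} [Fintype Λ] {T : ℝ} {S : Set E} {target : Λ → E → E} {rate : ℝ → Λ → E → ℝ}

open scoped Classical in
/-- The jump targets as maps of `S` to itself: jumps out of `S`, which have rate zero, are
suppressed. -/
def restrictTarget (S : Set E) (target : Λ → E → E) (e : Λ) (z : S) : S :=
  if h : target e z ∈ S then ⟨target e z, h⟩ else z

theorem jumpOp_restrictTarget {t : ℝ}
    (hout : ∀ e, ∀ z ∈ S, target e z ∉ S → rate t e z = 0) (F : E → ℝ) (z : S) :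
    jumpOp (restrictTarget S target) (fun e z => rate t e z) (fun z : S => F z) z
      = jumpOp target (rate t) F z := by
  refine Finset.sum_congr rfl fun e _ => ?_
  by_cases h : target e z ∈ S
  · simp [restrictTarget, h]
  · simp [hout e z z.2 h]

theorem exists_backward_solution_of_finite (hS : S.Finite) (hT : 0 ≤ T)
    (hrate : ∀ e, ∀ z ∈ S, ContinuousOn (fun t => rate t e z) (Icc 0 T))
    (hout : ∀ t ∈ Icc 0 T, ∀ e, ∀ z ∈ S, target e z ∉ S → rate t e z = 0) {f : ℝ → E → ℝ}
    (hf : ∀ z ∈ S, ContinuousOn (fun t => f t z) (Icc 0 T)) (g : E → ℝ) :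
    ∃ F ∈ timeC1 E, (∀ z ∈ S, F T z = g z) ∧
      ∀ t ∈ Icc 0 T, ∀ z ∈ S, jumpGen target rate F t z = -f t z := by
  classical
  have := hS.fintype
  obtain ⟨v, hvT, hv1, hv⟩ := exists_backward_solution (restrictTarget S target) hT
    (rate := fun t e z => rate t e z) (fun e z => hrate e z z.2) (f := fun t z => f t z)
    (fun z => hf z z.2) (fun z => g z)
  set F : ℝ → E → ℝ := fun t z => if hz : z ∈ S then v t ⟨z, hz⟩ else 0 with hF
  have hFv : ∀ t (z : S), F t z = v t z := fun t z => dif_pos z.2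
  refine ⟨F, fun z => ?_, fun z hz => ?_, fun t ht z hz => ?_⟩
  · by_cases hz : z ∈ S
    · simpa only [hF, dif_pos hz] using hv1 ⟨z, hz⟩
    · simpa only [hF, dif_neg hz] using contDiff_const
  · rw [hFv T ⟨z, hz⟩, hvT]
  · have h1 := jumpOp_restrictTarget (hout t ht) (F t) ⟨z, hz⟩
    have h2 : (fun s => F s z) = fun s => v s ⟨z, hz⟩ := funext fun s => hFv s ⟨z, hz⟩
    simp only [hFv] at h1
    rw [jumpGen, ← h1, h2, (hv t ht ⟨z, hz⟩).deriv]
    ring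

variable [MeasurableSpace E] [MeasurableSingletonClass E]

/-- Jump processes with finitely many states exist. -/
theorem nonempty_markovLaw_of_finite (hS : S.Finite) (hT : 0 ≤ T)
    (hrate : ∀ e, ∀ z ∈ S, ContinuousOn (fun t => rate t e z) (Icc 0 T))
    (h0 : ∀ t ∈ Icc 0 T, ∀ e, ∀ z ∈ S, 0 ≤ rate t e z)
    (hout : ∀ t ∈ Icc 0 T, ∀ e, ∀ z ∈ S, target e z ∉ S → rate t e z = 0) :
    Nonempty (MarkovLaw T S (timeC1 E) (jumpGen target rate)) := by
  classical
  have := hS.fintype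
  have hrate' : ∀ e (z : S), ContinuousOn (fun t => rate t e z) (Icc 0 T) := fun e z => hrate e z z.2
  obtain ⟨X⟩ := exists_transitionMatrices (restrictTarget S target) hT
    (rate := fun t e z => rate t e z) hrate' (fun t ht e z => h0 t ht e z z.2)
  have hker : ∀ t s, ∃ K : Kernel S S, 0 ≤ t → t ≤ s → s ≤ T → IsMarkovKernel K ∧
      ∀ (h : S → ℝ) (z : S), ∫ y, h y ∂(K z) = X.avg t s h z := by
    intro t s
    by_cases h : 0 ≤ t ∧ t ≤ s ∧ s ≤ T
    · choose μ hμ1 hμ2 using fun z : S => exists_measure_of_weights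
        (X.nonneg t s h.1 h.2.1 h.2.2 z) (X.row_sum t s h.1 h.2.1 h.2.2 z) (fun y : S => y)
      exact ⟨⟨μ, Measurable.of_discrete⟩, fun _ _ _ => ⟨⟨hμ1⟩, fun h z => hμ2 z h⟩⟩
    · exact ⟨Kernel.id, fun h1 h2 h3 => absurd ⟨h1, h2, h3⟩ h⟩
  choose K hK using hker
  have hext : ∀ (μ ν : Measure S) [IsProbabilityMeasure μ] [IsProbabilityMeasure ν],
      (∀ h : S → ℝ, ∫ y, h y ∂μ = ∫ y, h y ∂ν) → μ = ν := by
    intro μ ν _ _ h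
    ext s hs
    have h1 := h (s.indicator 1)
    rw [integral_indicator_one hs, integral_indicator_one hs] at h1
    exact (measureReal_eq_measureReal_iff).1 h1
  refine ⟨⟨K, fun t s h1 h2 h3 => (hK t s h1 h2 h3).1, fun t h1 h2 => ?_,
    fun t s u h0t hts hsu huT => ?_, fun F hF t s h0t hts hsT z => ?_⟩⟩
  · obtain ⟨h3, h4⟩ := hK t t h1 le_rfl h2
    ext1 z
    refine hext _ _ fun h => ?_
    rw [h4, X.avg_self ⟨h1, h2⟩, Kernel.id_apply, integral_dirac]
  · obtain ⟨h1, h1'⟩ := hK t s h0t hts (hsu.trans huT)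
    obtain ⟨h2, h2'⟩ := hK s u (h0t.trans hts) hsu huT
    obtain ⟨h3, h3'⟩ := hK t u h0t (hts.trans hsu) huT
    ext1 z
    refine hext _ _ fun h => ?_
    rw [Kernel.integral_comp .of_finite, h3']
    simp only [h2', h1']
    have hmul := X.mul t ⟨h0t, (hts.trans hsu).trans huT⟩ s ⟨h0t.trans hts, hsu.trans huT⟩ u
      ⟨(h0t.trans hts).trans hsu, huT⟩
    simp only [TransitionMatrices.avg, ← hmul, Matrix.mul_apply, Finset.mul_sum, Finset.sum_mul]
    rw [Finset.sum_comm]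
    exact Finset.sum_congr rfl fun i _ => Finset.sum_congr rfl fun j _ => by ring
  · have hFc : ∀ y : S, ContDiff ℝ 1 fun u => F u y := fun y => hF y
    have hgen : ∀ u ∈ uIcc t s, ∫ y : S, jumpGen target rate F u y ∂(K t u z)
        = X.avg t u (jumpGen (restrictTarget S target) (fun t e z => rate t e z)
          (fun t (z : S) => F t z) u) z := by
      intro u hu
      rw [uIcc_of_le hts] at hu
      rw [(hK t u h0t hu.1 (hu.2.trans hsT)).2 fun y => jumpGen target rate F u y]
      congr 1
      funext y
      rw [jumpGen, jumpGen, jumpOp_restrictTarget (hout u ⟨h0t.trans hu.1, hu.2.trans hsT⟩) (F u) y]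
    have hsub : uIcc t s ⊆ Icc 0 T := by
      rw [uIcc_of_le hts]
      exact Icc_subset_Icc h0t hsT
    have hint := ((X.continuousOn_avg ⟨h0t, hts.trans hsT⟩
      (continuousOn_jumpGen (target := restrictTarget S target) hrate' hFc) z).mono hsub).intervalIntegrable (μ := volume)
    refine ⟨hint.congr fun u hu => (hgen u (uIoc_subset_uIcc hu)).symm, ?_⟩
    rw [intervalIntegral.integral_congr hgen, (hK t s h0t hts hsT).2 fun y => F s y]
    exact X.avg_eq_add_integral hrate' h0t hts hsT hFc z

end FiniteLaw

/-! ### Games with finitely many players -/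

section GridGames

variable {m n : ℕ} {Δ R : Type*}

/-- Targets of the jumps of the environment and of the empirical distribution, if `w d` is the
contribution of the environment to the distribution. -/
def gridTarget (𝒮 : ParticleRates m Δ R) (N : ℕ) (w : Δ → Vec m) :
    R ⊕ Fin (m + 1) × Fin (m + 1) → Δ × Vec m → Δ × Vec m
  | .inl ρ, z => (𝒮.τ ρ z.1, z.2 + (1 / N : ℝ) • (w (𝒮.τ ρ z.1) - w z.1))
  | .inr (k, j), z => (z.1, z.2 + (1 / N : ℝ) • jump k j)

/-- Rates of the jumps of the environment and of the empirical distribution, if `ν d k` of the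
players in the state `k` belong to the environment. -/
def gridRate (𝒮 : ParticleRates m Δ R) (N : ℕ) (ν : Δ → Fin (m + 1) → ℝ) (t : ℝ) :
    R ⊕ Fin (m + 1) × Fin (m + 1) → Δ × Vec m → ℝ
  | .inl ρ, z => 𝒮.r t ρ z.1 z.2
  | .inr (k, j), z => (N * coord z.2 k - ν z.1 k) * 𝒮.q t k j z.1 z.2

theorem exists_eq_of_count_ne_zero {σ : Fin n → Fin (m + 1)} {a : Fin (m + 1)} (h : count σ a ≠ 0) :
    ∃ l, σ l = a := by
  by_contra! h'
  exact h (Finset.sum_eq_zero fun l _ => if_neg (h' l))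

theorem emp_change_environment (N : ℕ) (w : Δ → Vec m) (d d' : Δ) (σ : Fin n → Fin (m + 1)) :
    emp N w (d', σ) = emp N w (d, σ) + (1 / N : ℝ) • (w d' - w d) := by
  simp only [emp, ← smul_add]
  congr 1
  abel

theorem emp_eq_of_count_eq {N : ℕ} {w : Δ → Vec m} {d : Δ} {σ σ' : Fin n → Fin (m + 1)}
    (h : count σ = count σ') : emp N w (d, σ) = emp N w (d, σ') := by
  simp only [emp, sum_vertex_eq, h]

theorem continuousOn_gridRate {𝒮 : ParticleRates m Δ R} {T κ C : ℝ} (h𝒮 : 𝒮.Regular T κ C) (N : ℕ)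
    (ν : Δ → Fin (m + 1) → ℝ) (e : R ⊕ Fin (m + 1) × Fin (m + 1)) {z : Δ × Vec m}
    (hz : z.2 ∈ simplex m) : ContinuousOn (fun t => gridRate 𝒮 N ν t e z) (Icc 0 T) := by
  rcases e with ρ | ⟨k, j⟩
  · refine continuousOn_of_lip (κ := κ) fun t ht t' ht' => ?_
    simpa [gridRate] using h𝒮.r_lip t ht t' ht' ρ z.1 _ hz _ hz
  · refine continuousOn_const.mul (continuousOn_of_lip (κ := κ) fun t ht t' ht' => ?_)
    simpa using h𝒮.q_lip t ht t' ht' k j z.1 _ hz _ hz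

theorem CostRegular.continuousOn_time {T κ B : ℝ} {f : ℝ → Δ × Vec m → ℝ} {g : Δ × Vec m → ℝ}
    (hfg : CostRegular T κ B f g) {z : Δ × Vec m} (hz : z.2 ∈ simplex m) :
    ContinuousOn (fun t => f t z) (Icc 0 T) :=
  continuousOn_of_lip (κ := κ) fun t ht t' ht' => by
    simpa using hfg.f_lip t ht t' ht' z.1 _ hz _ hz

variable [Fintype R]

theorem jumpOp_grid (𝒮 : ParticleRates m Δ R) (N : ℕ) (w : Δ → Vec m) (ν : Δ → Fin (m + 1) → ℝ)
    (F : Δ × Vec m → ℝ) (t : ℝ) (z : Δ × Vec m) :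
    jumpOp (gridTarget 𝒮 N w) (gridRate 𝒮 N ν t) F z
      = ∑ ρ, 𝒮.r t ρ z.1 z.2
          * (F (𝒮.τ ρ z.1, z.2 + (1 / N : ℝ) • (w (𝒮.τ ρ z.1) - w z.1)) - F z)
        + ∑ k, ∑ j, (N * coord z.2 k - ν z.1 k) * 𝒮.q t k j z.1 z.2
          * (F (z.1, z.2 + (1 / N : ℝ) • jump k j) - F z) := by
  simp only [jumpOp, Fintype.sum_sum_type, Fintype.sum_prod_type, gridTarget, gridRate]

theorem jumpOp_particles (𝒮 : ParticleRates m Δ R) (N : ℕ) (w : Δ → Vec m) (F : Δ × Vec m → ℝ)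
    (t : ℝ) (c : Config Δ m n) :
    jumpOp 𝒮.target (𝒮.rate N w t) (fun c => F (c.1, emp N w c)) c
      = ∑ ρ, 𝒮.r t ρ c.1 (emp N w c)
          * (F (𝒮.τ ρ c.1, emp N w c + (1 / N : ℝ) • (w (𝒮.τ ρ c.1) - w c.1)) - F (c.1, emp N w c))
        + ∑ k, ∑ j, count c.2 k * 𝒮.q t k j c.1 (emp N w c)
          * (F (c.1, emp N w c + (1 / N : ℝ) • jump k j) - F (c.1, emp N w c)) := by
  have h := sum_eq_sum_count_mul c.2 fun k => ∑ j, 𝒮.q t k j c.1 (emp N w c)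
    * (F (c.1, emp N w c + (1 / N : ℝ) • jump k j) - F (c.1, emp N w c))
  simp only [Finset.mul_sum, ← mul_assoc] at h
  simp only [jumpOp, Fintype.sum_sum_type, Fintype.sum_prod_type, ParticleRates.target,
    ParticleRates.rate, emp_move, ← h]
  congr 1
  refine Finset.sum_congr rfl fun ρ _ => ?_
  rw [emp_change_environment N w c.1 (𝒮.τ ρ c.1) c.2]

/-- The state space of the empirical distribution of a particle system. -/
abbrev empSpace (Δ : Type*) (m n N : ℕ) (w : Δ → Vec m) : Set (Δ × Vec m) :=
  range fun c : Config Δ m n => (c.1, emp N w c)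

theorem mem_empSpace_change_environment {N : ℕ} {w : Δ → Vec m} (c : Config Δ m n) (d : Δ) :
    (d, emp N w c + (1 / N : ℝ) • (w d - w c.1)) ∈ empSpace Δ m n N w :=
  ⟨(d, c.2), by simp only [emp_change_environment N w c.1 d c.2]⟩

theorem mem_empSpace_move {N : ℕ} {w : Δ → Vec m} (c : Config Δ m n)
    {k : Fin (m + 1)} (hk : count c.2 k ≠ 0)
    (d : Δ) (hd : w d = w c.1) (j : Fin (m + 1)) :
    (d, emp N w c + (1 / N : ℝ) • jump k j) ∈ empSpace Δ m n N w := by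
  obtain ⟨l, rfl⟩ := exists_eq_of_count_ne_zero hk
  refine ⟨move (d, c.2) l j, Prod.ext rfl ?_⟩
  simp only [emp_move, emp_change_environment N w c.1 d c.2, hd, sub_self, smul_zero, add_zero]

/-- The jump process given by `target` and `rate` is the empirical distribution of the particle
system, up to an error that is controlled by the influence of a single particle. -/
structure IsGridModel [Fintype Δ] {Λ : Type*} [Fintype Λ] (𝒮 : ParticleRates m Δ R) (N n : ℕ)
    (w : Δ → Vec m) (T A : ℝ) (target : Λ → Δ × Vec m → Δ × Vec m)
    (rate : ℝ → Λ → Δ × Vec m → ℝ) : Prop where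
  continuousOn_rate : ∀ e, ∀ z ∈ empSpace Δ m n N w, ContinuousOn (fun t => rate t e z) (Icc 0 T)
  rate_nonneg : ∀ t ∈ Icc 0 T, ∀ e, ∀ z ∈ empSpace Δ m n N w, 0 ≤ rate t e z
  rate_eq_zero : ∀ t ∈ Icc 0 T, ∀ e, ∀ z ∈ empSpace Δ m n N w,
    target e z ∉ empSpace Δ m n N w → rate t e z = 0
  jumpOp_sub_le : ∀ t ∈ Icc 0 T, ∀ (F : Δ × Vec m → ℝ) (c : Config Δ m n),
    |jumpOp 𝒮.target (𝒮.rate N w t) (fun c => F (c.1, emp N w c)) c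
      - jumpOp target (rate t) F (c.1, emp N w c)|
      ≤ A * ‖diffs fun c : Config Δ m n => F (c.1, emp N w c)‖

variable [Fintype Δ] {𝒮 : ParticleRates m Δ R} {N : ℕ} {w : Δ → Vec m} {T κ C A B : ℝ}
  {S : Set (Δ × Vec m)}

/-- If the rates count the particles, the model is exact. -/
theorem isGridModel_of_count (h𝒮 : 𝒮.Regular T κ C) (hw : IsWeight N n w)
    {ν : Δ → Fin (m + 1) → ℝ}
    (hν : ∀ (c : Config Δ m n) k, N * coord (emp N w c) k - ν c.1 k = count c.2 k) :
    IsGridModel 𝒮 N n w T 0 (gridTarget 𝒮 N w) (gridRate 𝒮 N ν) where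
  continuousOn_rate := by
    rintro e _ ⟨c, rfl⟩
    exact continuousOn_gridRate h𝒮 N ν e (hw.mem c)
  rate_nonneg := by
    rintro t ht (ρ | ⟨k, j⟩) _ ⟨c, rfl⟩
    · exact h𝒮.r_nonneg t ht ρ _ _ (hw.mem c)
    · simp only [gridRate, hν]
      exact mul_nonneg (Nat.cast_nonneg _) (h𝒮.q_nonneg t ht k j _ _ (hw.mem c))
  rate_eq_zero := by
    rintro t - (ρ | ⟨k, j⟩) _ ⟨c, rfl⟩ hout
    · exact absurd (mem_empSpace_change_environment c (𝒮.τ ρ c.1)) hout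
    · simp only [gridRate, hν]
      by_cases hk : count c.2 k = 0
      · rw [hk, Nat.cast_zero, zero_mul]
      · exact absurd (mem_empSpace_move c hk c.1 rfl j) hout
  jumpOp_sub_le t _ F c := by
    rw [jumpOp_particles, jumpOp_grid]
    simp [hν]

/-- Suppose that all `N` players are particles, and that the environment also records the state `μ
d` of one of them, who jumps at different rates. When he jumps, the distribution moves in the game
with the targets `gridTarget`, but not in the particle system, where in turn all `N` particles jump
at the rates of the others. Both differences concern a single player, so they are an error term. If
nobody can leave an extinct state, the rates are meaningful even if nobody is in the state `μ d`. -/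
theorem isGridModel_of_extinction (h𝒮 : 𝒮.Regular T κ C) (hC : 0 ≤ C) (hN : 0 < N)
    (μ : Δ → Fin (m + 1))
    (hr : ∀ t ∈ Icc 0 T, ∀ ρ d, ∀ x ∈ simplex m, μ (𝒮.τ ρ d) ≠ μ d → 𝒮.r t ρ d x ≤ C)
    (hr0 : ∀ t ∈ Icc 0 T, ∀ ρ d, ∀ x ∈ simplex m, μ (𝒮.τ ρ d) ≠ μ d → coord x (μ d) = 0 →
      𝒮.r t ρ d x = 0)
    (hq0 : ∀ t ∈ Icc 0 T, ∀ i j d, ∀ x ∈ simplex m, coord x i = 0 → 𝒮.q t i j d x = 0) :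
    IsGridModel 𝒮 N N (fun _ => 0) T ((Fintype.card R + (m + 1)) * C)
      (gridTarget 𝒮 N fun d => vertex (μ d))
      (gridRate 𝒮 N fun d k => if k = μ d then 1 else 0) := by
  have hw := isWeight_zero (m := m) (Δ := Δ) hN
  have hcoord : ∀ (c : Config Δ m N) k, count c.2 k = 0 → coord (emp N (fun _ => 0) c) k = 0 := by
    intro c k hk
    have h := coord_emp_zero hN c k
    rw [hk, Nat.cast_zero] at h
    exact (mul_eq_zero.1 h).resolve_left (by positivity)
  refine ⟨?_, ?_, ?_, fun t ht F c => ?_⟩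
  · rintro e _ ⟨c, rfl⟩
    exact continuousOn_gridRate h𝒮 N _ e (hw.mem c)
  · rintro t ht (ρ | ⟨k, j⟩) _ ⟨c, rfl⟩
    · exact h𝒮.r_nonneg t ht ρ _ _ (hw.mem c)
    · simp only [gridRate, coord_emp_zero hN c]
      by_cases hk : count c.2 k = 0
      · rw [hq0 t ht k j _ _ (hw.mem c) (hcoord c k hk), mul_zero]
      · refine mul_nonneg ?_ (h𝒮.q_nonneg t ht k j _ _ (hw.mem c))
        have : (1 : ℝ) ≤ count c.2 k := by exact_mod_cast Nat.one_le_iff_ne_zero.2 hk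
        split_ifs <;> linarith
  · rintro t ht (ρ | ⟨k, j⟩) _ ⟨c, rfl⟩ hout
    · by_cases hμ : μ (𝒮.τ ρ c.1) = μ c.1
      · refine absurd ?_ hout
        simpa [gridTarget, hμ] using mem_empSpace_change_environment (N := N) (w := fun _ => 0) c
          (𝒮.τ ρ c.1)
      · by_cases hk : count c.2 (μ c.1) = 0
        · exact hr0 t ht ρ _ _ (hw.mem c) hμ (hcoord c _ hk)
        · exact absurd (mem_empSpace_move c hk (𝒮.τ ρ c.1) rfl (μ (𝒮.τ ρ c.1))) hout
    · by_cases hk : count c.2 k = 0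
      · simp only [gridRate, hq0 t ht k j _ _ (hw.mem c) (hcoord c k hk), mul_zero]
      · exact absurd (mem_empSpace_move c hk c.1 rfl j) hout
  · set x := emp N (fun _ => 0) c with hx
    have hxm : x ∈ simplex m := hw.mem c
    set D := ‖diffs fun c : Config Δ m N => F (c.1, emp N (fun _ => 0) c)‖ with hD
    have hdiff : ∀ d j, count c.2 (μ c.1) ≠ 0 →
        |F (d, x + (1 / N : ℝ) • jump (μ c.1) j) - F (d, x)| ≤ D := by
      intro d j hk
      obtain ⟨l, hl⟩ := exists_eq_of_count_ne_zero hk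
      have h := abs_diff_le (fun c : Config Δ m N => F (c.1, emp N (fun _ => 0) c)) (d, c.2) l j
      simp only [emp_move, hl] at h
      exact h
    have hkey : jumpOp 𝒮.target (𝒮.rate N (fun _ => 0) t)
          (fun c => F (c.1, emp N (fun _ => 0) c)) c
        - jumpOp (gridTarget 𝒮 N fun d => vertex (μ d))
          (gridRate 𝒮 N (fun d k => if k = μ d then 1 else 0) t) F (c.1, x)
        = -∑ ρ, 𝒮.r t ρ c.1 x * (F (𝒮.τ ρ c.1, x + (1 / N : ℝ) • jump (μ c.1) (μ (𝒮.τ ρ c.1)))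
            - F (𝒮.τ ρ c.1, x))
          + ∑ j, 𝒮.q t (μ c.1) j c.1 x
            * (F (c.1, x + (1 / N : ℝ) • jump (μ c.1) j) - F (c.1, x)) := by
      rw [jumpOp_particles, jumpOp_grid]
      have hcx : ∀ k, N * coord x k = count c.2 k := coord_emp_zero hN c
      simp only [hcx, sub_self, smul_zero, add_zero, ← hx, sub_mul, ite_mul, one_mul,
        zero_mul, Finset.sum_sub_distrib]
      have h1 : ∀ G : Fin (m + 1) → Fin (m + 1) → ℝ,
          ∑ k, ∑ j, (if k = μ c.1 then G k j else 0) = ∑ j, G (μ c.1) j := fun G => by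
        rw [Finset.sum_comm]
        simp
      rw [h1]
      simp only [jump, mul_sub, Finset.sum_sub_distrib]
      ring
    rw [hkey]
    have e1 : |∑ ρ, 𝒮.r t ρ c.1 x * (F (𝒮.τ ρ c.1, x + (1 / N : ℝ) • jump (μ c.1) (μ (𝒮.τ ρ c.1)))
            - F (𝒮.τ ρ c.1, x))| ≤ Fintype.card R * (C * D) := by
      refine (Finset.abs_sum_le_sum_abs _ _).trans ?_
      refine (Finset.sum_le_card_nsmul _ _ (C * D) fun ρ _ => ?_).trans_eq (by simp)
      rw [abs_mul, abs_of_nonneg (h𝒮.r_nonneg t ht ρ _ _ hxm)]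
      by_cases hμ : μ (𝒮.τ ρ c.1) = μ c.1
      · rw [hμ, jump, sub_self, smul_zero, add_zero, sub_self, abs_zero, mul_zero]
        positivity
      · by_cases hk : count c.2 (μ c.1) = 0
        · rw [hr0 t ht ρ _ _ hxm hμ (hcoord c _ hk), zero_mul]
          positivity
        · gcongr
          exacts [hr t ht ρ _ _ hxm hμ, hdiff _ _ hk]
    have e2 : |∑ j, 𝒮.q t (μ c.1) j c.1 x
            * (F (c.1, x + (1 / N : ℝ) • jump (μ c.1) j) - F (c.1, x))| ≤ (m + 1) * (C * D) := by
      refine (Finset.abs_sum_le_sum_abs _ _).trans ?_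
      refine (Finset.sum_le_card_nsmul _ _ (C * D) fun j _ => ?_).trans_eq (by simp)
      rw [abs_mul, abs_of_nonneg (h𝒮.q_nonneg t ht _ _ _ _ hxm)]
      by_cases hk : count c.2 (μ c.1) = 0
      · rw [hq0 t ht _ j _ _ hxm (hcoord c _ hk), zero_mul]
        positivity
      · gcongr
        exacts [h𝒮.q_le t ht _ _ _ _ hxm, hdiff _ _ hk]
    refine (abs_add_le _ _).trans ?_
    rw [abs_neg]
    linarith

namespace IsGridModel

variable {Λ : Type*} [Fintype Λ] {target : Λ → Δ × Vec m → Δ × Vec m}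
    {rate : ℝ → Λ → Δ × Vec m → ℝ}

variable [MeasurableSpace Δ] [DiscreteMeasurableSpace Δ]

theorem nonempty_markovLaw (hM : IsGridModel 𝒮 N n w T A target rate) (hT : 0 ≤ T)
    (hS : S = empSpace Δ m n N w) : Nonempty (MarkovLaw T S (timeC1 _) (jumpGen target rate)) := by
  subst hS
  exact nonempty_markovLaw_of_finite (finite_range _) hT hM.continuousOn_rate hM.rate_nonneg
    hM.rate_eq_zero

theorem abs_cost_sub_le (hM : IsGridModel 𝒮 N n w T A target rate) (h𝒮 : 𝒮.Regular T κ C)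
    (hw : IsWeight N n w) (hS : S = empSpace Δ m n N w)
    {f : ℝ → Δ × Vec m → ℝ} {g : Δ × Vec m → ℝ} (hfg : CostRegular T κ B f g) (hA : 0 ≤ A)
    (hB : 0 ≤ B) (hκ : 0 ≤ κ) (hC : 0 ≤ C) {𝒢N 𝒢 : (ℝ → Δ × Vec m → ℝ) → ℝ → Δ × Vec m → ℝ}
    (h𝒢N : ∀ F ∈ timeC1 (Δ × Vec m), ∀ t ∈ Icc 0 T, ∀ z ∈ S, 𝒢N F t z = jumpGen target rate F t z)
    (h𝒢 : ∀ F ∈ timeSpaceC1 Δ m, ∀ t ∈ Icc 0 T, ∀ z ∈ meanFieldSpace Δ m, 𝒢 F t z = 𝒮.gen F t z)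
    (PN : MarkovLaw T S (timeC1 _) 𝒢N) (P : MarkovLaw T (meanFieldSpace Δ m) (timeSpaceC1 Δ m) 𝒢)
    {t : ℝ} (ht : t ∈ Icc 0 T) {z : Δ × Vec m} (hz : z ∈ S) (hz' : z ∈ meanFieldSpace Δ m) :
    |PN.cost f g t ⟨z, hz⟩ - P.cost f g t ⟨z, hz'⟩|
      ≤ compBound m (Fintype.card R) T κ C A B / √(N : ℝ) := by
  subst hS
  have hmem : ∀ z ∈ empSpace Δ m n N w, z.2 ∈ simplex m := by
    rintro _ ⟨c, rfl⟩
    exact hw.mem c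
  obtain ⟨F, hF, hFg, hFf⟩ := exists_backward_solution_of_finite
    (finite_range fun c : Config Δ m n => (c.1, emp N w c)) (ht.1.trans ht.2) hM.continuousOn_rate
    hM.rate_eq_zero (fun z hz => hfg.continuousOn_time (hmem z hz)) g
  rw [PN.cost_eq_of_backward hF hFg (fun t ht z hz => by rw [h𝒢N F hF t ht z hz, hFf t ht z hz]) ht]
  have hv : IsParticleCost 𝒮 N w T A f g fun t (c : Config Δ m n) => F t (c.1, emp N w c) := by
    refine ⟨fun c => hF _, fun t ht c => ?_, fun c => hFg _ ⟨c, rfl⟩⟩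
    have h1 := hFf t ht _ ⟨c, rfl⟩
    refine le_trans (le_of_eq ?_) (hM.jumpOp_sub_le t ht (F t) c)
    rw [jumpGen] at h1
    congr 1
    linarith
  obtain ⟨c, rfl⟩ := hz
  exact MajorMinor.abs_cost_sub_le hv h𝒮 hw hfg hA hB hκ hC h𝒢 P ht c fun σ σ' hσ => by
    simp only [emp_eq_of_count_eq hσ]

end IsGridModel

end GridGames

/-! ### Empirical distributions and the grid -/

section Grid

variable {m n : ℕ} {Δ : Type*}

theorem exists_count_eq {c : Fin (m + 1) → ℕ} (hc : ∑ a, c a = n) :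
    ∃ σ : Fin n → Fin (m + 1), count σ = c := by
  have hcard : Fintype.card (Σ a, Fin (c a)) = n := by simpa using hc
  set e := (Fintype.equivFinOfCardEq hcard).symm
  refine ⟨fun l => (e l).1, funext fun a => ?_⟩
  rw [count, e.sum_comp fun p => if p.1 = a then 1 else 0, Fintype.sum_sigma]
  refine (Finset.sum_congr rfl fun x _ => (?_ : _ = if x = a then c x else 0)).trans (by simp)
  by_cases h : x = a <;> simp [h]

theorem mem_grid_iff {N : ℕ} {x : Vec m} (d : Δ) :
    x ∈ grid m N ↔ ∃ σ : Fin N → Fin (m + 1), emp N (fun _ => 0) (d, σ) = x := by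
  constructor
  · rintro ⟨c, hc, hx⟩
    obtain ⟨σ, hσ⟩ := exists_count_eq (n := N)
      (c := Fin.lastCases (motive := fun _ => ℕ) (N - ∑ k, c k) c)
      (by rw [Fin.sum_univ_castSucc]; simp only [Fin.lastCases_castSucc, Fin.lastCases_last]; omega)
    refine ⟨σ, PiLp.ext fun k => ?_⟩
    rw [emp_apply, hx, hσ]
    simp [div_eq_inv_mul]
  · rintro ⟨σ, rfl⟩
    refine ⟨fun k => count σ k.castSucc, ?_, fun k => ?_⟩
    · have := sum_count σ
      rw [Fin.sum_univ_castSucc] at this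
      simp only
      omega
    · rw [emp_apply]
      simp [div_eq_inv_mul]

theorem setOf_mem_grid_eq (N : ℕ) :
    {z : Δ × Vec m | z.2 ∈ grid m N} = empSpace Δ m N N fun _ => 0 := by
  ext ⟨d, x⟩
  constructor
  · intro hx
    obtain ⟨σ, rfl⟩ := (mem_grid_iff d).1 hx
    exact ⟨(d, σ), rfl⟩
  · rintro ⟨⟨d', σ⟩, h⟩
    obtain ⟨rfl, rfl⟩ := Prod.ext_iff.1 h
    exact (mem_grid_iff d').2 ⟨σ, rfl⟩

/-- A player of the environment, made a particle. -/
theorem emp_vertex_eq_emp_cons (N : ℕ) (μ : Δ → Fin (m + 1)) (d : Δ) (σ : Fin n → Fin (m + 1)) :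
    emp N (fun d => (vertex (μ d) : Vec m)) (d, σ)
      = emp N (fun _ => 0) (d, (Fin.cons (μ d) σ : Fin (n + 1) → Fin (m + 1))) := by
  simp only [emp, Fin.sum_univ_succ, Fin.cons_zero, Fin.cons_succ, zero_add]

theorem count_cons (a b : Fin (m + 1)) (σ : Fin n → Fin (m + 1)) :
    count (Fin.cons b σ : Fin (n + 1) → Fin (m + 1)) a = (if a = b then 1 else 0) + count σ a := by
  simp only [count, Fin.sum_univ_succ, Fin.cons_zero, Fin.cons_succ, eq_comm (a := a)]

theorem coord_emp_vertex (μ : Δ → Fin (m + 1)) (c : Config Δ m n) (k : Fin (m + 1)) :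
    ((n + 1 : ℕ) : ℝ) * coord (emp (n + 1) (fun d => (vertex (μ d) : Vec m)) c) k
      - (if k = μ c.1 then 1 else 0) = count c.2 k := by
  rw [show c = (c.1, c.2) from rfl, emp_vertex_eq_emp_cons, coord_emp_zero n.succ_pos, count_cons]
  push_cast
  ring

/-- The condition `x_i ≥ 1 / N` says that the singled-out player is one of the players that `x`
counts. -/
theorem setOf_mem_grid_and_le_eq (μ : Δ → Fin (m + 1)) :
    {z : Δ × Vec m | z.2 ∈ grid m (n + 1) ∧ 1 / ((n + 1 : ℕ) : ℝ) ≤ coord z.2 (μ z.1)}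
      = empSpace Δ m n (n + 1) fun d => vertex (μ d) := by
  have hn0 : (0 : ℝ) < (n + 1 : ℕ) := by positivity
  ext ⟨d, x⟩
  constructor
  · rintro ⟨hx, hx1⟩
    obtain ⟨σ, rfl⟩ := (mem_grid_iff d).1 hx
    simp only at hx1
    rw [div_le_iff₀ hn0, mul_comm, coord_emp_zero n.succ_pos] at hx1
    have hpos : 1 ≤ count σ (μ d) := by exact_mod_cast hx1
    obtain ⟨σ', hσ'⟩ := exists_count_eq (n := n)
      (c := fun a => count σ a - if a = μ d then 1 else 0) (by
        rw [Finset.sum_tsub_distrib _ fun a _ => by split_ifs with h <;> simp [h, hpos], sum_count]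
        simp)
    refine ⟨(d, σ'), Prod.ext rfl ?_⟩
    simp only [emp_vertex_eq_emp_cons]
    refine emp_eq_of_count_eq (funext fun a => ?_)
    rw [count_cons, hσ']
    simp only
    split_ifs with h
    · subst h
      omega
    · omega
  · rintro ⟨⟨d', σ⟩, h⟩
    obtain ⟨rfl, rfl⟩ := Prod.ext_iff.1 h
    refine ⟨?_, ?_⟩
    · simp only [emp_vertex_eq_emp_cons]
      exact (mem_grid_iff d').2 ⟨_, rfl⟩
    · have h := coord_emp_vertex μ (d', σ) (μ d')
      rw [if_pos rfl] at h
      simp only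
      rw [div_le_iff₀ hn0, mul_comm]
      have : (0 : ℝ) ≤ count σ (μ d') := Nat.cast_nonneg _
      simp only at h
      linarith

end Grid

/-! ### The major player and a singled-out minor player as environments -/

section Models

variable {m M₀ : ℕ}

/-- Lipschitz Q-matrices. -/
structure IsLipschitzQ {ι : Type*} [Fintype ι] [DecidableEq ι] (T κ : ℝ)
    (q : ℝ → ι → ι → Vec m → ℝ) : Prop where
  isQ : ∀ t ∈ Icc 0 T, ∀ x ∈ simplex m, IsQMatrix fun i j => q t i j x
  lip : ∀ t ∈ Icc 0 T, ∀ t' ∈ Icc 0 T, ∀ i j, ∀ x ∈ simplex m, ∀ x' ∈ simplex m,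
    |q t i j x - q t' i j x'| ≤ κ * (|t - t'| + ‖x - x'‖)

namespace IsLipschitzQ

variable {ι : Type*} [Fintype ι] [DecidableEq ι] {T κ : ℝ} {q : ℝ → ι → ι → Vec m → ℝ}

theorem ite_nonneg (hq : IsLipschitzQ T κ q) {t : ℝ} (ht : t ∈ Icc 0 T) (i j : ι) {x : Vec m}
    (hx : x ∈ simplex m) : 0 ≤ if j = i then 0 else q t i j x := by
  split_ifs with h
  exacts [le_rfl, (hq.isQ t ht x hx).1 i j (Ne.symm h)]

theorem ite_lip (hq : IsLipschitzQ T κ q) (hκ : 0 ≤ κ) {t t' : ℝ} (ht : t ∈ Icc 0 T)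
    (ht' : t' ∈ Icc 0 T) (i j : ι) {x x' : Vec m} (hx : x ∈ simplex m) (hx' : x' ∈ simplex m) :
    |(if j = i then 0 else q t i j x) - if j = i then 0 else q t' i j x'|
      ≤ κ * (|t - t'| + ‖x - x'‖) := by
  split_ifs with h
  · simp only [sub_self, abs_zero]
    positivity
  · exact hq.lip t ht t' ht' i j x hx x' hx'

end IsLipschitzQ

/-- The drift of the mean field flow, in terms of the off-diagonal rates. -/
theorem sum_partialX_eq {Q : Fin (m + 1) → Fin (m + 1) → ℝ} (hQ : IsQMatrix Q) (F : Vec m → ℝ)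
    (x : Vec m) (a : Fin (m + 1) → ℝ) :
    ∑ i, ∑ j : Fin m, partialX F j x * a i * Q i j.castSucc
      = ∑ i, ∑ j, a i * (if j = i then 0 else Q i j) * fderiv ℝ F x (jump i j) := by
  refine Finset.sum_congr rfl fun i _ => ?_
  have h1 : ∑ j : Fin m, partialX F j x * a i * Q i j.castSucc
      = ∑ j, a i * Q i j * fderiv ℝ F x (vertex j) := by
    rw [Fin.sum_univ_castSucc]
    simp only [vertex_castSucc, vertex_last, map_zero, mul_zero, add_zero, partialX]
    exact Finset.sum_congr rfl fun j _ => by ring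
  have h2 : ∑ j, (if j = i then 0 else Q i j) = - Q i i := by
    rw [← hQ.2 i, Finset.sum_filter]
    exact Finset.sum_congr rfl fun j _ => by by_cases h : j = i <;> simp [h]
  have h3 : ∑ j, a i * Q i j * fderiv ℝ F x (vertex j)
      = ∑ j, a i * (if j = i then 0 else Q i j) * fderiv ℝ F x (vertex j)
        + a i * Q i i * fderiv ℝ F x (vertex i) := by
    rw [← Finset.add_sum_erase _ _ (Finset.mem_univ i),
      ← Finset.add_sum_erase (a := i) _
        (fun j => a i * (if j = i then 0 else Q i j) * fderiv ℝ F x (vertex j)) (Finset.mem_univ i)]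
    have : ∑ j ∈ Finset.univ.erase i, a i * (if j = i then 0 else Q i j) * fderiv ℝ F x (vertex j)
        = ∑ j ∈ Finset.univ.erase i, a i * Q i j * fderiv ℝ F x (vertex j) :=
      Finset.sum_congr rfl fun j hj => by rw [if_neg (Finset.ne_of_mem_erase hj)]
    rw [this]
    simp only [if_true]
    ring
  rw [h1, h3]
  simp only [jump, map_sub, mul_sub, Finset.sum_sub_distrib]
  rw [← Finset.sum_mul, ← Finset.mul_sum, h2]
  ring

variable (q₀ : ℝ → Fin M₀ → Fin M₀ → Vec m → ℝ)
  (q q' : ℝ → Fin (m + 1) → Fin (m + 1) → Fin M₀ → Vec m → ℝ)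

/-- The minor players as particles, in the environment of the major player. -/
def majorRates : ParticleRates m (Fin M₀) (Fin M₀) where
  τ j₀ _ := j₀
  r t j₀ i₀ x := if j₀ = i₀ then 0 else q₀ t i₀ j₀ x
  q t i j i₀ x := if j = i then 0 else q t i j i₀ x

/-- The minor players as particles, in the environment of a singled-out minor player and of the
major player. -/
def minorRates : ParticleRates m (Fin (m + 1) × Fin M₀) (Fin M₀ ⊕ Fin (m + 1)) where
  τ
    | .inl j₀, d => (d.1, j₀)
    | .inr j, d => (j, d.2)
  r
    | t, .inl j₀, d, x => if j₀ = d.2 then 0 else q₀ t d.2 j₀ x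
    | t, .inr j, d, x => if j = d.1 then 0 else q' t d.1 j d.2 x
  q t i j d x := if j = i then 0 else q t i j d.2 x

variable {q₀ q q'} {T κ C : ℝ}

theorem regular_majorRates (hq₀ : IsLipschitzQ T κ q₀)
    (hq : ∀ i₀, IsLipschitzQ T κ fun t i j => q t i j i₀)
    (hqC : ∀ t ∈ Icc 0 T, ∀ i j i₀, ∀ x ∈ simplex m, |q t i j i₀ x| ≤ C) (hκ : 0 ≤ κ) (hC : 0 ≤ C) :
    (majorRates q₀ q).Regular T κ C where
  r_nonneg t ht _ _ _ hx := hq₀.ite_nonneg ht _ _ hx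
  q_nonneg t ht _ _ i₀ _ hx := (hq i₀).ite_nonneg ht _ _ hx
  q_le t ht i j i₀ x hx := by
    simp only [majorRates]
    split_ifs
    exacts [hC, (le_abs_self _).trans (hqC t ht i j i₀ x hx)]
  r_lip _ ht _ ht' _ _ _ hx _ hx' := hq₀.ite_lip hκ ht ht' _ _ hx hx'
  q_lip _ ht _ ht' _ _ i₀ _ hx _ hx' := (hq i₀).ite_lip hκ ht ht' _ _ hx hx'

theorem regular_minorRates (hq₀ : IsLipschitzQ T κ q₀)
    (hq : ∀ i₀, IsLipschitzQ T κ fun t i j => q t i j i₀)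
    (hq' : ∀ i₀, IsLipschitzQ T κ fun t i j => q' t i j i₀)
    (hqC : ∀ t ∈ Icc 0 T, ∀ i j i₀, ∀ x ∈ simplex m, |q t i j i₀ x| ≤ C) (hκ : 0 ≤ κ) (hC : 0 ≤ C) :
    (minorRates q₀ q q').Regular T κ C where
  r_nonneg t ht
    | .inl _, _, _, hx => hq₀.ite_nonneg ht _ _ hx
    | .inr _, d, _, hx => (hq' d.2).ite_nonneg ht _ _ hx
  q_nonneg t ht _ _ d _ hx := (hq d.2).ite_nonneg ht _ _ hx
  q_le t ht i j d x hx := by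
    simp only [minorRates]
    split_ifs
    exacts [hC, (le_abs_self _).trans (hqC t ht i j d.2 x hx)]
  r_lip _ ht _ ht'
    | .inl _, _, _, hx, _, hx' => hq₀.ite_lip hκ ht ht' _ _ hx hx'
    | .inr _, d, _, hx, _, hx' => (hq' d.2).ite_lip hκ ht ht' _ _ hx hx'
  q_lip _ ht _ ht' _ _ d _ hx _ hx' := (hq d.2).ite_lip hκ ht ht' _ _ hx hx'

theorem sum_filter_ne_mul {ι : Type*} [Fintype ι] [DecidableEq ι] (i : ι) (a b : ι → ℝ) :
    ∑ j with j ≠ i, a j * b j = ∑ j, (if j = i then 0 else b j) * a j := by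
  rw [Finset.sum_filter]
  refine Finset.sum_congr rfl fun j _ => ?_
  by_cases h : j = i
  · simp [h]
  · simp [h, mul_comm]

/-- The generator of the game with `N` minor players, as a jump process on the grid. -/
theorem majorGenN_eq (N : ℕ) (F : ℝ → Fin M₀ × Vec m → ℝ) (t : ℝ) (z : Fin M₀ × Vec m) :
    majorGenN N q₀ q F t z = jumpGen (gridTarget (majorRates q₀ q) N fun _ => 0)
      (gridRate (majorRates q₀ q) N fun _ _ => 0) F t z := by
  obtain ⟨i₀, x⟩ := z
  rw [jumpGen, jumpOp_grid]
  simp only [majorGenN, majorRates, sub_self, smul_zero, add_zero, sub_zero, sum_filter_ne_mul,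
    add_assoc]
  congr 2
  refine Finset.sum_congr rfl fun i _ => ?_
  exact Finset.sum_congr rfl fun j _ => by ring

theorem majorGen_eq {t : ℝ} {z : Fin M₀ × Vec m} (hQ : IsQMatrix fun i j => q t i j z.1 z.2)
    (F : ℝ → Fin M₀ × Vec m → ℝ) : majorGen q₀ q F t z = (majorRates q₀ q).gen F t z := by
  obtain ⟨i₀, x⟩ := z
  simp only [majorGen, ParticleRates.gen, majorRates, sum_filter_ne_mul]
  rw [sum_partialX_eq hQ]

/-- The generator of the game with `N` minor players and a singled-out minor player, as a jump
process on the grid: when the singled-out player jumps, so does the distribution. -/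
theorem minorGenN_eq (N : ℕ) (F : ℝ → (Fin (m + 1) × Fin M₀) × Vec m → ℝ) (t : ℝ)
    (z : (Fin (m + 1) × Fin M₀) × Vec m) :
    minorGenN N q₀ q q' F t z
      = jumpGen (gridTarget (minorRates q₀ q q') N fun d => vertex d.1)
          (gridRate (minorRates q₀ q q') N fun d k => if k = d.1 then 1 else 0) F t z := by
  obtain ⟨⟨i, i₀⟩, x⟩ := z
  rw [jumpGen, jumpOp_grid]
  simp only [minorGenN, minorRates, sub_self, smul_zero, add_zero, sum_filter_ne_mul,
    Fintype.sum_sum_type, add_assoc, jump]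
  congr 3
  refine Finset.sum_congr rfl fun k _ => ?_
  exact Finset.sum_congr rfl fun j _ => by ring

theorem minorGen_eq {t : ℝ} {z : (Fin (m + 1) × Fin M₀) × Vec m}
    (hQ : IsQMatrix fun i j => q t i j z.1.2 z.2) (F : ℝ → (Fin (m + 1) × Fin M₀) × Vec m → ℝ) :
    minorGen q₀ q q' F t z = (minorRates q₀ q q').gen F t z := by
  obtain ⟨⟨i, i₀⟩, x⟩ := z
  simp only [minorGen, ParticleRates.gen, minorRates, sum_filter_ne_mul, Fintype.sum_sum_type]
  rw [sum_partialX_eq hQ]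
  ring

end Models

/-! ### Feedback functions -/

section Feedback

variable {m M₀ : ℕ} {T K : ℝ} {U₀ U : Type*} [NormedAddCommGroup U₀] [NormedSpace ℝ U₀]
    [NormedAddCommGroup U] [NormedSpace ℝ U] {G : Game m M₀ T U₀ U}
    {φ₀ : ℝ → Fin M₀ → Vec m → U₀} {φ φ' : ℝ → Fin (m + 1) → Fin M₀ → Vec m → U}

/-- Lipschitz constant of the data with the feedback functions inserted. -/
def feedbackLip (K : ℝ) : ℝ := |K| * (1 + 2 * |K|)

theorem feedbackLip_nonneg (K : ℝ) : 0 ≤ feedbackLip K := by unfold feedbackLip; positivity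

theorem mul_add_le_feedbackLip_mul {K s a₀ a : ℝ} (hs : 0 ≤ s) (ha₀ : a₀ ≤ K * s) (ha : a ≤ K * s)
    (ha₀' : 0 ≤ a₀) (ha' : 0 ≤ a) : K * (s + a₀ + a) ≤ feedbackLip K * s := by
  have hK := le_abs_self K
  calc K * (s + a₀ + a) ≤ |K| * (s + |K| * s + |K| * s) := by
        have h1 : a₀ ≤ |K| * s := ha₀.trans (by gcongr)
        have h2 : a ≤ |K| * s := ha.trans (by gcongr)
        gcongr
    _ = feedbackLip K * s := by rw [feedbackLip]; ring

theorem isLipschitzQ_q₀Of (hG : G.LipschitzData K) (hφ₀ : G.IsMajorFeedback K φ₀)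
    (hφ : G.IsMinorFeedback K φ) : IsLipschitzQ T (feedbackLip K) (G.q₀Of φ₀) where
  isQ t ht x hx := by
    refine ⟨fun i₀ j₀ => (G.isQ_q₀ t ht _ (hφ₀.1 t ht i₀ x hx) x hx).1 i₀ j₀, fun i₀ =>
      (G.isQ_q₀ t ht _ (hφ₀.1 t ht i₀ x hx) x hx).2 i₀⟩
  lip t ht t' ht' i₀ j₀ x hx x' hx' := by
    have h := (hG t ht t' ht' x hx x' hx' _ (hφ₀.1 t ht i₀ x hx) _ (hφ₀.1 t' ht' i₀ x' hx') _
      (hφ.1 t ht 0 i₀ x hx) _ (hφ.1 t' ht' 0 i₀ x' hx') 0 0 i₀ j₀).2.2.2.1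
    have h' := mul_add_le_feedbackLip_mul (a := 0) (K := K) (by positivity)
      (hφ₀.2 t ht t' ht' x hx x' hx' i₀)
      ((norm_nonneg _).trans (hφ₀.2 t ht t' ht' x hx x' hx' i₀)) (norm_nonneg _) le_rfl
    rw [add_zero] at h'
    exact h.trans h'

theorem isLipschitzQ_qOf (hG : G.LipschitzData K) (hφ₀ : G.IsMajorFeedback K φ₀)
    (hφ : G.IsMinorFeedback K φ) (i₀ : Fin M₀) :
    IsLipschitzQ T (feedbackLip K) fun t i j => G.qOf φ₀ φ t i j i₀ where
  isQ t ht x hx := by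
    refine ⟨fun i j => (G.isQ_q t ht _ (hφ.1 t ht i i₀ x hx) i₀ _ (hφ₀.1 t ht i₀ x hx) x hx).1 i j,
      fun i => (G.isQ_q t ht _ (hφ.1 t ht i i₀ x hx) i₀ _ (hφ₀.1 t ht i₀ x hx) x hx).2 i⟩
  lip t ht t' ht' i j x hx x' hx' :=
    (hG t ht t' ht' x hx x' hx' _ (hφ₀.1 t ht i₀ x hx) _ (hφ₀.1 t' ht' i₀ x' hx') _
      (hφ.1 t ht i i₀ x hx) _ (hφ.1 t' ht' i i₀ x' hx') i j i₀ i₀).2.1.trans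
      (mul_add_le_feedbackLip_mul (by positivity) (hφ₀.2 t ht t' ht' x hx x' hx' i₀)
        (hφ.2 t ht t' ht' x hx x' hx' i i₀) (norm_nonneg _) (norm_nonneg _))

theorem mul_le_feedbackLip_mul {K s : ℝ} (hs : 0 ≤ s) : K * s ≤ feedbackLip K * s := by
  have h : |K| ≤ feedbackLip K := by
    rw [feedbackLip]
    nlinarith [abs_nonneg K]
  exact mul_le_mul_of_nonneg_right ((le_abs_self K).trans h) hs

theorem costRegular_major {B : ℝ} (hT : 0 ≤ T) (hG : G.LipschitzData K)
    (hφ₀ : G.IsMajorFeedback K φ₀) (hφ' : G.IsMinorFeedback K φ') (hB : G.CostBound B φ₀ φ') :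
    CostRegular T (feedbackLip K) |B| (G.f₀Of φ₀) fun z => G.g₀ z.1 z.2 where
  f_lip t ht t' ht' i₀ x hx x' hx' := by
    have h := (hG t ht t' ht' x hx x' hx' _ (hφ₀.1 t ht i₀ x hx) _ (hφ₀.1 t' ht' i₀ x' hx') _
      (hφ'.1 t ht 0 i₀ x hx) _ (hφ'.1 t' ht' 0 i₀ x' hx') 0 0 i₀ i₀).2.2.1
    have h' := mul_add_le_feedbackLip_mul (a := 0) (K := K) (by positivity)
      (hφ₀.2 t ht t' ht' x hx x' hx' i₀)
      ((norm_nonneg _).trans (hφ₀.2 t ht t' ht' x hx x' hx' i₀)) (norm_nonneg _) le_rfl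
    rw [add_zero] at h'
    exact h.trans h'
  f_le t ht i₀ x hx := (hB t ht 0 i₀ x hx).1.trans (le_abs_self B)
  g_lip i₀ x hx x' hx' := by
    have h0 : (0 : ℝ) ∈ Icc 0 T := ⟨le_rfl, hT⟩
    exact (hG 0 h0 0 h0 x hx x' hx' _ (hφ₀.1 0 h0 i₀ x hx) _ (hφ₀.1 0 h0 i₀ x' hx') _
      (hφ'.1 0 h0 0 i₀ x hx) _ (hφ'.1 0 h0 0 i₀ x' hx') 0 0 i₀ i₀).2.2.2.2.2.trans
      (mul_le_feedbackLip_mul (norm_nonneg _))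
  g_le i₀ x hx := (hB 0 ⟨le_rfl, hT⟩ 0 i₀ x hx).2.2.1.trans (le_abs_self B)

theorem costRegular_minor {B : ℝ} (hT : 0 ≤ T) (hG : G.LipschitzData K)
    (hφ₀ : G.IsMajorFeedback K φ₀) (hφ' : G.IsMinorFeedback K φ') (hB : G.CostBound B φ₀ φ') :
    CostRegular T (feedbackLip K) |B| (G.fOf φ₀ φ') fun z => G.g z.1.1 z.1.2 z.2 where
  f_lip t ht t' ht' d x hx x' hx' :=
    (hG t ht t' ht' x hx x' hx' _ (hφ₀.1 t ht d.2 x hx) _ (hφ₀.1 t' ht' d.2 x' hx') _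
      (hφ'.1 t ht d.1 d.2 x hx) _ (hφ'.1 t' ht' d.1 d.2 x' hx') d.1 d.1 d.2 d.2).1.trans
      (mul_add_le_feedbackLip_mul (by positivity) (hφ₀.2 t ht t' ht' x hx x' hx' d.2)
        (hφ'.2 t ht t' ht' x hx x' hx' d.1 d.2) (norm_nonneg _) (norm_nonneg _))
  f_le t ht d x hx := (hB t ht d.1 d.2 x hx).2.1.trans (le_abs_self B)
  g_lip d x hx x' hx' := by
    have h0 : (0 : ℝ) ∈ Icc 0 T := ⟨le_rfl, hT⟩
    exact (hG 0 h0 0 h0 x hx x' hx' _ (hφ₀.1 0 h0 d.2 x hx) _ (hφ₀.1 0 h0 d.2 x' hx') _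
      (hφ'.1 0 h0 d.1 d.2 x hx) _ (hφ'.1 0 h0 d.1 d.2 x' hx') d.1 d.1 d.2 d.2).2.2.2.2.1.trans
      (mul_le_feedbackLip_mul (norm_nonneg _))
  g_le d x hx := (hB 0 ⟨le_rfl, hT⟩ d.1 d.2 x hx).2.2.2.trans (le_abs_self B)

theorem abs_qOf_le {C : ℝ} (hC : G.RateBound C) (hφ₀ : G.IsMajorFeedback K φ₀)
    (hφ : G.IsMinorFeedback K φ) : ∀ t ∈ Icc 0 T, ∀ i j i₀, ∀ x ∈ simplex m,
      |G.qOf φ₀ φ t i j i₀ x| ≤ |C| := fun t ht i j i₀ x hx =>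
  (hC t ht i j _ (hφ.1 t ht i i₀ x hx) i₀ _ (hφ₀.1 t ht i₀ x hx) x hx).trans (le_abs_self C)

theorem qOf_eq_zero (hG : G.NoExtinction) (hφ₀ : G.IsMajorFeedback K φ₀)
    (hφ : G.IsMinorFeedback K φ) {t : ℝ} (ht : t ∈ Icc 0 T) {i j : Fin (m + 1)} (hij : j ≠ i)
    (i₀ : Fin M₀) {x : Vec m} (hx : x ∈ simplex m) (hxi : coord x i = 0) :
    G.qOf φ₀ φ t i j i₀ x = 0 := by
  obtain ⟨ε, hε, h⟩ := hG
  exact h t ht i j hij.symm _ (hφ.1 t ht i i₀ x hx) i₀ _ (hφ₀.1 t ht i₀ x hx) x hx (by rwa [hxi])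

theorem compBound_nonneg {k : ℕ} {T κ C A B : ℝ} (hT : 0 ≤ T) (hA : 0 ≤ A) (hB : 0 ≤ B)
    (hκ : 0 ≤ κ) : 0 ≤ compBound m k T κ C A B := by
  unfold compBound genBound lipBound costBound
  positivity

end Feedback

end MajorMinor

end

theorem mainTheorem3 (m M₀ : ℕ) (T K C B : ℝ) (hT : 0 < T) :
    ∃ L : ℝ, ∀ (U₀ U : Type*) [NormedAddCommGroup U₀] [NormedSpace ℝ U₀]
      [NormedAddCommGroup U] [NormedSpace ℝ U] (G : Game m M₀ T U₀ U)
      (φ₀ : ℝ → Fin M₀ → Vec m → U₀) (φ φ' : ℝ → Fin (m + 1) → Fin M₀ → Vec m → U),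
      G.LipschitzData K → G.RateBound C →
      G.IsMajorFeedback K φ₀ → G.IsMinorFeedback K φ → G.IsMinorFeedback K φ' →
      G.CostBound B φ₀ φ' →
      Nonempty (G.MajorLaw φ₀ φ) ∧ Nonempty (G.MinorLaw φ₀ φ φ') ∧
      ∀ N : ℕ, 0 < N →
        (Nonempty (G.MajorLawN N φ₀ φ) ∧
          ∀ (PN : G.MajorLawN N φ₀ φ) (P : G.MajorLaw φ₀ φ), ∀ t ∈ Set.Icc 0 T,
          ∀ (i₀ : Fin M₀) (x : Vec m) (hx : x ∈ grid m N),
            |PN.cost (G.f₀Of φ₀) (fun z => G.g₀ z.1 z.2) t ⟨(i₀, x), hx⟩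
              - P.cost (G.f₀Of φ₀) (fun z => G.g₀ z.1 z.2) t ⟨(i₀, x), grid_subset_simplex hx⟩|
              ≤ L / √(N : ℝ)) ∧
        ∀ (S : Set ((Fin (m + 1) × Fin M₀) × Vec m)) (hS : G.IsMinorStateSpace N S),
          Nonempty (G.MinorLawN N S φ₀ φ φ') ∧
          ∀ (PN : G.MinorLawN N S φ₀ φ φ') (P : G.MinorLaw φ₀ φ φ'), ∀ t ∈ Set.Icc 0 T,
          ∀ (i : Fin (m + 1)) (i₀ : Fin M₀) (x : Vec m) (hx : ((i, i₀), x) ∈ S),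
            |PN.cost (G.fOf φ₀ φ') (fun z => G.g z.1.1 z.1.2 z.2) t ⟨((i, i₀), x), hx⟩
              - P.cost (G.fOf φ₀ φ') (fun z => G.g z.1.1 z.1.2 z.2) t
                  ⟨((i, i₀), x), hS.mem_simplex hx⟩|
              ≤ L / √(N : ℝ) := by
  set κ := feedbackLip K
  have hκ : 0 ≤ κ := feedbackLip_nonneg K
  have hC0 := abs_nonneg C
  have hB0 := abs_nonneg B
  set k₀ := Fintype.card (Fin M₀)
  set k := Fintype.card (Fin M₀ ⊕ Fin (m + 1))
  set A : ℝ := (k + (m + 1)) * |C|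
  have hA0 : 0 ≤ A := by positivity
  have hL₀ := compBound_nonneg (m := m) (k := k₀) (C := |C|) hT.le le_rfl hB0 hκ
  have hL₁ := compBound_nonneg (m := m) (k := k) (C := |C|) hT.le le_rfl hB0 hκ
  have hL₂ := compBound_nonneg (m := m) (k := k) (C := |C|) hT.le hA0 hB0 hκ
  set L₀ := compBound m k₀ T κ |C| 0 |B|
  set L₁ := compBound m k T κ |C| 0 |B|
  set L₂ := compBound m k T κ |C| A |B|
  refine ⟨L₀ + L₁ + L₂, fun U₀ U _ _ _ _ G φ₀ φ φ' hG hGC hφ₀ hφ hφ' hGB => ?_⟩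
  have hq₀ := isLipschitzQ_q₀Of hG hφ₀ hφ
  have hq := isLipschitzQ_qOf hG hφ₀ hφ
  have hq' := isLipschitzQ_qOf hG hφ₀ hφ'
  have hqC := abs_qOf_le hGC hφ₀ hφ
  have h𝒮₀ := regular_majorRates hq₀ hq hqC hκ hC0
  have h𝒮 := regular_minorRates hq₀ hq hq' hqC hκ hC0
  have hfg₀ := costRegular_major hT.le hG hφ₀ hφ' hGB
  have hfg := costRegular_minor hT.le hG hφ₀ hφ' hGB
  have h𝒢₀ : ∀ F ∈ timeSpaceC1 (Fin M₀) m, ∀ t ∈ Set.Icc 0 T, ∀ z ∈ meanFieldSpace (Fin M₀) m,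
      majorGen (G.q₀Of φ₀) (G.qOf φ₀ φ) F t z
        = (majorRates (G.q₀Of φ₀) (G.qOf φ₀ φ)).gen F t z := fun F _ t ht z hz =>
    majorGen_eq ((hq z.1).isQ t ht z.2 hz) F
  have h𝒢 : ∀ F ∈ timeSpaceC1 (Fin (m + 1) × Fin M₀) m, ∀ t ∈ Set.Icc 0 T,
      ∀ z ∈ meanFieldSpace (Fin (m + 1) × Fin M₀) m,
      minorGen (G.q₀Of φ₀) (G.qOf φ₀ φ) (G.qOf φ₀ φ') F t z
        = (minorRates (G.q₀Of φ₀) (G.qOf φ₀ φ) (G.qOf φ₀ φ')).gen F t z := fun F _ t ht z hz =>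
    minorGen_eq ((hq z.1.2).isQ t ht z.2 hz) F
  refine ⟨(h𝒮₀.nonempty_markovLaw hκ hC0 hT.le).map fun P => P.congr h𝒢₀,
    (h𝒮.nonempty_markovLaw hκ hC0 hT.le).map fun P => P.congr h𝒢, fun N hN => ⟨?_, ?_⟩⟩
  · have hM := isGridModel_of_count h𝒮₀ (isWeight_zero hN) (ν := fun _ _ => 0) fun c k => by
      rw [coord_emp_zero hN c, sub_zero]
    have h𝒢N : ∀ F ∈ timeC1 (Fin M₀ × Vec m), ∀ t ∈ Set.Icc 0 T,
        ∀ z ∈ {z : Fin M₀ × Vec m | z.2 ∈ grid m N}, _ := fun F _ t _ z _ =>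
      majorGenN_eq (q₀ := G.q₀Of φ₀) (q := G.qOf φ₀ φ) N F t z
    refine ⟨(hM.nonempty_markovLaw hT.le (setOf_mem_grid_eq N)).map fun P => P.congr h𝒢N,
      fun PN P t ht i₀ x hx => ?_⟩
    refine (hM.abs_cost_sub_le h𝒮₀ (isWeight_zero hN) (setOf_mem_grid_eq N) hfg₀ le_rfl hB0 hκ hC0
      h𝒢N h𝒢₀ PN P ht hx (grid_subset_simplex hx)).trans ?_
    gcongr
    change L₀ ≤ _
    linarith
  · rintro S hS
    have h𝒢N : ∀ F ∈ timeC1 ((Fin (m + 1) × Fin M₀) × Vec m), ∀ t ∈ Set.Icc 0 T, ∀ z ∈ S, _ :=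
      fun F _ t _ z _ => minorGenN_eq (q₀ := G.q₀Of φ₀) (q := G.qOf φ₀ φ) (q' := G.qOf φ₀ φ') N F t z
    have hS' := hS
    rcases hS' with hS' | ⟨hGε, hS'⟩
    · -- the singled-out player belongs to the environment
      obtain ⟨n, rfl⟩ := Nat.exists_eq_add_one.2 hN
      have hw := isWeight_vertex (m := m) (n := n) fun d : Fin (m + 1) × Fin M₀ => d.1
      have hM := isGridModel_of_count h𝒮 hw (ν := fun d k => if k = d.1 then 1 else 0)
        (coord_emp_vertex fun d : Fin (m + 1) × Fin M₀ => d.1)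
      have hSe := hS'.trans (setOf_mem_grid_and_le_eq fun d : Fin (m + 1) × Fin M₀ => d.1)
      refine ⟨(hM.nonempty_markovLaw hT.le hSe).map fun P => P.congr h𝒢N,
        fun PN P t ht i i₀ x hx => ?_⟩
      refine (hM.abs_cost_sub_le h𝒮 hw hSe hfg le_rfl hB0 hκ hC0
        h𝒢N h𝒢 PN P ht hx (hS.mem_simplex hx)).trans ?_
      gcongr
      change L₁ ≤ _
      linarith
    · -- all players are particles
      have hM := isGridModel_of_extinction h𝒮 hC0 hN (fun d : Fin (m + 1) × Fin M₀ => d.1) (by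
          rintro t ht (j₀ | j) d x hx hμ
          · exact absurd rfl hμ
          · simp only [minorRates]
            rw [if_neg (show j ≠ d.1 from hμ)]
            exact (le_abs_self _).trans (abs_qOf_le hGC hφ₀ hφ' t ht _ _ _ x hx)) (by
          rintro t ht (j₀ | j) d x hx hμ h0
          · exact absurd rfl hμ
          · simp only [minorRates]
            have hj : j ≠ d.1 := hμ
            rw [if_neg hj]
            exact qOf_eq_zero hGε hφ₀ hφ' ht hj d.2 hx h0) (by
          intro t ht i j d x hx h0
          simp only [minorRates]
          split_ifs with h
          exacts [rfl, qOf_eq_zero hGε hφ₀ hφ ht h d.2 hx h0])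
      have hSe := hS'.trans (setOf_mem_grid_eq N)
      refine ⟨(hM.nonempty_markovLaw hT.le hSe).map fun P => P.congr h𝒢N,
        fun PN P t ht i i₀ x hx => ?_⟩
      refine (hM.abs_cost_sub_le h𝒮 (isWeight_zero hN) hSe hfg hA0 hB0 hκ hC0
        h𝒢N h𝒢 PN P ht hx (hS.mem_simplex hx)).trans ?_
      gcongr
      change L₂ ≤ _
      linarith
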